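/- Let $d\in\mathbb N$ and let $X$ be a random vector in $\mathbb R^d$ with density $f:\mathbb R^d\to[0,\infty)$ with respect to Lebesgue measure. Assume that $X$ is isotropic, i.e. $\mathbb E[X]=0$ and $\mathbb E[X_iX_j]=\delta_{ij}$ for $1\le i,j\le d$, and log-concave, i.e. $-\log f$ is convex on $\mathbb R^d$ (with values in $(-\infty,+\infty]$, where $-\log 0=+\infty$). Assume moreover that $f$ satisfies a Poincaré inequality with constant $c>0$: $$c\int_{\mathbb R^d} f\,s^2\,dx\le\int_{\mathbb R^d} f\,|\nabla s|^2\,dx$$ for every smooth function $s:\mathbb R^d\to\mathbb R$ such that $fs$, $fs^2$ and $f|\nabla s|^2$ are integrable and $\int_{\mathbb R^d} f s\,dx=0$. Let $Y$ be an independent copy of $X$ and let $G$ be a standard Gaussian vector in $\mathbb R^d$. For a random vector $Z$ in $\mathbb R^d$ with density $p$ write $\operatorname{Ent}(Z)=-\int_{\mathbb R^d}p\log p\,dx$. Then $X$, $\frac{X+Y}{\sqrt2}$ and $G$ have densities and finite entropy (the defining integrals converge absolutely), and $$\operatorname{Ent}\Big(\frac{X+Y}{\sqrt2}\Big)-\operatorname{Ent}(X)\;\ge\;\frac{c}{4(1+c)}\,\bigl(\operatorname{Ent}(G)-\operatorname{Ent}(X)\bigr).$$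 -/

import Mathlib

open MeasureTheory ProbabilityTheory

namespace EntropyJump

/-- `f : ℝᵈ → [0, ∞)` is a (Lebesgue) density of the random vector `X`. -/
structure HasDensity {d : ℕ} {Ω : Type*} [MeasurableSpace Ω]
    (X : Ω → EuclideanSpace ℝ (Fin d)) (μ : Measure Ω)
    (f : EuclideanSpace ℝ (Fin d) → ℝ) : Prop where
  aemeasurable : AEMeasurable X μ
  aemeasurable_density : AEMeasurable f volume
  nonneg : ∀ x, 0 ≤ f x
  map_eq : μ.map X = volume.withDensity (fun x => ENNReal.ofReal (f x))

/-- `f ≥ 0` is log-concave: `-log f`, with the convention `-log 0 = +∞`, is a convex function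
on `ℝᵈ` with values in `(-∞, +∞]`; that is, its domain `{f > 0}` is convex (this is part of
`ConvexOn`) and `-log f` is convex there. -/
def IsLogConcave {d : ℕ} (f : EuclideanSpace ℝ (Fin d) → ℝ) : Prop :=
  (∀ x, 0 ≤ f x) ∧ ConvexOn ℝ {x | 0 < f x} (fun x => -Real.log (f x))

/-- `X` is isotropic: it is centered and its covariance matrix is the identity. -/
structure IsIsotropic {d : ℕ} {Ω : Type*} [MeasurableSpace Ω]
    (X : Ω → EuclideanSpace ℝ (Fin d)) (μ : Measure Ω) : Prop where
  memLp_two : MemLp X 2 μ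
  mean_eq_zero : ∫ ω, X ω ∂μ = 0
  covariance_eq_one : ∀ i j : Fin d, ∫ ω, X ω i * X ω j ∂μ = if i = j then 1 else 0

/-- The density `f` satisfies the Poincaré (spectral gap) inequality with constant `c`:
`c ∫ f s² ≤ ∫ f |∇s|²` for every smooth `s` with `∫ f s = 0` for which these three integrals
converge absolutely (so that no integral below takes a default value). -/
def SatisfiesPoincare {d : ℕ} (f : EuclideanSpace ℝ (Fin d) → ℝ) (c : ℝ) : Prop :=
  ∀ s : EuclideanSpace ℝ (Fin d) → ℝ, ContDiff ℝ (↑(⊤ : ℕ∞)) s →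
    Integrable (fun x => f x * s x) →
    Integrable (fun x => f x * s x ^ 2) →
    Integrable (fun x => f x * ‖gradient s x‖ ^ 2) →
    ∫ x, f x * s x = 0 →
    c * ∫ x, f x * s x ^ 2 ≤ ∫ x, f x * ‖gradient s x‖ ^ 2

/-- The entropy `Ent(X) = -∫ p log p`, where `p` is the density of `X`. -/
noncomputable def entropy {d : ℕ} {Ω : Type*} [MeasurableSpace Ω]
    (X : Ω → EuclideanSpace ℝ (Fin d)) (μ : Measure Ω) : ℝ :=
  -∫ x, (pdf X μ volume x).toReal * Real.log (pdf X μ volume x).toReal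

/-- `X` has a density `p`, and the integral defining `Ent(X) = -∫ p log p` converges
absolutely, so that `entropy X μ` is the true (finite) entropy. -/
def HasFiniteEntropy {d : ℕ} {Ω : Type*} [MeasurableSpace Ω]
    (X : Ω → EuclideanSpace ℝ (Fin d)) (μ : Measure Ω) : Prop :=
  HasPDF X μ volume ∧
    Integrable (fun x => (pdf X μ volume x).toReal * Real.log (pdf X μ volume x).toReal)

end EntropyJump

/-! Let both laws evolve under the heat flow: P, the law of X, and the law of (X+Y)/√2, written
`selfConv P`. At time t let E₁, E₂ be the entropies of the two flows, J₁, J₂ the traces of their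
Fisher matrices, and K₁, K₂ the integrals ∫ u |Hess log u|². De Bruijn's identity gives E' = J/2
(`hasDerivAt_flowEntropy`), and one more differentiation gives J' = -K (`hasDerivAt_fisher`). A
bound on K₁ - K₂ therefore becomes a bound on E₂ - E₁ by integrating back from t = ∞, where both
flows look Gaussian.

Comparison of K₁ and K₂. Write H for the Hessian of -log u along P and H₂ for that of the
self-convolution. Conditionally on x + y = √2 w, H₂(w) is the mean of (H(x) + H(y))/2 minus half the
covariance matrix of the sum of the scores at x and y. Log-concavity survives convolution
(Prékopa–Leindler, `MidLogConcave.conv`), so H₂ is positive semidefinite. Pairing the identity with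
H₂ drops the covariance, and Cauchy–Schwarz bounds tr H₂² by the conditional mean of |(H(x) +
H(y))/2|². Integrating over w gives K₂ ≤ (K₁ + |I|²)/2, with I = ∫ u H the Fisher matrix
(`sum_hessSq_selfConv_le`). The gain is half the variance of H.

The Poincaré inequality bounds this variance from below. The flow of an isotropic P satisfies it
with constant c/(1+t) (`SatisfiesLipPoincare.heatFlow`). The test functions are ∂ᵢ log u + Σⱼ Iᵢⱼ
xⱼ, whose gradient is the i-th row of I - H; isotropy evaluates their L² norms. The result is
(1+c)|I|² ≤ K₁ + c J₁/(1+t) (`sum_fisher_sq_le`), hence K₁ - K₂ ≥ θ (K₁ - J₁/(1+t)) with θ =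
c/(2(1+c)).

A one-variable argument (`entropy_jump_of_dissipation`) turns this into E₂ - E₁ ≥ (θ/2)(g - E₁) for
every t > 0, where g(t) is the entropy of a Gaussian of covariance 1+t; this explains the constant
c/(4(1+c)).

At t → 0 only one-sided information is needed: convolution raises entropy, so E₁(t) ≥ Ent X, and
g(t) ≥ Ent G. The entropy of (X+Y)/√2 is at least any uniform lower bound of E₂, by Fatou's lemma
applied to relative entropy (`IsBoundedDensity.le_of_forall_le_flowEntropy`). That step uses a
continuous bounded density of (X+Y)/√2, which log-concavity of f supplies.

All interchanges of derivative and integral rest on one estimate, `exists_heatMaj_pow_le`: every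
quotient ∂u/u up to third order is bounded by a multiple of a majorant R, and u R⁴ is dominated,
locally uniformly in time, by the heat flow at one later time. -/

namespace EntropyJump

/-! ### The Gaussian kernel: space derivatives up to order three and the heat equation -/

section HeatKernel

open Real InnerProductSpace

variable {d : ℕ}

local notation "𝔼" => EuclideanSpace ℝ (Fin d)

/-- The standard basis vectors. -/
noncomputable abbrev stdVec (i : Fin d) : 𝔼 := EuclideanSpace.single i 1

lemma inner_stdVec (i : Fin d) (z : 𝔼) : inner ℝ (stdVec i) z = z i := by
  simp [stdVec, EuclideanSpace.inner_single_left]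

lemma norm_stdVec (i : Fin d) : ‖(stdVec i : 𝔼)‖ = 1 := by simp [stdVec]

/-- The Gaussian density with covariance `t • 1`. -/
noncomputable def heatKernel (t : ℝ) (z : 𝔼) : ℝ :=
  exp (-‖z‖ ^ 2 / (2 * t) - d / 2 * log (2 * π * t))

/-- First directional derivative of the heat kernel. -/
noncomputable def heatKernel₁ (t : ℝ) (ξ z : 𝔼) : ℝ :=
  -(inner ℝ ξ z / t) * heatKernel t z

/-- Second directional derivative of the heat kernel. -/
noncomputable def heatKernel₂ (t : ℝ) (ξ η z : 𝔼) : ℝ :=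
  (inner ℝ ξ z * inner ℝ η z / t ^ 2 - inner ℝ ξ η / t) * heatKernel t z

/-- Third directional derivative of the heat kernel. -/
noncomputable def heatKernel₃ (t : ℝ) (ξ η ζ z : 𝔼) : ℝ :=
  (-(inner ℝ ξ z * inner ℝ η z * inner ℝ ζ z / t ^ 3) +
    (inner ℝ ξ η * inner ℝ ζ z + inner ℝ ξ ζ * inner ℝ η z + inner ℝ η ζ * inner ℝ ξ z) / t ^ 2) *
    heatKernel t z

lemma heatKernel_pos (t : ℝ) (z : 𝔼) : 0 < heatKernel t z := exp_pos _

lemma contDiff_heatKernel (t : ℝ) {n : WithTop ℕ∞} :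
    ContDiff ℝ n (heatKernel t : 𝔼 → ℝ) := by
  unfold heatKernel
  have : ContDiff ℝ n (fun z : 𝔼 => ‖z‖ ^ 2) := contDiff_norm_sq ℝ
  fun_prop

lemma contDiff_inner_left (ξ : 𝔼) {n : WithTop ℕ∞} :
    ContDiff ℝ n (fun z : 𝔼 => inner ℝ ξ z) :=
  (innerSL ℝ ξ).contDiff

lemma contDiff_heatKernel₁ (t : ℝ) (ξ : 𝔼) {n : WithTop ℕ∞} :
    ContDiff ℝ n (heatKernel₁ t ξ) := by
  unfold heatKernel₁
  have h1 := contDiff_inner_left ξ (n := n)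
  have := contDiff_heatKernel (d := d) t (n := n)
  fun_prop

lemma contDiff_heatKernel₂ (t : ℝ) (ξ η : 𝔼) {n : WithTop ℕ∞} :
    ContDiff ℝ n (heatKernel₂ t ξ η) := by
  unfold heatKernel₂
  have h1 := contDiff_inner_left ξ (n := n)
  have h2 := contDiff_inner_left η (n := n)
  have := contDiff_heatKernel (d := d) t (n := n)
  fun_prop

lemma contDiff_heatKernel₃ (t : ℝ) (ξ η ζ : 𝔼) {n : WithTop ℕ∞} :
    ContDiff ℝ n (heatKernel₃ t ξ η ζ) := by
  unfold heatKernel₃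
  have h1 := contDiff_inner_left ξ (n := n)
  have h2 := contDiff_inner_left η (n := n)
  have h3 := contDiff_inner_left ζ (n := n)
  have := contDiff_heatKernel (d := d) t (n := n)
  fun_prop

lemma hasFDerivAt_heatKernel (t : ℝ) (z : 𝔼) :
    HasFDerivAt (heatKernel t) ((-(heatKernel t z / t)) • innerSL ℝ z) z := by
  have h1 : HasFDerivAt (fun z : 𝔼 => ‖z‖ ^ 2) (2 • innerSL ℝ z) z := by
    simpa using (hasStrictFDerivAt_norm_sq z).hasFDerivAt
  have h2 := ((h1.const_mul (-(2 * t)⁻¹)).sub_const (d / 2 * log (2 * π * t))).exp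
  have e : (heatKernel t : 𝔼 → ℝ) =
      fun z => exp (-(2 * t)⁻¹ * ‖z‖ ^ 2 - d / 2 * log (2 * π * t)) := by
    ext z; simp only [heatKernel]; ring_nf
  rw [e]
  refine h2.congr_fderiv ?_
  ext η
  simp only [FunLike.coe_smul, Pi.smul_apply, smul_eq_mul, innerSL_apply_apply]
  rcases eq_or_ne t 0 with rfl | ht
  · simp
  · field_simp
    simp

lemma fderiv_heatKernel (t : ℝ) (z η : 𝔼) :
    fderiv ℝ (heatKernel t) z η = heatKernel₁ t η z := by
  rw [(hasFDerivAt_heatKernel t z).fderiv]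
  simp only [FunLike.coe_smul, Pi.smul_apply, innerSL_apply_apply, smul_eq_mul,
    heatKernel₁, real_inner_comm]
  ring

lemma hasFDerivAt_inner_left (ξ z : 𝔼) :
    HasFDerivAt (fun z : 𝔼 => inner ℝ ξ z) (innerSL ℝ ξ) z :=
  (innerSL ℝ ξ).hasFDerivAt

lemma fderiv_heatKernel₁ (t : ℝ) (ξ z η : 𝔼) :
    fderiv ℝ (heatKernel₁ t ξ) z η = heatKernel₂ t ξ η z := by
  have h := ((hasFDerivAt_inner_left ξ z).const_mul (-t⁻¹)).mul (hasFDerivAt_heatKernel t z)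
  have h' : HasFDerivAt (heatKernel₁ t ξ) _ z :=
    h.congr_of_eventuallyEq (Filter.Eventually.of_forall fun z => by
      simp only [heatKernel₁, Pi.mul_apply]; ring)
  rw [h'.fderiv]
  simp only [FunLike.coe_smul, Pi.smul_apply, innerSL_apply_apply, smul_eq_mul,
    heatKernel₂, FunLike.coe_add, Pi.add_apply, real_inner_comm]
  ring

lemma fderiv_heatKernel₂ (t : ℝ) (ξ η z ζ : 𝔼) :
    fderiv ℝ (heatKernel₂ t ξ η) z ζ = heatKernel₃ t ξ η ζ z := by
  have h := ((((hasFDerivAt_inner_left ξ z).mul (hasFDerivAt_inner_left η z)).const_mul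
    ((t ^ 2)⁻¹)).sub_const (inner ℝ ξ η / t)).mul (hasFDerivAt_heatKernel t z)
  have h' : HasFDerivAt (heatKernel₂ t ξ η) _ z :=
    h.congr_of_eventuallyEq (Filter.Eventually.of_forall fun z => by
      simp only [heatKernel₂, Pi.mul_apply]; ring)
  rw [h'.fderiv]
  simp only [FunLike.coe_smul, Pi.smul_apply, innerSL_apply_apply, smul_eq_mul,
    heatKernel₃, FunLike.coe_add, Pi.add_apply, real_inner_comm, Pi.mul_apply]
  ring

lemma hasDerivAt_heatKernel_time {t : ℝ} (ht : 0 < t) (z : 𝔼) :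
    HasDerivAt (fun τ => heatKernel τ z) ((‖z‖ ^ 2 / t ^ 2 - d / t) / 2 * heatKernel t z) t := by
  have h1 : HasDerivAt (fun τ : ℝ => -‖z‖ ^ 2 / 2 * τ⁻¹ - d / 2 * log (2 * π * τ))
      (-‖z‖ ^ 2 / 2 * (-(t ^ 2)⁻¹) - d / 2 * (2 * π * 1 / (2 * π * t))) t :=
    ((hasDerivAt_inv ht.ne').const_mul _).sub
      ((((hasDerivAt_id t).const_mul (2 * π)).log (by simp; positivity)).const_mul _)
  have h2 := h1.exp
  have e : (fun τ => heatKernel τ z) =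
      fun τ : ℝ => exp (-‖z‖ ^ 2 / 2 * τ⁻¹ - d / 2 * log (2 * π * τ)) := by
    ext τ; simp only [heatKernel]; congr 1; rw [mul_comm 2 τ, ← div_div, div_right_comm]; ring
  rw [e]
  convert h2 using 1
  rw [congrFun e t]
  field_simp

lemma sum_heatKernel₂ (t : ℝ) (z : 𝔼) :
    ∑ j, heatKernel₂ t (stdVec j) (stdVec j) z = (‖z‖ ^ 2 / t ^ 2 - d / t) * heatKernel t z := by
  simp only [heatKernel₂, inner_stdVec, real_inner_self_eq_norm_sq, norm_stdVec]
  rw [← Finset.sum_mul, Finset.sum_sub_distrib, ← Finset.sum_div, EuclideanSpace.norm_sq_eq]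
  simp [sq, div_eq_mul_inv]

lemma sum_inner_mul_coord (ξ z : 𝔼) : ∑ j, inner ℝ ξ (stdVec j) * z j = inner ℝ ξ z := by
  rw [PiLp.inner_apply]
  refine Finset.sum_congr rfl fun j _ => ?_
  rw [real_inner_comm, inner_stdVec]; simp [mul_comm]

lemma sum_heatKernel₃ (t : ℝ) (ξ z : 𝔼) :
    ∑ j, heatKernel₃ t ξ (stdVec j) (stdVec j) z =
      (-(inner ℝ ξ z * ‖z‖ ^ 2 / t ^ 3) + (2 + d) * inner ℝ ξ z / t ^ 2) * heatKernel t z := by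
  simp only [heatKernel₃, inner_stdVec, real_inner_self_eq_norm_sq, norm_stdVec]
  rw [← Finset.sum_mul, Finset.sum_add_distrib, ← Finset.sum_div, Finset.sum_neg_distrib,
    ← Finset.sum_div, Finset.sum_add_distrib, Finset.sum_add_distrib, sum_inner_mul_coord,
    EuclideanSpace.norm_sq_eq, Finset.mul_sum]
  simp only [Real.norm_eq_abs, sq_abs, Finset.sum_const, Finset.card_univ, Fintype.card_fin,
    nsmul_eq_mul]
  congr 1
  congr 1
  · congr 2; exact Finset.sum_congr rfl fun j _ => by ring
  · ring

lemma hasDerivAt_heatKernel {t : ℝ} (ht : 0 < t) (z : 𝔼) :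
    HasDerivAt (fun τ => heatKernel τ z)
      (1 / 2 * ∑ j, heatKernel₂ t (stdVec j) (stdVec j) z) t := by
  rw [sum_heatKernel₂]
  convert hasDerivAt_heatKernel_time ht z using 1
  ring

lemma hasDerivAt_heatKernel₁ {t : ℝ} (ht : 0 < t) (ξ z : 𝔼) :
    HasDerivAt (fun τ => heatKernel₁ τ ξ z)
      (1 / 2 * ∑ j, heatKernel₃ t ξ (stdVec j) (stdVec j) z) t := by
  rw [sum_heatKernel₃]
  have h := ((hasDerivAt_inv ht.ne').const_mul (-inner ℝ ξ z)).mul (hasDerivAt_heatKernel_time ht z)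
  refine (h.congr_deriv ?_).congr_of_eventuallyEq (Filter.Eventually.of_forall fun τ => ?_)
  · field_simp
    ring
  · simp only [heatKernel₁, Pi.mul_apply]; ring

end HeatKernel
end EntropyJump

/-! ### Bounds, integrals and moments of the kernel -/

namespace EntropyJump

section HeatKernelIntegrals

open Real InnerProductSpace

variable {d : ℕ}

local notation "𝔼" => EuclideanSpace ℝ (Fin d)

/-- Integration by parts against the constant function 1. Every later integration by parts has this
form: exhibit an integrable function whose line derivative is integrable. -/
lemma integral_lineDeriv_eq_zero {F F' : 𝔼 → ℝ} {ξ : 𝔼}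
    (hF : ∀ x, HasLineDerivAt ℝ F (F' x) x ξ) (hi : Integrable F) (hi' : Integrable F') :
    ∫ x, F' x = 0 := by
  have := integral_bilinear_hasLineDerivAt_right_eq_neg_left_of_integrable (μ := volume)
    (f := fun _ : 𝔼 => (1 : ℝ)) (f' := fun _ => 0) (g := F) (g' := F') (v := ξ)
    (B := ContinuousLinearMap.mul ℝ ℝ) (by simp) (by simpa using hi') (by simpa using hi)
    (fun x _ => (hasFDerivAt_const (1 : ℝ) x).hasLineDerivAt ξ) (fun x _ => hF x)
  simpa using this

lemma heatKernel_eq_mul {t : ℝ} (ht : 0 < t) (z : 𝔼) :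
    heatKernel t z = (2 * π * t) ^ (-(d / 2 : ℝ)) * exp (-(2 * t)⁻¹ * ‖z‖ ^ 2) := by
  rw [heatKernel, rpow_def_of_pos (by positivity), ← exp_add]
  congr 1
  ring

lemma integral_heatKernel {t : ℝ} (ht : 0 < t) : ∫ z : 𝔼, heatKernel t z = 1 := by
  simp_rw [heatKernel_eq_mul ht]
  rw [integral_const_mul, GaussianFourier.integral_rexp_neg_mul_sq_norm (by positivity),
    finrank_euclideanSpace, Fintype.card_fin, show π / (2 * t)⁻¹ = 2 * π * t by field_simp,
    ← rpow_add (by positivity)]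
  simp

lemma integrable_heatKernel {t : ℝ} (ht : 0 < t) : Integrable (heatKernel t : 𝔼 → ℝ) := by
  by_contra h
  have := integral_heatKernel (d := d) ht
  rw [integral_undef h] at this
  simp at this

lemma continuous_heatKernel (t : ℝ) : Continuous (heatKernel t : 𝔼 → ℝ) :=
  (contDiff_heatKernel t (n := 0)).continuous

/-- A polynomial times a Gaussian density is dominated by a wider Gaussian density, locally
uniformly in time. -/
lemma exists_pow_mul_heatKernel_le (m : ℕ) {a b : ℝ} (ha : 0 < a) (hab : a ≤ b) :
    ∃ C > 0, ∀ t, a ≤ t → t ≤ b → ∀ z : 𝔼,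
      (1 + ‖z‖) ^ m * heatKernel t z ≤ C * heatKernel (2 * b) z := by
  have hb : 0 < b := ha.trans_le hab
  -- the polynomial against the remaining Gaussian factor
  obtain ⟨C, hC0, hC⟩ : ∃ C > 0, ∀ r : ℝ, 0 ≤ r → (1 + r) ^ m ≤ C * exp (r ^ 2 / (4 * b)) := by
    -- The constant comes from x ^ m / m! ≤ exp x at x = 1 + r, followed by r ≤ b + r² / (4b).
    refine ⟨m.factorial * exp (1 + b), by positivity, fun r hr => ?_⟩
    have h1 : (1 + r) ^ m ≤ m.factorial * exp (1 + r) := by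
      have := pow_div_factorial_le_exp (x := 1 + r) (by positivity) m
      rw [div_le_iff₀ (by positivity)] at this
      linarith
    refine h1.trans ?_
    rw [mul_assoc, ← exp_add]
    refine mul_le_mul_of_nonneg_left (exp_le_exp.2 ?_) (by positivity)
    have : r ≤ b + r ^ 2 / (4 * b) := by
      have h2 : 0 ≤ (r - 2 * b) ^ 2 / (4 * b) := by positivity
      have h3 : (r - 2 * b) ^ 2 / (4 * b) = r ^ 2 / (4 * b) - r + b := by field_simp; ring
      linarith
    linarith
  -- For t ≤ b the exponent -r²/(2t) is at most -2 · r²/(4b): one half absorbs the polynomial, the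
  -- other is the exponent of variance 2b. The extra factor compares the normalisations at 2b and at
  -- a.
  refine ⟨C * exp (d / 2 * log (2 * π * (2 * b)) - d / 2 * log (2 * π * a)), by positivity,
    fun t hat htb z => ?_⟩
  have ht : 0 < t := ha.trans_le hat
  refine (mul_le_mul_of_nonneg_right (hC ‖z‖ (norm_nonneg z)) (heatKernel_pos t z).le).trans ?_
  rw [mul_assoc, mul_assoc]
  refine mul_le_mul_of_nonneg_left ?_ hC0.le
  rw [heatKernel, heatKernel, ← exp_add, ← exp_add]
  refine exp_le_exp.2 ?_
  have h1 : log (2 * π * a) ≤ log (2 * π * t) := log_le_log (by positivity) (by gcongr)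
  have h2 : (d / 2 : ℝ) * log (2 * π * a) ≤ d / 2 * log (2 * π * t) := by gcongr
  have h3 : ‖z‖ ^ 2 / (2 * b) ≤ ‖z‖ ^ 2 / (2 * t) := by gcongr
  have h4 : ‖z‖ ^ 2 / (2 * b) = 2 * (‖z‖ ^ 2 / (4 * b)) := by field_simp; ring
  have h5 : -‖z‖ ^ 2 / (2 * (2 * b)) = -(‖z‖ ^ 2 / (4 * b)) := by ring_nf
  rw [h5, neg_div]
  linarith

lemma heatKernel_le (t : ℝ) (ht : 0 < t) (z : 𝔼) : heatKernel t z ≤ heatKernel t (0 : 𝔼) := by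
  simp only [heatKernel]
  refine exp_le_exp.2 ?_
  simp only [norm_zero]
  have : 0 ≤ ‖z‖ ^ 2 / (2 * t) := by positivity
  simp [neg_div, this]

lemma integrable_pow_mul_heatKernel (m : ℕ) {t : ℝ} (ht : 0 < t) :
    Integrable (fun z : 𝔼 => (1 + ‖z‖) ^ m * heatKernel t z) := by
  obtain ⟨C, _, hC⟩ := exists_pow_mul_heatKernel_le (d := d) m ht le_rfl
  refine Integrable.mono' ((integrable_heatKernel (t := 2 * t) (by positivity)).const_mul C)
    ?_ (Filter.Eventually.of_forall fun z => ?_)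
  · have := continuous_heatKernel (d := d) t
    exact Continuous.aestronglyMeasurable (by fun_prop)
  · rw [norm_of_nonneg (by have := heatKernel_pos t z; positivity)]
    exact hC t le_rfl le_rfl z

lemma one_le_one_add_norm_pow (m : ℕ) (z : 𝔼) : 1 ≤ (1 + ‖z‖) ^ m :=
  one_le_pow₀ (by have := norm_nonneg z; linarith)

/-- A cubic weight suffices for all derivatives up to order three, so one majorant serves this bound
and the next two. Stating them with a ≤ t makes the constants uniform in time. -/
lemma abs_heatKernel₁_le {a t : ℝ} (ha : 0 < a) (hat : a ≤ t) (ξ z : 𝔼) (hξ : ‖ξ‖ ≤ 1) :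
    |heatKernel₁ t ξ z| ≤ (1 + 1 / a) * ((1 + ‖z‖) ^ 3 * heatKernel t z) := by
  have ht := ha.trans_le hat
  rw [heatKernel₁, abs_mul, abs_of_pos (heatKernel_pos t z), ← mul_assoc]
  refine mul_le_mul_of_nonneg_right ?_ (heatKernel_pos t z).le
  rw [abs_neg, abs_div, abs_of_pos ht]
  have h1 : |inner ℝ ξ z| ≤ ‖z‖ := (abs_real_inner_le_norm ξ z).trans
    (by nlinarith [norm_nonneg z])
  have hz := norm_nonneg z
  calc |inner ℝ ξ z| / t ≤ ‖z‖ / a := by gcongr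
    _ = (1 / a) * ‖z‖ := by ring
    _ ≤ (1 + 1 / a) * (1 + ‖z‖) ^ 3 := by
      gcongr
      · linarith
      · nlinarith [sq_nonneg ‖z‖, pow_nonneg hz 3]

lemma abs_heatKernel₂_le {a t : ℝ} (ha : 0 < a) (hat : a ≤ t) (ξ η z : 𝔼) (hξ : ‖ξ‖ ≤ 1)
    (hη : ‖η‖ ≤ 1) :
    |heatKernel₂ t ξ η z| ≤ 2 * (1 + 1 / a) ^ 2 * ((1 + ‖z‖) ^ 3 * heatKernel t z) := by
  have ht := ha.trans_le hat
  rw [heatKernel₂, abs_mul, abs_of_pos (heatKernel_pos t z), ← mul_assoc]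
  refine mul_le_mul_of_nonneg_right ?_ (heatKernel_pos t z).le
  have hz := norm_nonneg z
  have h1 : |inner ℝ ξ z| ≤ ‖z‖ := (abs_real_inner_le_norm ξ z).trans
    (by nlinarith [norm_nonneg z])
  have h2 : |inner ℝ η z| ≤ ‖z‖ := (abs_real_inner_le_norm η z).trans
    (by nlinarith [norm_nonneg z])
  have h3 : |inner ℝ ξ η| ≤ 1 := (abs_real_inner_le_norm ξ η).trans
    (by nlinarith [norm_nonneg ξ, norm_nonneg η])
  have h4 : 1 / t ≤ 1 / a := by gcongr
  have h5 : 0 < 1 / a := by positivity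
  have h6 : 1 / t ^ 2 ≤ (1 / a) ^ 2 := by rw [one_div_pow]; gcongr
  have h7 : (1 + ‖z‖) ^ 3 ≥ 1 + ‖z‖ ^ 2 := by nlinarith [sq_nonneg ‖z‖, pow_nonneg hz 3]
  calc |inner ℝ ξ z * inner ℝ η z / t ^ 2 - inner ℝ ξ η / t|
      ≤ |inner ℝ ξ z| * |inner ℝ η z| * (1 / t ^ 2) + |inner ℝ ξ η| * (1 / t) := by
        refine (abs_sub _ _).trans_eq ?_
        rw [abs_div, abs_div, abs_mul, abs_of_pos ht, abs_of_pos (pow_pos ht 2)]; ring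
    _ ≤ ‖z‖ * ‖z‖ * (1 / a) ^ 2 + 1 * (1 / a) := by gcongr
    _ ≤ (1 + 1 / a) ^ 2 * (1 + ‖z‖ ^ 2) := by nlinarith [mul_nonneg h5.le (sq_nonneg ‖z‖)]
    _ ≤ 2 * (1 + 1 / a) ^ 2 * (1 + ‖z‖) ^ 3 := by
        nlinarith [mul_le_mul_of_nonneg_left h7 (sq_nonneg (1 + 1 / a)),
          mul_nonneg (sq_nonneg (1 + 1 / a)) (pow_nonneg (add_nonneg zero_le_one hz) 3)]

lemma abs_heatKernel₃_le {a t : ℝ} (ha : 0 < a) (hat : a ≤ t) (ξ η ζ z : 𝔼) (hξ : ‖ξ‖ ≤ 1)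
    (hη : ‖η‖ ≤ 1) (hζ : ‖ζ‖ ≤ 1) :
    |heatKernel₃ t ξ η ζ z| ≤ 4 * (1 + 1 / a) ^ 3 * ((1 + ‖z‖) ^ 3 * heatKernel t z) := by
  have ht := ha.trans_le hat
  rw [heatKernel₃, abs_mul, abs_of_pos (heatKernel_pos t z), ← mul_assoc]
  refine mul_le_mul_of_nonneg_right ?_ (heatKernel_pos t z).le
  have hz := norm_nonneg z
  have hn : ∀ ξ : 𝔼, ‖ξ‖ ≤ 1 → |inner ℝ ξ z| ≤ ‖z‖ := fun ξ hξ =>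
    (abs_real_inner_le_norm ξ z).trans (by nlinarith [norm_nonneg z])
  have hm : ∀ ξ η : 𝔼, ‖ξ‖ ≤ 1 → ‖η‖ ≤ 1 → |inner ℝ ξ η| ≤ 1 := fun ξ η hξ hη =>
    (abs_real_inner_le_norm ξ η).trans (by nlinarith [norm_nonneg ξ, norm_nonneg η])
  have h5 : 0 < 1 / a := by positivity
  have h6 : 1 / t ^ 2 ≤ (1 / a) ^ 2 := by rw [one_div_pow]; gcongr
  have h8 : 1 / t ^ 3 ≤ (1 / a) ^ 3 := by rw [one_div_pow]; gcongr
  have h9 : (1 / a) ^ 3 ≤ (1 + 1 / a) ^ 3 := by gcongr; linarith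
  have h10 : (1 / a) ^ 2 ≤ (1 + 1 / a) ^ 3 := by nlinarith [pow_pos h5 3]
  have h7 : (1 + ‖z‖) ^ 3 ≥ ‖z‖ ^ 3 + 3 * ‖z‖ := by nlinarith [sq_nonneg ‖z‖]
  set A := inner ℝ ξ z
  set B := inner ℝ η z
  set D := inner ℝ ζ z
  have hA : |A| ≤ ‖z‖ := hn ξ hξ
  have hB : |B| ≤ ‖z‖ := hn η hη
  have hD : |D| ≤ ‖z‖ := hn ζ hζ
  have e1 : |-(A * B * D / t ^ 3)| ≤ ‖z‖ ^ 3 * (1 + 1 / a) ^ 3 := by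
    rw [abs_neg, abs_div, abs_mul, abs_mul, abs_of_pos (pow_pos ht 3)]
    calc |A| * |B| * |D| / t ^ 3 = |A| * |B| * |D| * (1 / t ^ 3) := by ring
      _ ≤ ‖z‖ * ‖z‖ * ‖z‖ * (1 + 1 / a) ^ 3 := by gcongr; exact h8.trans h9
      _ = _ := by ring
  have e2 : |(inner ℝ ξ η * D + inner ℝ ξ ζ * B + inner ℝ η ζ * A) / t ^ 2| ≤
      (3 * ‖z‖) * (1 + 1 / a) ^ 3 := by
    rw [abs_div, abs_of_pos (pow_pos ht 2)]
    have : |inner ℝ ξ η * D + inner ℝ ξ ζ * B + inner ℝ η ζ * A| ≤ 3 * ‖z‖ := by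
      refine (abs_add_three _ _ _).trans ?_
      rw [abs_mul, abs_mul, abs_mul]
      have := mul_le_mul (hm ξ η hξ hη) hD (abs_nonneg _) zero_le_one
      have := mul_le_mul (hm ξ ζ hξ hζ) hB (abs_nonneg _) zero_le_one
      have := mul_le_mul (hm η ζ hη hζ) hA (abs_nonneg _) zero_le_one
      linarith
    rw [div_eq_mul_one_div]
    gcongr
    exact h6.trans h10
  calc _ ≤ ‖z‖ ^ 3 * (1 + 1 / a) ^ 3 + (3 * ‖z‖) * (1 + 1 / a) ^ 3 :=
        (abs_add_le _ _).trans (add_le_add e1 e2)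
    _ = (1 + 1 / a) ^ 3 * (‖z‖ ^ 3 + 3 * ‖z‖) := by ring
    _ ≤ (1 + 1 / a) ^ 3 * (4 * (1 + ‖z‖) ^ 3) := by
        gcongr
        nlinarith [pow_nonneg (add_nonneg zero_le_one hz) 3]
    _ = _ := by ring

lemma integrable_of_abs_le_pow_mul_heatKernel {q : 𝔼 → ℝ} (hq : Continuous q) {t C : ℝ} {m : ℕ}
    (ht : 0 < t) (h : ∀ z, |q z| ≤ C * ((1 + ‖z‖) ^ m * heatKernel t z)) : Integrable q :=
  ((integrable_pow_mul_heatKernel m ht).const_mul C).mono' hq.aestronglyMeasurable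
    (Filter.Eventually.of_forall h)

lemma HasFDerivAt.lineDeriv_of_fderiv {q : 𝔼 → ℝ} (hq : ContDiff ℝ 1 q) (x ξ : 𝔼) :
    HasLineDerivAt ℝ q (fderiv ℝ q x ξ) x ξ :=
  (hq.differentiable one_ne_zero x).hasFDerivAt.hasLineDerivAt ξ

lemma integrable_heatKernel₁ {t : ℝ} (ht : 0 < t) (ξ : 𝔼) (hξ : ‖ξ‖ ≤ 1) :
    Integrable (heatKernel₁ t ξ) :=
  integrable_of_abs_le_pow_mul_heatKernel (contDiff_heatKernel₁ t ξ (n := 0)).continuous ht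
    (fun z => abs_heatKernel₁_le ht le_rfl ξ z hξ)

lemma integrable_heatKernel₂ {t : ℝ} (ht : 0 < t) (ξ η : 𝔼) (hξ : ‖ξ‖ ≤ 1) (hη : ‖η‖ ≤ 1) :
    Integrable (heatKernel₂ t ξ η) :=
  integrable_of_abs_le_pow_mul_heatKernel (contDiff_heatKernel₂ t ξ η (n := 0)).continuous ht
    (fun z => abs_heatKernel₂_le ht le_rfl ξ η z hξ hη)

lemma integral_heatKernel₁ {t : ℝ} (ht : 0 < t) (ξ : 𝔼) (hξ : ‖ξ‖ ≤ 1) :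
    ∫ z, heatKernel₁ t ξ z = 0 := by
  refine integral_lineDeriv_eq_zero (F := heatKernel t) (ξ := ξ) (fun x => ?_)
    (integrable_heatKernel ht) (integrable_heatKernel₁ ht ξ hξ)
  rw [← fderiv_heatKernel]
  exact HasFDerivAt.lineDeriv_of_fderiv (contDiff_heatKernel t) x ξ

lemma integral_heatKernel₂ {t : ℝ} (ht : 0 < t) (ξ η : 𝔼) (hξ : ‖ξ‖ ≤ 1) (hη : ‖η‖ ≤ 1) :
    ∫ z, heatKernel₂ t ξ η z = 0 := by
  refine integral_lineDeriv_eq_zero (F := heatKernel₁ t ξ) (ξ := η) (fun x => ?_)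
    (integrable_heatKernel₁ ht ξ hξ) (integrable_heatKernel₂ ht ξ η hξ hη)
  rw [← fderiv_heatKernel₁]
  exact HasFDerivAt.lineDeriv_of_fderiv (contDiff_heatKernel₁ t ξ) x η

lemma abs_coord_le_norm (z : 𝔼) (i : Fin d) : |z i| ≤ ‖z‖ := by
  simpa using PiLp.norm_apply_le z i

lemma integrable_coord_mul_heatKernel {t : ℝ} (ht : 0 < t) (i : Fin d) :
    Integrable (fun z : 𝔼 => z i * heatKernel t z) := by
  refine integrable_of_abs_le_pow_mul_heatKernel (C := 1) (m := 1) ?_ ht (fun z => ?_)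
  · have := continuous_heatKernel (d := d) t
    fun_prop
  · rw [abs_mul, abs_of_pos (heatKernel_pos t z), one_mul, pow_one]
    exact mul_le_mul_of_nonneg_right (by linarith [abs_coord_le_norm z i]) (heatKernel_pos t z).le

lemma integrable_coord_mul_coord_mul_heatKernel {t : ℝ} (ht : 0 < t) (i j : Fin d) :
    Integrable (fun z : 𝔼 => z i * z j * heatKernel t z) := by
  refine integrable_of_abs_le_pow_mul_heatKernel (C := 1) (m := 2) ?_ ht (fun z => ?_)
  · have := continuous_heatKernel (d := d) t
    fun_prop
  · rw [abs_mul, abs_of_pos (heatKernel_pos t z), one_mul, abs_mul]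
    refine mul_le_mul_of_nonneg_right ?_ (heatKernel_pos t z).le
    nlinarith [abs_coord_le_norm z i, abs_coord_le_norm z j, abs_nonneg (z i), abs_nonneg (z j)]

lemma integral_coord_mul_heatKernel {t : ℝ} (ht : 0 < t) (i : Fin d) :
    ∫ z : 𝔼, z i * heatKernel t z = 0 := by
  have h := integral_heatKernel₁ (d := d) ht (stdVec i) (norm_stdVec i).le
  simp only [heatKernel₁, inner_stdVec] at h
  have : ∀ z : 𝔼, -(z i / t) * heatKernel t z = -t⁻¹ * (z i * heatKernel t z) := fun z => by ring
  simp_rw [this] at h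
  rw [integral_const_mul] at h
  simpa [ht.ne'] using h

/-- The Gaussian covariance is read off from the vanishing integral of the second derivative, whose
density is (zᵢ zⱼ / t² - δᵢⱼ / t) times the kernel. -/
lemma integral_coord_mul_coord_mul_heatKernel {t : ℝ} (ht : 0 < t) (i j : Fin d) :
    ∫ z : 𝔼, z i * z j * heatKernel t z = if i = j then t else 0 := by
  have h := integral_heatKernel₂ (d := d) ht (stdVec i) (stdVec j) (norm_stdVec i).le
    (norm_stdVec j).le
  simp only [heatKernel₂, inner_stdVec] at h
  have : ∀ z : 𝔼, (z i * z j / t ^ 2 - (stdVec j : 𝔼) i / t) * heatKernel t z =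
      (t ^ 2)⁻¹ * (z i * z j * heatKernel t z) - (stdVec j : 𝔼) i / t * heatKernel t z :=
    fun z => by ring
  simp_rw [this] at h
  rw [integral_sub ((integrable_coord_mul_coord_mul_heatKernel ht i j).const_mul _)
    ((integrable_heatKernel ht).const_mul _), integral_const_mul, integral_const_mul,
    integral_heatKernel ht] at h
  have ht' := ht.ne'
  have h2 : (stdVec j : 𝔼) i = if i = j then 1 else 0 := by
    simp [stdVec]
  rw [h2] at h
  split_ifs at h ⊢
  · field_simp at h; linarith
  · field_simp at h; linarith

/-- Completing the square: the product is the kernel of variance 2t at v times, in y, the kernel of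
variance t/2 centred at v/2. -/
lemma integral_heatKernel_mul_heatKernel {t : ℝ} (ht : 0 < t) (v : 𝔼) :
    ∫ y, heatKernel t (v - y) * heatKernel t y = heatKernel (2 * t) v := by
  have key : ∀ y : 𝔼, heatKernel t (v - y) * heatKernel t y =
      heatKernel (2 * t) v * heatKernel (t / 2) (y - (2⁻¹ : ℝ) • v) := fun y => by
    simp only [heatKernel]
    rw [← exp_add, ← exp_add]
    congr 1
    have h1 : ‖v - y‖ ^ 2 = ‖v‖ ^ 2 - 2 * inner ℝ v y + ‖y‖ ^ 2 := norm_sub_sq_real v y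
    have h2 : ‖y - (2⁻¹ : ℝ) • v‖ ^ 2 = ‖y‖ ^ 2 - inner ℝ v y + ‖v‖ ^ 2 / 4 := by
      rw [norm_sub_sq_real, inner_smul_right, norm_smul, real_inner_comm]
      norm_num
      ring
    have h3 : log (2 * π * (2 * t)) + log (2 * π * (t / 2)) =
        log (2 * π * t) + log (2 * π * t) := by
      rw [← log_mul (by positivity) (by positivity), ← log_mul (by positivity) (by positivity)]
      congr 1; ring
    rw [h1, h2]
    have h4 : log (2 * π * (2 * t)) =
        log (2 * π * t) + log (2 * π * t) - log (2 * π * (t / 2)) := by linarith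
    rw [h4]
    field_simp
    ring
  simp_rw [key]
  rw [integral_const_mul, integral_sub_right_eq_self (fun y : 𝔼 => heatKernel (t / 2) y),
    integral_heatKernel (by positivity), mul_one]

end HeatKernelIntegrals
end EntropyJump

/-! ### Convolution of a function with a measure: differentiation and Fubini -/

namespace EntropyJump

section HeatFlow

open Real InnerProductSpace Filter Topology

variable {d : ℕ}

local notation "𝔼" => EuclideanSpace ℝ (Fin d)

/-- Convolution of a function with a measure. -/
noncomputable def measConv (P : Measure 𝔼) (q : 𝔼 → ℝ) (x : 𝔼) : ℝ := ∫ y, q (x - y) ∂P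

/-- A bounded derivative of q gives a constant dominating function, integrable because P is finite.
-/
lemma hasFDerivAt_measConv {P : Measure 𝔼} [IsFiniteMeasure P] {q : 𝔼 → ℝ} (hq : ContDiff ℝ 1 q)
    {C : ℝ} (hC : ∀ z, ‖fderiv ℝ q z‖ ≤ C) (hint : ∀ x, Integrable (fun y => q (x - y)) P) (x : 𝔼) :
    HasFDerivAt (measConv P q) (∫ y, fderiv ℝ q (x - y) ∂P) x := by
  have hcont : Continuous (fderiv ℝ q) := hq.continuous_fderiv one_ne_zero
  refine hasFDerivAt_integral_of_dominated_of_fderiv_le (F := fun x y => q (x - y))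
    (F' := fun x y => fderiv ℝ q (x - y)) (bound := fun _ => C) (s := Set.univ) univ_mem
    (Eventually.of_forall fun x => (hint x).aestronglyMeasurable) (hint x) ?_
    (Eventually.of_forall fun y x _ => hC _) (integrable_const C)
    (Eventually.of_forall fun y x _ => ?_)
  · exact (hcont.comp (by fun_prop)).aestronglyMeasurable
  · have h1 := (hq.differentiable one_ne_zero (x - y)).hasFDerivAt
    exact h1.comp x ((hasFDerivAt_id x).sub_const y)

lemma continuous_measConv_of_bounded {F : Type*} [NormedAddCommGroup F] [NormedSpace ℝ F]
    {P : Measure 𝔼} [IsFiniteMeasure P] {q : 𝔼 → F} (hq : Continuous q)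
    {C : ℝ} (hC : ∀ z, ‖q z‖ ≤ C) : Continuous (fun x => ∫ y, q (x - y) ∂P) := by
  have : ∀ x : 𝔼, AEStronglyMeasurable (fun y => q (x - y)) P :=
    fun x => (hq.comp (by fun_prop)).aestronglyMeasurable
  refine continuous_of_dominated (bound := fun _ => C) this
    (fun x => Eventually.of_forall fun y => hC _) (integrable_const C)
    (Eventually.of_forall fun y => ?_)
  exact hq.comp (by fun_prop)

lemma integrable_fderiv_comp_sub {P : Measure 𝔼} [IsFiniteMeasure P] {q : 𝔼 → ℝ}
    (hq : ContDiff ℝ 1 q) {C : ℝ} (hC : ∀ z, ‖fderiv ℝ q z‖ ≤ C) (x : 𝔼) :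
    Integrable (fun y => fderiv ℝ q (x - y)) P := by
  have hcont : Continuous (fderiv ℝ q) := hq.continuous_fderiv one_ne_zero
  exact (integrable_const C).mono' (hcont.comp (by fun_prop)).aestronglyMeasurable
    (Eventually.of_forall fun y => hC _)

lemma contDiff_measConv {P : Measure 𝔼} [IsFiniteMeasure P] {q : 𝔼 → ℝ} (hq : ContDiff ℝ 1 q)
    {C : ℝ} (hC : ∀ z, ‖fderiv ℝ q z‖ ≤ C) (hint : ∀ x, Integrable (fun y => q (x - y)) P) :
    ContDiff ℝ 1 (measConv P q) := by
  have hcont : Continuous (fderiv ℝ q) := hq.continuous_fderiv one_ne_zero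
  rw [contDiff_one_iff_fderiv]
  refine ⟨fun x => (hasFDerivAt_measConv hq hC hint x).differentiableAt, ?_⟩
  have : fderiv ℝ (measConv P q) = fun x => ∫ y, fderiv ℝ q (x - y) ∂P :=
    funext fun x => (hasFDerivAt_measConv hq hC hint x).fderiv
  rw [this]
  exact continuous_measConv_of_bounded hcont hC

lemma fderiv_measConv {P : Measure 𝔼} [IsFiniteMeasure P] {q : 𝔼 → ℝ} (hq : ContDiff ℝ 1 q)
    {C : ℝ} (hC : ∀ z, ‖fderiv ℝ q z‖ ≤ C) (hint : ∀ x, Integrable (fun y => q (x - y)) P)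
    (x ξ : 𝔼) : fderiv ℝ (measConv P q) x ξ = measConv P (fun z => fderiv ℝ q z ξ) x := by
  rw [(hasFDerivAt_measConv hq hC hint x).fderiv, measConv,
    ContinuousLinearMap.integral_apply (integrable_fderiv_comp_sub hq hC x)]

/-- Shear of the product of `P` and Lebesgue measure. -/
lemma measurePreserving_shear (P : Measure 𝔼) [SFinite P] :
    MeasurePreserving (fun p : 𝔼 × 𝔼 => (p.1, p.2 - p.1)) (P.prod volume) (P.prod volume) :=
  (MeasurePreserving.id P).skew_product (g := fun y x => x - y) (by fun_prop)
    (Eventually.of_forall fun y => (measurePreserving_sub_right volume y).map_eq)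

lemma integrable_prod_shear {P : Measure 𝔼} [SFinite P] {F : 𝔼 × 𝔼 → ℝ}
    (hF : Integrable F (P.prod volume)) :
    Integrable (fun p : 𝔼 × 𝔼 => F (p.1, p.2 - p.1)) (P.prod volume) :=
  (measurePreserving_shear P).integrable_comp_of_integrable hF

/-- Fubini for a convolution tested against a function. -/
lemma integrable_mul_measConv {P : Measure 𝔼} [SFinite P] {φ q : 𝔼 → ℝ}
    (h : Integrable (fun p : 𝔼 × 𝔼 => φ (p.1 + p.2) * q p.2) (P.prod volume)) :
    Integrable (fun x => φ x * measConv P q x) := by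
  have h2 := integrable_prod_shear h
  simp only [add_sub_cancel] at h2
  have h3 := h2.integral_prod_right
  simp only [measConv]
  simpa only [integral_const_mul] using h3

lemma integral_mul_measConv {P : Measure 𝔼} [SFinite P] {φ q : 𝔼 → ℝ}
    (h : Integrable (fun p : 𝔼 × 𝔼 => φ (p.1 + p.2) * q p.2) (P.prod volume)) :
    ∫ x, φ x * measConv P q x = ∫ y, (∫ z, φ (y + z) * q z) ∂P := by
  have h2 := integrable_prod_shear h
  simp only [add_sub_cancel] at h2
  have h3 : ∫ x, φ x * measConv P q x = ∫ x, ∫ y, φ x * q (x - y) ∂P := by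
    simp only [measConv, integral_const_mul]
  rw [h3, ← integral_integral_swap (f := fun y x => φ x * q (x - y)) h2]
  refine integral_congr_ae (Eventually.of_forall fun y => ?_)
  have := integral_sub_right_eq_self (μ := (volume : Measure 𝔼)) (fun z => φ (y + z) * q z) y
  simpa only [add_sub_cancel] using this

lemma integrable_measConv {P : Measure 𝔼} [IsFiniteMeasure P] {q : 𝔼 → ℝ} (hq : Integrable q) :
    Integrable (measConv P q) := by
  have := integrable_mul_measConv (P := P) (φ := fun _ => 1) (q := q)
    (by simpa using hq.comp_snd P)
  simpa using this

lemma integral_measConv {P : Measure 𝔼} [IsProbabilityMeasure P] {q : 𝔼 → ℝ} (hq : Integrable q) :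
    ∫ x, measConv P q x = ∫ z, q z := by
  have := integral_mul_measConv (P := P) (φ := fun _ => 1) (q := q)
    (by simpa using hq.comp_snd P)
  simpa using this

end HeatFlow
end EntropyJump

/-! ### Regularity of the heat flow and its domination -/

namespace EntropyJump

section HeatFlowRegularity

open Real InnerProductSpace Filter Topology

variable {d : ℕ}

local notation "𝔼" => EuclideanSpace ℝ (Fin d)

/-- The density at time `t` of the heat flow started from `P`. -/
noncomputable abbrev heatFlow (P : Measure 𝔼) (t : ℝ) : 𝔼 → ℝ := measConv P (heatKernel t)

/-- First directional derivative of the heat flow. -/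
noncomputable abbrev heatFlow₁ (P : Measure 𝔼) (t : ℝ) (ξ : 𝔼) : 𝔼 → ℝ :=
  measConv P (heatKernel₁ t ξ)

/-- Second directional derivative of the heat flow. -/
noncomputable abbrev heatFlow₂ (P : Measure 𝔼) (t : ℝ) (ξ η : 𝔼) : 𝔼 → ℝ :=
  measConv P (heatKernel₂ t ξ η)

/-- Third directional derivative of the heat flow. -/
noncomputable abbrev heatFlow₃ (P : Measure 𝔼) (t : ℝ) (ξ η ζ : 𝔼) : 𝔼 → ℝ :=
  measConv P (heatKernel₃ t ξ η ζ)

/-- A common majorant of the heat flow and its derivatives. -/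
noncomputable abbrev heatMaj (P : Measure 𝔼) (t : ℝ) : 𝔼 → ℝ :=
  measConv P (fun z => (1 + ‖z‖) ^ 3 * heatKernel t z)

lemma exists_pow_mul_heatKernel_le_const (m : ℕ) {a b : ℝ} (ha : 0 < a) (hab : a ≤ b) :
    ∃ C > 0, ∀ t, a ≤ t → t ≤ b → ∀ z : 𝔼, (1 + ‖z‖) ^ m * heatKernel t z ≤ C := by
  obtain ⟨C, hC, h⟩ := exists_pow_mul_heatKernel_le (d := d) m ha hab
  refine ⟨C * heatKernel (2 * b) (0 : 𝔼), mul_pos hC (heatKernel_pos _ _),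
    fun t h1 h2 z => (h t h1 h2 z).trans ?_⟩
  exact mul_le_mul_of_nonneg_left (heatKernel_le _ (by linarith) z) hC.le

lemma integrable_comp_sub_of_bounded {P : Measure 𝔼} [IsFiniteMeasure P] {q : 𝔼 → ℝ}
    (hq : Continuous q) {C : ℝ} (hC : ∀ z, |q z| ≤ C) (x : 𝔼) :
    Integrable (fun y => q (x - y)) P :=
  (integrable_const C).mono' (hq.comp (by fun_prop)).aestronglyMeasurable
    (Eventually.of_forall fun _ => hC _)

lemma exists_abs_le_of_abs_le_pow_mul_heatKernel {q : 𝔼 → ℝ} {t C : ℝ} (hC : 0 ≤ C) {m : ℕ}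
    (ht : 0 < t) (h : ∀ z, |q z| ≤ C * ((1 + ‖z‖) ^ m * heatKernel t z)) :
    ∃ C', ∀ z, |q z| ≤ C' := by
  obtain ⟨C', _, h'⟩ := exists_pow_mul_heatKernel_le_const (d := d) m ht le_rfl
  exact ⟨C * C', fun z => (h z).trans (mul_le_mul_of_nonneg_left (h' t le_rfl le_rfl z) hC)⟩

lemma heatKernel_le_maj (t : ℝ) (z : 𝔼) :
    heatKernel t z ≤ (1 + ‖z‖) ^ 3 * heatKernel t z :=
  le_mul_of_one_le_left (heatKernel_pos t z).le (one_le_one_add_norm_pow 3 z)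

lemma exists_abs_heatKernel_le {t : ℝ} (ht : 0 < t) : ∃ C, ∀ z : 𝔼, |heatKernel t z| ≤ C :=
  exists_abs_le_of_abs_le_pow_mul_heatKernel zero_le_one ht (m := 3)
    fun z => by rw [abs_of_pos (heatKernel_pos t z), one_mul]; exact heatKernel_le_maj t z

lemma exists_abs_heatKernel₁_le {t : ℝ} (ht : 0 < t) :
    ∃ C, ∀ ξ : 𝔼, ‖ξ‖ ≤ 1 → ∀ z, |heatKernel₁ t ξ z| ≤ C := by
  obtain ⟨C', _, h'⟩ := exists_pow_mul_heatKernel_le_const (d := d) 3 ht le_rfl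
  refine ⟨(1 + 1 / t) * C', fun ξ hξ z => (abs_heatKernel₁_le ht le_rfl ξ z hξ).trans ?_⟩
  exact mul_le_mul_of_nonneg_left (h' t le_rfl le_rfl z) (by positivity)

lemma exists_abs_heatKernel₂_le {t : ℝ} (ht : 0 < t) :
    ∃ C, ∀ ξ η : 𝔼, ‖ξ‖ ≤ 1 → ‖η‖ ≤ 1 → ∀ z, |heatKernel₂ t ξ η z| ≤ C := by
  obtain ⟨C', _, h'⟩ := exists_pow_mul_heatKernel_le_const (d := d) 3 ht le_rfl
  refine ⟨2 * (1 + 1 / t) ^ 2 * C', fun ξ η hξ hη z =>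
    (abs_heatKernel₂_le ht le_rfl ξ η z hξ hη).trans ?_⟩
  exact mul_le_mul_of_nonneg_left (h' t le_rfl le_rfl z) (by positivity)

lemma exists_abs_heatKernel₃_le {t : ℝ} (ht : 0 < t) :
    ∃ C, ∀ ξ η ζ : 𝔼, ‖ξ‖ ≤ 1 → ‖η‖ ≤ 1 → ‖ζ‖ ≤ 1 → ∀ z, |heatKernel₃ t ξ η ζ z| ≤ C := by
  obtain ⟨C', _, h'⟩ := exists_pow_mul_heatKernel_le_const (d := d) 3 ht le_rfl
  refine ⟨4 * (1 + 1 / t) ^ 3 * C', fun ξ η ζ hξ hη hζ z =>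
    (abs_heatKernel₃_le ht le_rfl ξ η ζ z hξ hη hζ).trans ?_⟩
  exact mul_le_mul_of_nonneg_left (h' t le_rfl le_rfl z) (by positivity)

lemma norm_le_of_forall_unit_abs_le {L : 𝔼 →L[ℝ] ℝ} {C : ℝ}
    (h : ∀ η : 𝔼, ‖η‖ ≤ 1 → |L η| ≤ C) : ‖L‖ ≤ C := by
  have hC : 0 ≤ C := (abs_nonneg _).trans (h 0 (by simp))
  exact ContinuousLinearMap.opNorm_le_of_unit_norm hC fun η hη => h η hη.le

lemma exists_fderiv_heatKernel_le {t : ℝ} (ht : 0 < t) :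
    ∃ C, ∀ z : 𝔼, ‖fderiv ℝ (heatKernel t) z‖ ≤ C := by
  obtain ⟨C, hC⟩ := exists_abs_heatKernel₁_le (d := d) ht
  refine ⟨C, fun z => norm_le_of_forall_unit_abs_le fun η hη => ?_⟩
  rw [fderiv_heatKernel]
  exact hC η hη z

lemma exists_fderiv_heatKernel₁_le {t : ℝ} (ht : 0 < t) {ξ : 𝔼} (hξ : ‖ξ‖ ≤ 1) :
    ∃ C, ∀ z, ‖fderiv ℝ (heatKernel₁ t ξ) z‖ ≤ C := by
  obtain ⟨C, hC⟩ := exists_abs_heatKernel₂_le (d := d) ht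
  refine ⟨C, fun z => norm_le_of_forall_unit_abs_le fun η hη => ?_⟩
  rw [fderiv_heatKernel₁]
  exact hC ξ η hξ hη z

lemma exists_fderiv_heatKernel₂_le {t : ℝ} (ht : 0 < t) {ξ η : 𝔼} (hξ : ‖ξ‖ ≤ 1) (hη : ‖η‖ ≤ 1) :
    ∃ C, ∀ z, ‖fderiv ℝ (heatKernel₂ t ξ η) z‖ ≤ C := by
  obtain ⟨C, hC⟩ := exists_abs_heatKernel₃_le (d := d) ht
  refine ⟨C, fun z => norm_le_of_forall_unit_abs_le fun ζ hζ => ?_⟩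
  rw [fderiv_heatKernel₂]
  exact hC ξ η ζ hξ hη hζ z

lemma abs_measConv_le {P : Measure 𝔼} {q g : 𝔼 → ℝ} {C : ℝ} (hg : ∀ x, Integrable (fun y => g (x - y)) P)
    (h : ∀ z, |q z| ≤ C * g z) (x : 𝔼) : |measConv P q x| ≤ C * measConv P g x := by
  rw [measConv, measConv, ← integral_const_mul]
  exact norm_integral_le_of_norm_le (f := fun y => q (x - y)) ((hg x).const_mul C)
    (Eventually.of_forall fun y => h _)

lemma measConv_half_sum {P : Measure 𝔼} {q : Fin d → 𝔼 → ℝ} {x : 𝔼}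
    (hq : ∀ j, Integrable (fun y => q j (x - y)) P) :
    measConv P (fun z => 1 / 2 * ∑ j, q j z) x = 1 / 2 * ∑ j, measConv P (q j) x := by
  simp only [measConv]
  rw [integral_const_mul, integral_finsetSum _ fun j _ => hq j]

section Prob

variable {P : Measure (EuclideanSpace ℝ (Fin d))} [IsProbabilityMeasure P] {t : ℝ}

lemma integrable_heatKernel_comp_sub (ht : 0 < t) (x : 𝔼) :
    Integrable (fun y => heatKernel t (x - y)) P := by
  obtain ⟨C, hC⟩ := exists_abs_heatKernel_le (d := d) ht
  exact integrable_comp_sub_of_bounded (continuous_heatKernel t) hC x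

lemma integrable_heatKernel₁_comp_sub (ht : 0 < t) {ξ : 𝔼} (hξ : ‖ξ‖ ≤ 1) (x : 𝔼) :
    Integrable (fun y => heatKernel₁ t ξ (x - y)) P := by
  obtain ⟨C, hC⟩ := exists_abs_heatKernel₁_le (d := d) ht
  exact integrable_comp_sub_of_bounded (contDiff_heatKernel₁ t ξ (n := 0)).continuous (hC ξ hξ) x

lemma integrable_heatKernel₂_comp_sub (ht : 0 < t) {ξ η : 𝔼} (hξ : ‖ξ‖ ≤ 1) (hη : ‖η‖ ≤ 1)
    (x : 𝔼) : Integrable (fun y => heatKernel₂ t ξ η (x - y)) P := by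
  obtain ⟨C, hC⟩ := exists_abs_heatKernel₂_le (d := d) ht
  exact integrable_comp_sub_of_bounded (contDiff_heatKernel₂ t ξ η (n := 0)).continuous
    (hC ξ η hξ hη) x

lemma integrable_heatKernel₃_comp_sub (ht : 0 < t) {ξ η ζ : 𝔼} (hξ : ‖ξ‖ ≤ 1) (hη : ‖η‖ ≤ 1)
    (hζ : ‖ζ‖ ≤ 1) (x : 𝔼) : Integrable (fun y => heatKernel₃ t ξ η ζ (x - y)) P := by
  obtain ⟨C, hC⟩ := exists_abs_heatKernel₃_le (d := d) ht
  exact integrable_comp_sub_of_bounded (contDiff_heatKernel₃ t ξ η ζ (n := 0)).continuous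
    (hC ξ η ζ hξ hη hζ) x

lemma integrable_pow_mul_heatKernel_comp_sub (m : ℕ) (ht : 0 < t) (x : 𝔼) :
    Integrable (fun y => (1 + ‖x - y‖) ^ m * heatKernel t (x - y)) P := by
  obtain ⟨C, _, hC⟩ := exists_pow_mul_heatKernel_le_const (d := d) m ht le_rfl
  refine integrable_comp_sub_of_bounded (q := fun z => (1 + ‖z‖) ^ m * heatKernel t z) ?_
    (C := C) (fun z => ?_) x
  · have := continuous_heatKernel (d := d) t
    fun_prop
  · rw [abs_of_nonneg (by have := heatKernel_pos t z; positivity)]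
    exact hC t le_rfl le_rfl z

lemma heatFlow_pos (ht : 0 < t) (x : 𝔼) : 0 < heatFlow P t x := by
  rw [heatFlow, measConv, integral_pos_iff_support_of_nonneg
    (fun y => (heatKernel_pos t _).le) (integrable_heatKernel_comp_sub ht x)]
  have : Function.support (fun y => heatKernel t (x - y)) = Set.univ :=
    Set.eq_univ_of_forall fun y => (heatKernel_pos t _).ne'
  rw [this]
  simp

lemma contDiff_heatFlow (ht : 0 < t) : ContDiff ℝ 1 (heatFlow P t) := by
  obtain ⟨C, hC⟩ := exists_fderiv_heatKernel_le (d := d) ht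
  exact contDiff_measConv (contDiff_heatKernel t) hC (integrable_heatKernel_comp_sub ht)

lemma contDiff_heatFlow₁ (ht : 0 < t) {ξ : 𝔼} (hξ : ‖ξ‖ ≤ 1) :
    ContDiff ℝ 1 (heatFlow₁ P t ξ) := by
  obtain ⟨C, hC⟩ := exists_fderiv_heatKernel₁_le (d := d) ht hξ
  exact contDiff_measConv (contDiff_heatKernel₁ t ξ) hC (integrable_heatKernel₁_comp_sub ht hξ)

lemma contDiff_heatFlow₂ (ht : 0 < t) {ξ η : 𝔼} (hξ : ‖ξ‖ ≤ 1) (hη : ‖η‖ ≤ 1) :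
    ContDiff ℝ 1 (heatFlow₂ P t ξ η) := by
  obtain ⟨C, hC⟩ := exists_fderiv_heatKernel₂_le (d := d) ht hξ hη
  exact contDiff_measConv (contDiff_heatKernel₂ t ξ η) hC
    (integrable_heatKernel₂_comp_sub ht hξ hη)

lemma continuous_heatFlow₃ (ht : 0 < t) {ξ η ζ : 𝔼} (hξ : ‖ξ‖ ≤ 1) (hη : ‖η‖ ≤ 1)
    (hζ : ‖ζ‖ ≤ 1) : Continuous (heatFlow₃ P t ξ η ζ) := by
  obtain ⟨C, hC⟩ := exists_abs_heatKernel₃_le (d := d) ht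
  exact continuous_measConv_of_bounded (contDiff_heatKernel₃ t ξ η ζ (n := 0)).continuous
    (hC ξ η ζ hξ hη hζ)

lemma fderiv_heatFlow (ht : 0 < t) (x ξ : 𝔼) :
    fderiv ℝ (heatFlow P t) x ξ = heatFlow₁ P t ξ x := by
  obtain ⟨C, hC⟩ := exists_fderiv_heatKernel_le (d := d) ht
  rw [fderiv_measConv (contDiff_heatKernel t) hC (integrable_heatKernel_comp_sub ht)]
  simp only [fderiv_heatKernel]

lemma fderiv_heatFlow₁ (ht : 0 < t) {ξ : 𝔼} (hξ : ‖ξ‖ ≤ 1) (x η : 𝔼) :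
    fderiv ℝ (heatFlow₁ P t ξ) x η = heatFlow₂ P t ξ η x := by
  obtain ⟨C, hC⟩ := exists_fderiv_heatKernel₁_le (d := d) ht hξ
  rw [fderiv_measConv (contDiff_heatKernel₁ t ξ) hC (integrable_heatKernel₁_comp_sub ht hξ)]
  simp only [fderiv_heatKernel₁]

lemma fderiv_heatFlow₂ (ht : 0 < t) {ξ η : 𝔼} (hξ : ‖ξ‖ ≤ 1) (hη : ‖η‖ ≤ 1) (x ζ : 𝔼) :
    fderiv ℝ (heatFlow₂ P t ξ η) x ζ = heatFlow₃ P t ξ η ζ x := by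
  obtain ⟨C, hC⟩ := exists_fderiv_heatKernel₂_le (d := d) ht hξ hη
  rw [fderiv_measConv (contDiff_heatKernel₂ t ξ η) hC (integrable_heatKernel₂_comp_sub ht hξ hη)]
  simp only [fderiv_heatKernel₂]

lemma hasLineDerivAt_heatFlow (ht : 0 < t) (x ξ : 𝔼) :
    HasLineDerivAt ℝ (heatFlow P t) (heatFlow₁ P t ξ x) x ξ := by
  rw [← fderiv_heatFlow ht]
  exact HasFDerivAt.lineDeriv_of_fderiv (contDiff_heatFlow ht) x ξ

lemma hasLineDerivAt_heatFlow₁ (ht : 0 < t) {ξ : 𝔼} (hξ : ‖ξ‖ ≤ 1) (x η : 𝔼) :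
    HasLineDerivAt ℝ (heatFlow₁ P t ξ) (heatFlow₂ P t ξ η x) x η := by
  rw [← fderiv_heatFlow₁ ht hξ]
  exact HasFDerivAt.lineDeriv_of_fderiv (contDiff_heatFlow₁ ht hξ) x η

lemma hasLineDerivAt_heatFlow₂ (ht : 0 < t) {ξ η : 𝔼} (hξ : ‖ξ‖ ≤ 1) (hη : ‖η‖ ≤ 1) (x ζ : 𝔼) :
    HasLineDerivAt ℝ (heatFlow₂ P t ξ η) (heatFlow₃ P t ξ η ζ x) x ζ := by
  rw [← fderiv_heatFlow₂ ht hξ hη]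
  exact HasFDerivAt.lineDeriv_of_fderiv (contDiff_heatFlow₂ ht hξ hη) x ζ

lemma integrable_heatFlow (ht : 0 < t) : Integrable (heatFlow P t) :=
  integrable_measConv (integrable_heatKernel ht)

lemma integral_heatFlow (ht : 0 < t) : ∫ x, heatFlow P t x = 1 := by
  rw [integral_measConv (integrable_heatKernel ht), integral_heatKernel ht]

lemma heatFlow_le_heatMaj (ht : 0 < t) (x : 𝔼) : heatFlow P t x ≤ heatMaj P t x :=
  integral_mono (integrable_heatKernel_comp_sub ht x)
    (integrable_pow_mul_heatKernel_comp_sub 3 ht x) fun _ => heatKernel_le_maj t _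

lemma abs_heatFlow₁_le {a : ℝ} (ha : 0 < a) (hat : a ≤ t) {ξ : 𝔼} (hξ : ‖ξ‖ ≤ 1) (x : 𝔼) :
    |heatFlow₁ P t ξ x| ≤ (1 + 1 / a) * heatMaj P t x :=
  abs_measConv_le (integrable_pow_mul_heatKernel_comp_sub 3 (ha.trans_le hat))
    (fun z => abs_heatKernel₁_le ha hat ξ z hξ) x

lemma abs_heatFlow₂_le {a : ℝ} (ha : 0 < a) (hat : a ≤ t) {ξ η : 𝔼} (hξ : ‖ξ‖ ≤ 1)
    (hη : ‖η‖ ≤ 1) (x : 𝔼) :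
    |heatFlow₂ P t ξ η x| ≤ 2 * (1 + 1 / a) ^ 2 * heatMaj P t x :=
  abs_measConv_le (integrable_pow_mul_heatKernel_comp_sub 3 (ha.trans_le hat))
    (fun z => abs_heatKernel₂_le ha hat ξ η z hξ hη) x

lemma abs_heatFlow₃_le {a : ℝ} (ha : 0 < a) (hat : a ≤ t) {ξ η ζ : 𝔼} (hξ : ‖ξ‖ ≤ 1)
    (hη : ‖η‖ ≤ 1) (hζ : ‖ζ‖ ≤ 1) (x : 𝔼) :
    |heatFlow₃ P t ξ η ζ x| ≤ 4 * (1 + 1 / a) ^ 3 * heatMaj P t x :=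
  abs_measConv_le (integrable_pow_mul_heatKernel_comp_sub 3 (ha.trans_le hat))
    (fun z => abs_heatKernel₃_le ha hat ξ η ζ z hξ hη hζ) x

/-- The fourth power of the majorant, compared with the heat flow at a later time. -/
lemma exists_heatMaj_pow_le {a b : ℝ} (ha : 0 < a) (hab : a ≤ b) :
    ∃ C > 0, ∀ (P : Measure 𝔼) [IsProbabilityMeasure P], ∀ t, a ≤ t → t ≤ b → ∀ x,
      heatFlow P t x * (heatMaj P t x / heatFlow P t x) ^ 4 ≤ C * heatFlow P (2 * b) x := by
  -- The exponent 12 is 3 · 4: the fourth power of the cubic weight.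
  obtain ⟨C, hC0, hC⟩ := exists_pow_mul_heatKernel_le (d := d) 12 ha hab
  refine ⟨C, hC0, fun P _ t hat htb x => ?_⟩
  have ht := ha.trans_le hat
  have hu := heatFlow_pos (P := P) ht x
  set r := heatMaj P t x / heatFlow P t x with hr
  have h1 : ∫ y, (1 + ‖x - y‖) ^ 12 * heatKernel t (x - y) ∂P ≤ C * heatFlow P (2 * b) x := by
    rw [show C * heatFlow P (2 * b) x = ∫ y, C * heatKernel (2 * b) (x - y) ∂P from
      (integral_const_mul _ _).symm]
    exact integral_mono (integrable_pow_mul_heatKernel_comp_sub 12 ht x)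
      ((integrable_heatKernel_comp_sub (by linarith) x).const_mul C) fun y => hC t hat htb _
  refine le_trans ?_ h1
  -- Jensen in tangent form. The quotient r is the mean of B = (1 + ‖x - y‖) ^ 3 under the
  -- probability proportional to the kernel, and B⁴ lies above its tangent 4r³B - 3r⁴ at r.
  -- Integrating gives r⁴ ≤ mean of B⁴ without normalising the measure.
  have h2 : ∫ y, (4 * r ^ 3 * ((1 + ‖x - y‖) ^ 3 * heatKernel t (x - y)) -
      3 * r ^ 4 * heatKernel t (x - y)) ∂P ≤ ∫ y, (1 + ‖x - y‖) ^ 12 * heatKernel t (x - y) ∂P := by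
    refine integral_mono (((integrable_pow_mul_heatKernel_comp_sub 3 ht x).const_mul _).sub
      ((integrable_heatKernel_comp_sub ht x).const_mul _))
      (integrable_pow_mul_heatKernel_comp_sub 12 ht x) fun y => ?_
    have hk := heatKernel_pos t (x - y)
    set B := (1 + ‖x - y‖) ^ 3
    have hB : (1 + ‖x - y‖) ^ 12 = B ^ 4 := by simp only [B]; ring
    have : 4 * r ^ 3 * B - 3 * r ^ 4 ≤ B ^ 4 := by
      nlinarith [sq_nonneg (B ^ 2 - r ^ 2), sq_nonneg (r * (B - r)), sq_nonneg (r ^ 2 - r * B)]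
    simp only [hB]
    nlinarith
  rw [integral_sub ((integrable_pow_mul_heatKernel_comp_sub 3 ht x).const_mul _)
    ((integrable_heatKernel_comp_sub ht x).const_mul _), integral_const_mul,
    integral_const_mul] at h2
  have h3 : heatMaj P t x = r * heatFlow P t x := by rw [hr]; field_simp
  have h4 : ∫ y, (1 + ‖x - y‖) ^ 3 * heatKernel t (x - y) ∂P = r * heatFlow P t x := h3
  have h5 : ∫ y, heatKernel t (x - y) ∂P = heatFlow P t x := rfl
  rw [h4, h5] at h2
  linarith

/-- Allows lower powers of the quotient to be replaced by its fourth power, the one that is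
dominated. -/
lemma one_le_heatMaj_div (ht : 0 < t) (x : 𝔼) : 1 ≤ heatMaj P t x / heatFlow P t x := by
  rw [one_le_div (heatFlow_pos ht x)]
  exact heatFlow_le_heatMaj ht x

/-- Differentiation in time under the integral sign. -/
lemma hasDerivAt_measConv_time {q : ℝ → 𝔼 → ℝ} {q' : ℝ → 𝔼 → ℝ} (ht : 0 < t)
    (hq : ∀ τ, 0 < τ → Continuous (q τ)) (hqi : ∀ τ, 0 < τ → ∃ C, ∀ z, |q τ z| ≤ C)
    (hd : ∀ τ, 0 < τ → ∀ z, HasDerivAt (fun τ => q τ z) (q' τ z) τ)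
    (hq' : Continuous (q' t)) {C : ℝ}
    (hC : ∀ τ, t / 2 ≤ τ → τ ≤ 2 * t → ∀ z, |q' τ z| ≤ C) (x : 𝔼) :
    HasDerivAt (fun τ => measConv P (q τ) x) (measConv P (q' t) x) t := by
  obtain ⟨D, hD⟩ := hqi t ht
  refine (hasDerivAt_integral_of_dominated_loc_of_deriv_le (F := fun τ y => q τ (x - y))
    (F' := fun τ y => q' τ (x - y)) (bound := fun _ => C) (s := Set.Ioo (t / 2) (2 * t))
    (Ioo_mem_nhds (by linarith) (by linarith)) ?_
    (integrable_comp_sub_of_bounded (hq t ht) hD x)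
    (hq'.comp (by fun_prop)).aestronglyMeasurable
    (Eventually.of_forall fun y τ hτ => hC τ hτ.1.le hτ.2.le _) (integrable_const C)
    (Eventually.of_forall fun y τ hτ => hd τ (by linarith [hτ.1]) _)).2
  filter_upwards [lt_mem_nhds ht] with τ hτ
  exact ((hq τ hτ).comp (by fun_prop)).aestronglyMeasurable

lemma hasDerivAt_heatFlow (ht : 0 < t) (x : 𝔼) :
    HasDerivAt (fun τ => heatFlow P τ x)
      (1 / 2 * ∑ j, heatFlow₂ P t (stdVec j) (stdVec j) x) t := by
  rw [← measConv_half_sum fun j =>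
    integrable_heatKernel₂_comp_sub ht (norm_stdVec j).le (norm_stdVec j).le x]
  obtain ⟨C, _, hC⟩ := exists_pow_mul_heatKernel_le_const (d := d) 3 (half_pos ht)
    (show t / 2 ≤ 2 * t by linarith)
  refine hasDerivAt_measConv_time ht (fun τ _ => continuous_heatKernel τ)
    (fun τ hτ => exists_abs_heatKernel_le hτ) (fun τ hτ z => hasDerivAt_heatKernel hτ z) ?_
    (C := 1 / 2 * ∑ _j : Fin d, 2 * (1 + 1 / (t / 2)) ^ 2 * C) (fun τ h1 h2 z => ?_) x
  · exact continuous_const.mul (continuous_finsetSum _ fun j _ =>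
      (contDiff_heatKernel₂ t _ _ (n := 0)).continuous)
  · rw [abs_mul, abs_of_pos (by norm_num : (0 : ℝ) < 1 / 2)]
    refine mul_le_mul_of_nonneg_left ((Finset.abs_sum_le_sum_abs _ _).trans
      (Finset.sum_le_sum fun j _ => ?_)) (by norm_num)
    exact (abs_heatKernel₂_le (half_pos ht) h1 _ _ z (norm_stdVec j).le (norm_stdVec j).le).trans
      (mul_le_mul_of_nonneg_left (hC τ h1 h2 z) (by positivity))

lemma hasDerivAt_heatFlow₁ (ht : 0 < t) {ξ : 𝔼} (hξ : ‖ξ‖ ≤ 1) (x : 𝔼) :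
    HasDerivAt (fun τ => heatFlow₁ P τ ξ x)
      (1 / 2 * ∑ j, heatFlow₃ P t ξ (stdVec j) (stdVec j) x) t := by
  rw [← measConv_half_sum fun j =>
    integrable_heatKernel₃_comp_sub ht hξ (norm_stdVec j).le (norm_stdVec j).le x]
  obtain ⟨C, _, hC⟩ := exists_pow_mul_heatKernel_le_const (d := d) 3 (half_pos ht)
    (show t / 2 ≤ 2 * t by linarith)
  refine hasDerivAt_measConv_time ht
    (fun τ _ => (contDiff_heatKernel₁ τ ξ (n := 0)).continuous)
    (fun τ hτ => (exists_abs_heatKernel₁_le hτ).imp fun C h => h ξ hξ)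
    (fun τ hτ z => hasDerivAt_heatKernel₁ hτ ξ z) ?_
    (C := 1 / 2 * ∑ _j : Fin d, 4 * (1 + 1 / (t / 2)) ^ 3 * C) (fun τ h1 h2 z => ?_) x
  · exact continuous_const.mul (continuous_finsetSum _ fun j _ =>
      (contDiff_heatKernel₃ t _ _ _ (n := 0)).continuous)
  · rw [abs_mul, abs_of_pos (by norm_num : (0 : ℝ) < 1 / 2)]
    refine mul_le_mul_of_nonneg_left ((Finset.abs_sum_le_sum_abs _ _).trans
      (Finset.sum_le_sum fun j _ => ?_)) (by norm_num)
    exact (abs_heatKernel₃_le (half_pos ht) h1 _ _ _ z hξ (norm_stdVec j).le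
      (norm_stdVec j).le).trans (mul_le_mul_of_nonneg_left (hC τ h1 h2 z) (by positivity))

end Prob

end HeatFlowRegularity
end EntropyJump

/-! ### Scores, Hessians and the derivative of the Fisher information -/

namespace EntropyJump

section DeBruijn

open Real InnerProductSpace Filter Topology

variable {d : ℕ}

local notation "𝔼" => EuclideanSpace ℝ (Fin d)

/-- The score `∂ᵢ log u` of the heat flow. -/
noncomputable def score (P : Measure 𝔼) (t : ℝ) (i : Fin d) (x : 𝔼) : ℝ :=
  heatFlow₁ P t (stdVec i) x / heatFlow P t x

/-- The quotient `∂ᵢⱼ u / u`. -/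
noncomputable def ratio₂ (P : Measure 𝔼) (t : ℝ) (i j : Fin d) (x : 𝔼) : ℝ :=
  heatFlow₂ P t (stdVec i) (stdVec j) x / heatFlow P t x

/-- The quotient `∂ᵢⱼₖ u / u`. -/
noncomputable def ratio₃ (P : Measure 𝔼) (t : ℝ) (i j k : Fin d) (x : 𝔼) : ℝ :=
  heatFlow₃ P t (stdVec i) (stdVec j) (stdVec k) x / heatFlow P t x

/-- The entries of the Hessian of `-log u`. -/
noncomputable def negHess (P : Measure 𝔼) (t : ℝ) (i j : Fin d) (x : 𝔼) : ℝ :=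
  score P t i x * score P t j x - ratio₂ P t i j x

/-- The Fisher information matrix of the heat flow. -/
noncomputable def fisher (P : Measure 𝔼) (t : ℝ) (i j : Fin d) : ℝ :=
  ∫ x, heatFlow P t x * (score P t i x * score P t j x)

/-- The integrated squared entries of the Hessian of `-log u`. -/
noncomputable def hessSq (P : Measure 𝔼) (t : ℝ) (i j : Fin d) : ℝ :=
  ∫ x, heatFlow P t x * negHess P t i j x ^ 2

/-- The entropy along the heat flow. -/
noncomputable def flowEntropy (P : Measure 𝔼) (t : ℝ) : ℝ :=
  -∫ x, heatFlow P t x * log (heatFlow P t x)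

lemma HasLineDerivAt.mul' {f g : 𝔼 → ℝ} {f' g' : ℝ} {x v : 𝔼} (hf : HasLineDerivAt ℝ f f' x v)
    (hg : HasLineDerivAt ℝ g g' x v) :
    HasLineDerivAt ℝ (fun x => f x * g x) (f' * g x + f x * g') x v := by
  have := HasDerivAt.fun_mul (hf : HasDerivAt (fun t : ℝ => f (x + t • v)) f' 0) hg
  simpa only [HasLineDerivAt, zero_smul, add_zero] using this

lemma HasLineDerivAt.sub' {f g : 𝔼 → ℝ} {f' g' : ℝ} {x v : 𝔼} (hf : HasLineDerivAt ℝ f f' x v)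
    (hg : HasLineDerivAt ℝ g g' x v) :
    HasLineDerivAt ℝ (fun x => f x - g x) (f' - g') x v :=
  HasDerivAt.fun_sub (hf : HasDerivAt (fun t : ℝ => f (x + t • v)) f' 0) hg

lemma HasLineDerivAt.div' {f g : 𝔼 → ℝ} {f' g' : ℝ} {x v : 𝔼} (hf : HasLineDerivAt ℝ f f' x v)
    (hg : HasLineDerivAt ℝ g g' x v) (hx : g x ≠ 0) :
    HasLineDerivAt ℝ (fun x => f x / g x) ((f' * g x - f x * g') / g x ^ 2) x v := by
  have := HasDerivAt.fun_div (hf : HasDerivAt (fun t : ℝ => f (x + t • v)) f' 0) hg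
    (by simpa using hx)
  simpa only [HasLineDerivAt, zero_smul, add_zero] using this

lemma HasLineDerivAt.log' {f : 𝔼 → ℝ} {f' : ℝ} {x v : 𝔼} (hf : HasLineDerivAt ℝ f f' x v)
    (hx : f x ≠ 0) : HasLineDerivAt ℝ (fun x => log (f x)) (f' / f x) x v := by
  have := HasDerivAt.log (hf : HasDerivAt (fun t : ℝ => f (x + t • v)) f' 0) (by simpa using hx)
  simpa [HasLineDerivAt] using this

variable {P : Measure (EuclideanSpace ℝ (Fin d))} [IsProbabilityMeasure P] {t : ℝ}

lemma heatFlow_mul_score (ht : 0 < t) (i : Fin d) (x : 𝔼) :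
    heatFlow P t x * score P t i x = heatFlow₁ P t (stdVec i) x :=
  mul_div_cancel₀ _ (heatFlow_pos ht x).ne'

lemma heatFlow_mul_ratio₂ (ht : 0 < t) (i j : Fin d) (x : 𝔼) :
    heatFlow P t x * ratio₂ P t i j x = heatFlow₂ P t (stdVec i) (stdVec j) x :=
  mul_div_cancel₀ _ (heatFlow_pos ht x).ne'

lemma hasLineDerivAt_heatFlow_stdVec (ht : 0 < t) (j : Fin d) (x : 𝔼) :
    HasLineDerivAt ℝ (heatFlow P t) (heatFlow P t x * score P t j x) x (stdVec j) := by
  rw [heatFlow_mul_score ht]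
  exact hasLineDerivAt_heatFlow ht x _

lemma hasLineDerivAt_score (ht : 0 < t) (i j : Fin d) (x : 𝔼) :
    HasLineDerivAt ℝ (score P t i) (-negHess P t i j x) x (stdVec j) := by
  have h := HasLineDerivAt.div' (hasLineDerivAt_heatFlow₁ (P := P) ht (norm_stdVec i).le x
    (stdVec j)) (hasLineDerivAt_heatFlow (P := P) ht x (stdVec j)) (heatFlow_pos ht x).ne'
  refine HasDerivAt.congr_deriv h ?_
  have := (heatFlow_pos (P := P) ht x).ne'
  simp only [negHess, score, ratio₂]
  field_simp
  ring

lemma hasLineDerivAt_ratio₂ (ht : 0 < t) (i j k : Fin d) (x : 𝔼) :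
    HasLineDerivAt ℝ (ratio₂ P t i j)
      (ratio₃ P t i j k x - ratio₂ P t i j x * score P t k x) x (stdVec k) := by
  have h := HasLineDerivAt.div' (hasLineDerivAt_heatFlow₂ (P := P) ht (norm_stdVec i).le
    (norm_stdVec j).le x (stdVec k)) (hasLineDerivAt_heatFlow (P := P) ht x (stdVec k))
    (heatFlow_pos ht x).ne'
  refine HasDerivAt.congr_deriv h ?_
  have := (heatFlow_pos (P := P) ht x).ne'
  simp only [score, ratio₂, ratio₃]
  field_simp

lemma continuous_heatFlow (ht : 0 < t) : Continuous (heatFlow P t) :=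
  (contDiff_heatFlow ht).continuous

lemma continuous_score (ht : 0 < t) (i : Fin d) : Continuous (score P t i) :=
  (contDiff_heatFlow₁ ht (norm_stdVec i).le).continuous.div (continuous_heatFlow ht)
    fun x => (heatFlow_pos ht x).ne'

lemma continuous_ratio₂ (ht : 0 < t) (i j : Fin d) : Continuous (ratio₂ P t i j) :=
  (contDiff_heatFlow₂ ht (norm_stdVec i).le (norm_stdVec j).le).continuous.div
    (continuous_heatFlow ht) fun x => (heatFlow_pos ht x).ne'

lemma continuous_ratio₃ (ht : 0 < t) (i j k : Fin d) : Continuous (ratio₃ P t i j k) :=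
  (continuous_heatFlow₃ ht (norm_stdVec i).le (norm_stdVec j).le (norm_stdVec k).le).div
    (continuous_heatFlow ht) fun x => (heatFlow_pos ht x).ne'

lemma continuous_negHess (ht : 0 < t) (i j : Fin d) : Continuous (negHess P t i j) :=
  ((continuous_score ht i).mul (continuous_score ht j)).sub (continuous_ratio₂ ht i j)

section Bounds

variable {a : ℝ}

lemma abs_score_le (ha : 0 < a) (hat : a ≤ t) (i : Fin d) (x : 𝔼) :
    |score P t i x| ≤ (1 + 1 / a) * (heatMaj P t x / heatFlow P t x) := by
  have h := heatFlow_pos (P := P) (ha.trans_le hat) x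
  rw [score, abs_div, abs_of_pos h, ← mul_div_assoc]
  exact div_le_div_of_nonneg_right (abs_heatFlow₁_le ha hat (norm_stdVec i).le x) h.le

lemma abs_ratio₂_le (ha : 0 < a) (hat : a ≤ t) (i j : Fin d) (x : 𝔼) :
    |ratio₂ P t i j x| ≤ 2 * (1 + 1 / a) ^ 2 * (heatMaj P t x / heatFlow P t x) := by
  have h := heatFlow_pos (P := P) (ha.trans_le hat) x
  rw [ratio₂, abs_div, abs_of_pos h, ← mul_div_assoc]
  exact div_le_div_of_nonneg_right
    (abs_heatFlow₂_le ha hat (norm_stdVec i).le (norm_stdVec j).le x) h.le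

lemma abs_ratio₃_le (ha : 0 < a) (hat : a ≤ t) (i j k : Fin d) (x : 𝔼) :
    |ratio₃ P t i j k x| ≤ 4 * (1 + 1 / a) ^ 3 * (heatMaj P t x / heatFlow P t x) := by
  have h := heatFlow_pos (P := P) (ha.trans_le hat) x
  rw [ratio₃, abs_div, abs_of_pos h, ← mul_div_assoc]
  exact div_le_div_of_nonneg_right
    (abs_heatFlow₃_le ha hat (norm_stdVec i).le (norm_stdVec j).le (norm_stdVec k).le x) h.le

lemma abs_negHess_le (ha : 0 < a) (hat : a ≤ t) (i j : Fin d) (x : 𝔼) :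
    |negHess P t i j x| ≤ 3 * (1 + 1 / a) ^ 2 * (heatMaj P t x / heatFlow P t x) ^ 2 := by
  have h1 := abs_score_le (P := P) ha hat i x
  have h2 := abs_score_le (P := P) ha hat j x
  have h3 := abs_ratio₂_le (P := P) ha hat i j x
  have hR := one_le_heatMaj_div (P := P) (ha.trans_le hat) x
  set R := heatMaj P t x / heatFlow P t x
  have hM : 0 < (1 + 1 / a) ^ 2 := by positivity
  calc |negHess P t i j x| ≤ |score P t i x| * |score P t j x| + |ratio₂ P t i j x| := by
        rw [negHess, ← abs_mul]; exact abs_sub _ _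
    _ ≤ ((1 + 1 / a) * R) * ((1 + 1 / a) * R) + 2 * (1 + 1 / a) ^ 2 * R := by gcongr
    _ ≤ _ := by nlinarith [mul_le_mul_of_nonneg_left hR (mul_pos hM (by linarith : 0 < R)).le]

end Bounds

/-- Every expression of degree at most four in the quotients `∂u / u` is integrable against `u`. -/
lemma integrable_heatFlow_mul {g : 𝔼 → ℝ} (ht : 0 < t) (hg : Continuous g) {C : ℝ}
    (h : ∀ x, |g x| ≤ C * (heatMaj P t x / heatFlow P t x) ^ 4) :
    Integrable (fun x => heatFlow P t x * g x) := by
  obtain ⟨D, hD, hD'⟩ := exists_heatMaj_pow_le (d := d) ht le_rfl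
  have hC : 0 ≤ C := by
    have h0 := (abs_nonneg _).trans (h 0)
    have := one_le_heatMaj_div (P := P) ht 0
    by_contra hC
    nlinarith [pow_pos (by linarith : 0 < heatMaj P t 0 / heatFlow P t 0) 4]
  refine ((integrable_heatFlow (P := P) (t := 2 * t) (by positivity)).const_mul (C * D)).mono'
    ((continuous_heatFlow ht).mul hg).aestronglyMeasurable (Eventually.of_forall fun x => ?_)
  have hu := heatFlow_pos (P := P) ht x
  rw [norm_mul, norm_of_nonneg hu.le, norm_eq_abs]
  calc heatFlow P t x * |g x| ≤ heatFlow P t x * (C * (heatMaj P t x / heatFlow P t x) ^ 4) := by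
        gcongr; exact h x
    _ = C * (heatFlow P t x * (heatMaj P t x / heatFlow P t x) ^ 4) := by ring
    _ ≤ C * (D * heatFlow P (2 * t) x) :=
        mul_le_mul_of_nonneg_left (hD' P t le_rfl le_rfl x) hC
    _ = _ := by ring

lemma integrable_heatFlow_mul_score_mul_score (ht : 0 < t) (i j : Fin d) :
    Integrable (fun x => heatFlow P t x * (score P t i x * score P t j x)) := by
  refine integrable_heatFlow_mul ht ((continuous_score ht i).mul (continuous_score ht j))
    (C := (1 + 1 / t) ^ 2) fun x => ?_
  have h1 := abs_score_le (P := P) ht le_rfl i x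
  have h2 := abs_score_le (P := P) ht le_rfl j x
  have hR := one_le_heatMaj_div (P := P) ht x
  set R := heatMaj P t x / heatFlow P t x
  rw [abs_mul]
  calc _ ≤ ((1 + 1 / t) * R) * ((1 + 1 / t) * R) := by gcongr
    _ = (1 + 1 / t) ^ 2 * R ^ 2 := by ring
    _ ≤ _ := by gcongr; norm_num

lemma integrable_heatFlow_mul_negHess_mul (ht : 0 < t) (i j k l : Fin d) :
    Integrable (fun x => heatFlow P t x * (negHess P t i j x * negHess P t k l x)) := by
  refine integrable_heatFlow_mul ht ((continuous_negHess ht i j).mul (continuous_negHess ht k l))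
    (C := 9 * (1 + 1 / t) ^ 4) fun x => ?_
  have h1 := abs_negHess_le (P := P) ht le_rfl i j x
  have h2 := abs_negHess_le (P := P) ht le_rfl k l x
  set R := heatMaj P t x / heatFlow P t x
  rw [abs_mul]
  calc _ ≤ (3 * (1 + 1 / t) ^ 2 * R ^ 2) * (3 * (1 + 1 / t) ^ 2 * R ^ 2) := by gcongr
    _ = _ := by ring

lemma integrable_heatFlow_mul_negHess_sq (ht : 0 < t) (i j : Fin d) :
    Integrable (fun x => heatFlow P t x * negHess P t i j x ^ 2) := by
  simpa only [sq] using integrable_heatFlow_mul_negHess_mul (P := P) ht i j i j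

lemma integrable_heatFlow_mul_negHess (ht : 0 < t) (i j : Fin d) :
    Integrable (fun x => heatFlow P t x * negHess P t i j x) := by
  refine integrable_heatFlow_mul ht (continuous_negHess ht i j)
    (C := 3 * (1 + 1 / t) ^ 2) fun x => ?_
  have h1 := abs_negHess_le (P := P) ht le_rfl i j x
  have hR := one_le_heatMaj_div (P := P) ht x
  refine h1.trans ?_
  gcongr
  norm_num

/-- Pure arithmetic for the integrand of the time derivative of the Fisher information: s, r, q
stand for quotients of first, second and third derivatives by u, and M for 1 + 1/a. -/
lemma abs_two_mul_sub_le {s q r m M R : ℝ} (hM : 0 ≤ M) (hR : 1 ≤ R) (hs : |s| ≤ M * R)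
    (hq : |q| ≤ 4 * M ^ 3 * R) (hr : |r| ≤ 2 * M ^ 2 * R) (hm : m = 2 * s * q - s ^ 2 * r) :
    |m| ≤ 10 * M ^ 4 * R ^ 4 := by
  have h0 : 0 ≤ R := by linarith
  calc |m| ≤ 2 * |s| * |q| + |s| ^ 2 * |r| := by
        rw [hm]
        refine (abs_sub _ _).trans_eq ?_
        rw [abs_mul, abs_mul, abs_mul, abs_pow, abs_two]
    _ ≤ 2 * (M * R) * (4 * M ^ 3 * R) + (M * R) ^ 2 * (2 * M ^ 2 * R) := by gcongr
    _ = 8 * M ^ 4 * R ^ 2 + 2 * M ^ 4 * R ^ 3 := by ring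
    _ ≤ 8 * M ^ 4 * R ^ 4 + 2 * M ^ 4 * R ^ 4 := by gcongr <;> norm_num
    _ = _ := by ring

/-- The derivative of the Fisher information along the heat flow. -/
lemma hasDerivAt_fisher (ht : 0 < t) (i : Fin d) :
    HasDerivAt (fun τ => fisher P τ i i) (-∑ j, hessSq P t i j) t := by
  -- the space derivatives of `u * score ^ 2`
  set F' : ℝ → Fin d → 𝔼 → ℝ := fun τ j x => 2 * score P τ i x * ratio₃ P τ i j j x -
    score P τ i x ^ 2 * ratio₂ P τ j j x with hF'
  have hF'c : ∀ τ, 0 < τ → ∀ j, Continuous (F' τ j) := fun τ hτ j => by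
    have := continuous_score (P := P) hτ i
    have := continuous_ratio₃ (P := P) hτ i j j
    have := continuous_ratio₂ (P := P) hτ j j
    fun_prop
  have hF'b : ∀ τ, t / 2 ≤ τ → ∀ j x, |F' τ j x| ≤
      10 * (1 + 1 / (t / 2)) ^ 4 * (heatMaj P τ x / heatFlow P τ x) ^ 4 := fun τ hτ j x =>
    abs_two_mul_sub_le (by positivity) (one_le_heatMaj_div (by linarith) x)
      (abs_score_le (half_pos ht) hτ i x) (abs_ratio₃_le (half_pos ht) hτ i j j x)
      (abs_ratio₂_le (half_pos ht) hτ j j x) rfl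
  have hF'i : ∀ j, Integrable (fun x => heatFlow P t x * F' t j x) := fun j =>
    integrable_heatFlow_mul ht (hF'c t ht j) (hF'b t (by linarith) j)
  -- The field u (2 sᵢ ∂ᵢⱼu/u - sᵢ² sⱼ), with s the score, has j-derivative u F'ⱼ + 2 u Hᵢⱼ². The
  -- left side integrates to zero, which turns third derivatives into the squared Hessian.
  have hspace : ∀ j, ∫ x, heatFlow P t x * F' t j x = -2 * hessSq P t i j := fun j => by
    have h1 : ∀ x, HasLineDerivAt ℝ (fun x => heatFlow P t x *
        (2 * score P t i x * ratio₂ P t i j x - score P t i x * score P t i x * score P t j x))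
        (heatFlow P t x * F' t j x + 2 * (heatFlow P t x * negHess P t i j x ^ 2)) x
        (stdVec j) := fun x => by
      have hu := hasLineDerivAt_heatFlow_stdVec (P := P) ht j x
      have hs := hasLineDerivAt_score (P := P) ht i j x
      have hsj := hasLineDerivAt_score (P := P) ht j j x
      have hr := hasLineDerivAt_ratio₂ (P := P) ht i j j x
      have hc : HasLineDerivAt ℝ (fun _ : 𝔼 => (2 : ℝ)) 0 x (stdVec j) :=
        (hasFDerivAt_const (2 : ℝ) x).hasLineDerivAt _
      have h := HasLineDerivAt.mul' hu (HasLineDerivAt.sub'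
        (HasLineDerivAt.mul' (HasLineDerivAt.mul' hc hs) hr)
        (HasLineDerivAt.mul' (HasLineDerivAt.mul' hs hs) hsj))
      convert h using 1
      simp only [hF', negHess]
      ring
    have h2 := integral_lineDeriv_eq_zero h1 ?_ ((hF'i j).add
      ((integrable_heatFlow_mul_negHess_sq ht i j).const_mul 2))
    · rw [integral_add (hF'i j) ((integrable_heatFlow_mul_negHess_sq ht i j).const_mul 2),
        integral_const_mul] at h2
      rw [hessSq]
      linarith
    · refine integrable_heatFlow_mul ht ?_ (C := 5 * (1 + 1 / t) ^ 3) fun x => ?_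
      · have := continuous_score (P := P) ht i
        have := continuous_score (P := P) ht j
        have := continuous_ratio₂ (P := P) ht i j
        fun_prop
      · have h1 := abs_score_le (P := P) ht le_rfl i x
        have h2 := abs_score_le (P := P) ht le_rfl j x
        have h3 := abs_ratio₂_le (P := P) ht le_rfl i j x
        have hR := one_le_heatMaj_div (P := P) ht x
        set R := heatMaj P t x / heatFlow P t x
        set M := 1 + 1 / t
        have hM : 0 ≤ M := by positivity
        refine (abs_sub _ _).trans ?_
        rw [abs_mul, abs_mul, abs_mul, abs_mul, abs_two]
        calc _ ≤ 2 * (M * R) * (2 * M ^ 2 * R) + (M * R) * (M * R) * (M * R) := by gcongr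
          _ = 4 * M ^ 3 * R ^ 2 + M ^ 3 * R ^ 3 := by ring
          _ ≤ 4 * M ^ 3 * R ^ 4 + M ^ 3 * R ^ 4 := by gcongr <;> norm_num
          _ = _ := by ring
  obtain ⟨D, hD, hD'⟩ := exists_heatMaj_pow_le (d := d) (half_pos ht)
    (show t / 2 ≤ 2 * t by linarith)
  -- Since u s² = (∂ᵢu)²/u, the heat equation for u and ∂ᵢu gives the time derivative ½ Σⱼ u F'ⱼ. On
  -- (t/2, 2t) it is dominated by a multiple of the heat flow at time 4t.
  have key := hasDerivAt_integral_of_dominated_loc_of_deriv_le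
    (μ := (volume : Measure 𝔼))
    (F := fun τ x => heatFlow P τ x * (score P τ i x * score P τ i x))
    (F' := fun τ x => 1 / 2 * ∑ j, heatFlow P τ x * F' τ j x)
    (bound := fun x => 1 / 2 * ∑ _j : Fin d,
      (10 * (1 + 1 / (t / 2)) ^ 4 * (D * heatFlow P (2 * (2 * t)) x)))
    (s := Set.Ioo (t / 2) (2 * t)) (x₀ := t) (Ioo_mem_nhds (by linarith) (by linarith)) ?_
    (integrable_heatFlow_mul_score_mul_score ht i i) ?_
    (Eventually.of_forall fun x τ hτ => ?_) ?_ (Eventually.of_forall fun x τ hτ => ?_)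
  · have := key.2
    rw [integral_const_mul, integral_finsetSum _ fun j _ => hF'i j,
      Finset.sum_congr rfl fun j _ => hspace j, ← Finset.mul_sum] at this
    refine this.congr_deriv ?_
    ring
  · filter_upwards [lt_mem_nhds ht] with τ hτ
    exact ((continuous_heatFlow hτ).mul
      ((continuous_score hτ i).mul (continuous_score hτ i))).aestronglyMeasurable
  · exact (continuous_const.mul (continuous_finsetSum _ fun j _ =>
      (continuous_heatFlow ht).mul (hF'c t ht j))).aestronglyMeasurable
  · rw [norm_mul, norm_of_nonneg (by norm_num : (0 : ℝ) ≤ 1 / 2)]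
    refine mul_le_mul_of_nonneg_left ((norm_sum_le _ _).trans
      (Finset.sum_le_sum fun j _ => ?_)) (by norm_num)
    have hu := heatFlow_pos (P := P) (show 0 < τ by linarith [hτ.1]) x
    rw [norm_mul, norm_of_nonneg hu.le, norm_eq_abs]
    calc _ ≤ heatFlow P τ x * (10 * (1 + 1 / (t / 2)) ^ 4 *
          (heatMaj P τ x / heatFlow P τ x) ^ 4) := by gcongr; exact hF'b τ hτ.1.le j x
      _ = 10 * (1 + 1 / (t / 2)) ^ 4 *
          (heatFlow P τ x * (heatMaj P τ x / heatFlow P τ x) ^ 4) := by ring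
      _ ≤ _ := mul_le_mul_of_nonneg_left (hD' P τ hτ.1.le hτ.2.le x) (by positivity)
  · exact ((integrable_finsetSum _ fun j _ =>
      ((integrable_heatFlow (P := P) (t := 2 * (2 * t)) (by positivity)).const_mul D).const_mul
        _)).const_mul _
  · have hτ0 : 0 < τ := by linarith [hτ.1]
    have hu := (heatFlow_pos (P := P) hτ0 x).ne'
    have h1 := hasDerivAt_heatFlow (P := P) hτ0 x
    have h2 := hasDerivAt_heatFlow₁ (P := P) hτ0 (norm_stdVec i).le x
    have h3 := (h2.mul h2).div h1 hu
    refine (h3.congr_deriv ?_).congr_of_eventuallyEq ?_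
    · simp only [hF', score, ratio₂, ratio₃]
      simp only [mul_sub, Finset.sum_sub_distrib, Pi.mul_apply]
      have e1 : ∑ j, heatFlow P τ x * (2 * (heatFlow₁ P τ (stdVec i) x / heatFlow P τ x) *
          (heatFlow₃ P τ (stdVec i) (stdVec j) (stdVec j) x / heatFlow P τ x)) =
          2 * heatFlow₁ P τ (stdVec i) x / heatFlow P τ x *
            ∑ j, heatFlow₃ P τ (stdVec i) (stdVec j) (stdVec j) x := by
        rw [Finset.mul_sum]
        exact Finset.sum_congr rfl fun j _ => by field_simp
      have e2 : ∑ j, heatFlow P τ x * ((heatFlow₁ P τ (stdVec i) x / heatFlow P τ x) ^ 2 *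
          (heatFlow₂ P τ (stdVec j) (stdVec j) x / heatFlow P τ x)) =
          (heatFlow₁ P τ (stdVec i) x / heatFlow P τ x) ^ 2 *
            ∑ j, heatFlow₂ P τ (stdVec j) (stdVec j) x := by
        rw [Finset.mul_sum]
        exact Finset.sum_congr rfl fun j _ => by field_simp
      rw [e1, e2]
      field_simp
      ring
    · filter_upwards [lt_mem_nhds hτ0] with σ hσ
      have := (heatFlow_pos (P := P) hσ x).ne'
      simp only [score, Pi.mul_apply, Pi.div_apply]
      field_simp

end DeBruijn
end EntropyJump

/-! ### De Bruijn's identity -/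

namespace EntropyJump

section EntropyDerivative

open Real InnerProductSpace Filter Topology

variable {d : ℕ}

local notation "𝔼" => EuclideanSpace ℝ (Fin d)

variable {P : Measure (EuclideanSpace ℝ (Fin d))} [IsProbabilityMeasure P] {t : ℝ}

lemma integrable_norm_of_sq (hP : Integrable (fun x : 𝔼 => ‖x‖ ^ 2) P) :
    Integrable (fun x : 𝔼 => ‖x‖) P := by
  refine ((integrable_const (1 : ℝ)).add hP).mono' continuous_norm.aestronglyMeasurable
    (Eventually.of_forall fun x => ?_)
  rw [norm_norm]
  simp only [Pi.add_apply]
  nlinarith [sq_nonneg (‖x‖ - 1)]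

lemma norm_sq_add_le (y z : 𝔼) : ‖y + z‖ ^ 2 ≤ 2 * ‖y‖ ^ 2 + 2 * ‖z‖ ^ 2 := by
  have h := norm_add_le y z
  have h0 := norm_nonneg (y + z)
  nlinarith [sq_nonneg (‖y‖ - ‖z‖)]

/-- Quadratic growth separates through ‖y + z‖² ≤ 2‖y‖² + 2‖z‖²: one factor uses the second moment
of P, the other a Gaussian moment two degrees higher. This is the integrability behind every Fubini
argument for moments of the flow. -/
lemma integrable_prod_heatKernel {φ : 𝔼 → ℝ} (hφ : Continuous φ) {C : ℝ}
    (hφC : ∀ x, |φ x| ≤ C * (1 + ‖x‖ ^ 2))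
    (hP : Integrable (fun x : 𝔼 => ‖x‖ ^ 2) P) {q : 𝔼 → ℝ} (hq : Continuous q)
    {D : ℝ} {m : ℕ} (ht : 0 < t) (hqD : ∀ z, |q z| ≤ D * ((1 + ‖z‖) ^ m * heatKernel t z)) :
    Integrable (fun p : 𝔼 × 𝔼 => φ (p.1 + p.2) * q p.2) (P.prod volume) := by
  have hD : 0 ≤ D := by
    have h0 := (abs_nonneg _).trans (hqD 0)
    have := heatKernel_pos t (0 : 𝔼)
    simp only [norm_zero, add_zero, one_pow, one_mul] at h0
    exact nonneg_of_mul_nonneg_left h0 this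
  have hC : 0 ≤ C := by
    have h0 := (abs_nonneg _).trans (hφC 0)
    simpa using h0
  have i1 := (((integrable_const (1 : ℝ)).add (hP.const_mul 2)).mul_prod
    ((integrable_pow_mul_heatKernel (d := d) m ht).const_mul (C * D)))
  have i2 := ((integrable_const (μ := P) (1 : ℝ)).mul_prod
    ((integrable_pow_mul_heatKernel (d := d) (m + 2) ht).const_mul (2 * C * D)))
  refine (i1.add i2).mono' (by fun_prop) (Eventually.of_forall fun p => ?_)
  have h1 := hφC (p.1 + p.2)
  have h2 := hqD p.2
  have h3 := norm_sq_add_le p.1 p.2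
  have hk := heatKernel_pos t p.2
  have hz := norm_nonneg p.2
  rw [norm_mul, norm_eq_abs, norm_eq_abs]
  simp only [Pi.add_apply]
  have hB : 0 ≤ (1 + ‖p.2‖) ^ m * heatKernel t p.2 := by positivity
  calc |φ (p.1 + p.2)| * |q p.2| ≤ (C * (1 + (2 * ‖p.1‖ ^ 2 + 2 * ‖p.2‖ ^ 2))) *
        (D * ((1 + ‖p.2‖) ^ m * heatKernel t p.2)) := by
        gcongr
        exact h1.trans (by gcongr)
    _ = (1 + 2 * ‖p.1‖ ^ 2) * (C * D * ((1 + ‖p.2‖) ^ m * heatKernel t p.2)) +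
        2 * C * D * (‖p.2‖ ^ 2 * ((1 + ‖p.2‖) ^ m * heatKernel t p.2)) := by ring
    _ ≤ (1 + 2 * ‖p.1‖ ^ 2) * (C * D * ((1 + ‖p.2‖) ^ m * heatKernel t p.2)) +
        2 * C * D * ((1 + ‖p.2‖) ^ 2 * ((1 + ‖p.2‖) ^ m * heatKernel t p.2)) := by
        gcongr; linarith
    _ = _ := by ring

lemma integrable_prod_heatKernel₀ {φ : 𝔼 → ℝ} (hφ : Continuous φ) {C : ℝ}
    (hφC : ∀ x, |φ x| ≤ C * (1 + ‖x‖ ^ 2))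
    (hP : Integrable (fun x : 𝔼 => ‖x‖ ^ 2) P) (ht : 0 < t) :
    Integrable (fun p : 𝔼 × 𝔼 => φ (p.1 + p.2) * heatKernel t p.2) (P.prod volume) :=
  integrable_prod_heatKernel hφ hφC hP (continuous_heatKernel t) ht (m := 0) (D := 1)
    fun z => by simp [abs_of_pos (heatKernel_pos t z)]

lemma integrable_mul_heatFlow {φ : 𝔼 → ℝ} (hφ : Continuous φ) {C : ℝ}
    (hφC : ∀ x, |φ x| ≤ C * (1 + ‖x‖ ^ 2))
    (hP : Integrable (fun x : 𝔼 => ‖x‖ ^ 2) P) (ht : 0 < t) :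
    Integrable (fun x => φ x * heatFlow P t x) :=
  integrable_mul_measConv (integrable_prod_heatKernel₀ hφ hφC hP ht)

lemma integrable_one_add_norm_sq_mul_heatFlow (hP : Integrable (fun x : 𝔼 => ‖x‖ ^ 2) P)
    (ht : 0 < t) : Integrable (fun x => (1 + ‖x‖ ^ 2) * heatFlow P t x) :=
  integrable_mul_heatFlow (φ := fun x => 1 + ‖x‖ ^ 2) (by fun_prop) (C := 1)
    (fun x => by rw [one_mul, abs_of_nonneg (by positivity)]) hP ht

lemma heatFlow_le_heatKernel_zero (ht : 0 < t) (x : 𝔼) :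
    heatFlow P t x ≤ heatKernel t (0 : 𝔼) := by
  have := integral_mono (integrable_heatKernel_comp_sub (P := P) ht x)
    (integrable_const (heatKernel t (0 : 𝔼))) fun y => heatKernel_le t ht (x - y)
  simpa [measConv] using this

lemma log_heatKernel (t : ℝ) (z : 𝔼) :
    log (heatKernel t z) = -‖z‖ ^ 2 / (2 * t) - d / 2 * log (2 * π * t) := by
  rw [heatKernel, log_exp]

/-- Jensen's inequality for exp. The logarithm of the kernel at x - y is at least an expression
affine in ‖y‖², whose P-mean is the left side m; the tangent line of exp at m is then integrated. -/
lemma le_log_heatFlow (hP : Integrable (fun x : 𝔼 => ‖x‖ ^ 2) P) (ht : 0 < t) (x : 𝔼) :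
    -(‖x‖ ^ 2 + ∫ y, ‖y‖ ^ 2 ∂P) / t - d / 2 * log (2 * π * t) ≤ log (heatFlow P t x) := by
  rw [le_log_iff_exp_le (heatFlow_pos ht x)]
  set m := -(‖x‖ ^ 2 + ∫ y, ‖y‖ ^ 2 ∂P) / t - d / 2 * log (2 * π * t) with hm
  have h1 : ∀ y, exp m * (1 + (-(‖x‖ ^ 2 + ‖y‖ ^ 2) / t - d / 2 * log (2 * π * t) - m)) ≤
      heatKernel t (x - y) := fun y => by
    have h2 : ‖x - y‖ ^ 2 ≤ 2 * ‖x‖ ^ 2 + 2 * ‖y‖ ^ 2 := by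
      simpa [sub_eq_add_neg] using norm_sq_add_le x (-y)
    have h3 : -(‖x‖ ^ 2 + ‖y‖ ^ 2) / t - d / 2 * log (2 * π * t) ≤
        -‖x - y‖ ^ 2 / (2 * t) - d / 2 * log (2 * π * t) := by
      rw [sub_le_sub_iff_right, div_le_div_iff₀ ht (by positivity)]
      nlinarith
    calc _ ≤ exp m * exp (-(‖x‖ ^ 2 + ‖y‖ ^ 2) / t - d / 2 * log (2 * π * t) - m) := by
          gcongr
          linarith [add_one_le_exp (-(‖x‖ ^ 2 + ‖y‖ ^ 2) / t - d / 2 * log (2 * π * t) - m)]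
      _ = exp (-(‖x‖ ^ 2 + ‖y‖ ^ 2) / t - d / 2 * log (2 * π * t)) := by
          rw [← exp_add]; congr 1; ring
      _ ≤ _ := exp_le_exp.2 h3
  have e : ∀ y : 𝔼, exp m * (1 + (-(‖x‖ ^ 2 + ‖y‖ ^ 2) / t - d / 2 * log (2 * π * t) - m)) =
      exp m * (1 - ‖x‖ ^ 2 / t - d / 2 * log (2 * π * t) - m) - exp m / t * ‖y‖ ^ 2 := fun y => by
    ring
  simp_rw [e] at h1
  have h4 := integral_mono ((integrable_const _).sub (hP.const_mul _))
    (integrable_heatKernel_comp_sub ht x) h1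
  rw [integral_sub' (integrable_const _) (hP.const_mul _), integral_const_mul] at h4
  simp only [integral_const, probReal_univ, smul_eq_mul, one_mul] at h4
  refine le_trans (le_of_eq ?_) h4
  have : exp m * (1 - ‖x‖ ^ 2 / t - d / 2 * log (2 * π * t) - m) - exp m / t * ∫ y, ‖y‖ ^ 2 ∂P =
    exp m * (1 + ((-(‖x‖ ^ 2 + ∫ y, ‖y‖ ^ 2 ∂P) / t - d / 2 * log (2 * π * t)) - m)) := by ring
  rw [integral_const_mul, this, ← hm]
  ring

/-- The logarithm of the heat flow grows at most quadratically, locally uniformly in time. -/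
lemma exists_abs_log_heatFlow_le (hP : Integrable (fun x : 𝔼 => ‖x‖ ^ 2) P) {a b : ℝ}
    (ha : 0 < a) : ∃ C, 0 ≤ C ∧ ∀ t, a ≤ t → t ≤ b → ∀ x,
      |log (heatFlow P t x)| ≤ C * (1 + ‖x‖ ^ 2) := by
  set m := ∫ y, ‖y‖ ^ 2 ∂P
  have hm : 0 ≤ m := integral_nonneg fun y => by positivity
  refine ⟨(1 + m) / a + d / 2 * (|log (2 * π * a)| + |log (2 * π * b)|), by positivity,
    fun t hat htb x => ?_⟩
  have ht := ha.trans_le hat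
  have h1 := le_log_heatFlow hP ht x
  have h2 : log (heatFlow P t x) ≤ -(d / 2 * log (2 * π * t)) := by
    have := log_le_log (heatFlow_pos ht x) (heatFlow_le_heatKernel_zero (P := P) ht x)
    rw [log_heatKernel] at this
    simpa using this
  have h3 : |log (2 * π * t)| ≤ |log (2 * π * a)| + |log (2 * π * b)| := by
    have l1 : log (2 * π * a) ≤ log (2 * π * t) := log_le_log (by positivity) (by gcongr)
    have l2 : log (2 * π * t) ≤ log (2 * π * b) := log_le_log (by positivity) (by gcongr)
    rw [abs_le]
    constructor
    · linarith [neg_abs_le (log (2 * π * a)), abs_nonneg (log (2 * π * b))]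
    · linarith [le_abs_self (log (2 * π * b)), abs_nonneg (log (2 * π * a))]
  have h4 : |(d / 2 : ℝ) * log (2 * π * t)| ≤ d / 2 * (|log (2 * π * a)| + |log (2 * π * b)|) := by
    rw [abs_mul, abs_of_nonneg (by positivity)]
    gcongr
  have h5 : (‖x‖ ^ 2 + m) / t ≤ (1 + m) / a * (1 + ‖x‖ ^ 2) := by
    calc (‖x‖ ^ 2 + m) / t ≤ (‖x‖ ^ 2 + m) / a := by gcongr
      _ ≤ ((1 + m) * (1 + ‖x‖ ^ 2)) / a := by
        gcongr
        nlinarith [mul_nonneg hm (sq_nonneg ‖x‖)]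
      _ = _ := by ring
  have h6 : d / 2 * (|log (2 * π * a)| + |log (2 * π * b)|) ≤
      d / 2 * (|log (2 * π * a)| + |log (2 * π * b)|) * (1 + ‖x‖ ^ 2) :=
    le_mul_of_one_le_right (by positivity) (by nlinarith [sq_nonneg ‖x‖])
  have h7 := abs_le.1 h4
  have h8 : 0 ≤ (1 + m) / a * (1 + ‖x‖ ^ 2) := by positivity
  rw [neg_div] at h1
  rw [abs_le, add_mul]
  constructor <;> linarith [h7.1, h7.2]

lemma integrable_heatFlow_mul_log (hP : Integrable (fun x : 𝔼 => ‖x‖ ^ 2) P) (ht : 0 < t) :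
    Integrable (fun x => heatFlow P t x * log (heatFlow P t x)) := by
  obtain ⟨C, hC0, hC⟩ := exists_abs_log_heatFlow_le hP (b := t) ht
  have hc : Continuous fun x => log (heatFlow P t x) :=
    (continuous_heatFlow ht).log fun x => (heatFlow_pos ht x).ne'
  simpa only [mul_comm] using integrable_mul_heatFlow hc (hC t le_rfl le_rfl) hP ht

/-- The majorant is u R with R ≥ 1, hence at most u R⁴, to which the fixed-time domination applies.
-/
lemma abs_le_mul_heatFlow_of_abs_le_heatMaj {a b C D : ℝ} (ha : 0 < a)
    (hD : ∀ (P : Measure 𝔼) [IsProbabilityMeasure P], ∀ t, a ≤ t → t ≤ b → ∀ x,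
      heatFlow P t x * (heatMaj P t x / heatFlow P t x) ^ 4 ≤ D * heatFlow P (2 * b) x)
    (hC : 0 ≤ C) (hat : a ≤ t) (htb : t ≤ b) {x : 𝔼} {w : ℝ} (hw : |w| ≤ C * heatMaj P t x) :
    |w| ≤ C * D * heatFlow P (2 * b) x := by
  have hu := heatFlow_pos (P := P) (ha.trans_le hat) x
  have hR := one_le_heatMaj_div (P := P) (ha.trans_le hat) x
  refine hw.trans ?_
  rw [mul_assoc]
  refine mul_le_mul_of_nonneg_left (le_trans ?_ (hD P t hat htb x)) hC
  calc heatMaj P t x = heatFlow P t x * (heatMaj P t x / heatFlow P t x) ^ 1 := by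
        field_simp
    _ ≤ _ := by gcongr; norm_num

/-- De Bruijn's identity. -/
lemma hasDerivAt_flowEntropy (hP : Integrable (fun x : 𝔼 => ‖x‖ ^ 2) P) (ht : 0 < t) :
    HasDerivAt (flowEntropy P) (1 / 2 * ∑ i, fisher P t i i) t := by
  set a := t / 2 with ha
  set b := 2 * t with hb
  have ha0 : 0 < a := by positivity
  have hat : a ≤ t := by linarith
  have htb : t ≤ b := by linarith
  obtain ⟨D, hD0, hD⟩ := exists_heatMaj_pow_le (d := d) ha0 (hat.trans htb)
  obtain ⟨L, hL0, hL⟩ := exists_abs_log_heatFlow_le hP (b := b) ha0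
  set M := 1 + 1 / a
  have hM : 0 < M := by positivity
  have hlog : ∀ τ, a ≤ τ → τ ≤ b → ∀ x, |log (heatFlow P τ x) + 1| ≤ (L + 1) * (1 + ‖x‖ ^ 2) :=
    fun τ h1 h2 x => by
      refine (abs_add_le _ _).trans ?_
      have := hL τ h1 h2 x
      rw [abs_one]
      nlinarith [sq_nonneg ‖x‖]
  -- The logarithm costs a quadratic weight, affordable because the flow at the later time 2b keeps
  -- a finite second moment.
  have hdom : ∀ C : ℝ, 0 ≤ C → ∀ τ, a ≤ τ → τ ≤ b → ∀ x w, |w| ≤ C * heatMaj P τ x →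
      |w * (log (heatFlow P τ x) + 1)| ≤
        C * D * (L + 1) * ((1 + ‖x‖ ^ 2) * heatFlow P (2 * b) x) := fun C hC τ h1 h2 x w hw => by
    have h3 := abs_le_mul_heatFlow_of_abs_le_heatMaj ha0 hD hC h1 h2 hw
    have h4 := hlog τ h1 h2 x
    have := (heatFlow_pos (P := P) (show 0 < 2 * b by positivity) x).le
    rw [abs_mul]
    calc _ ≤ C * D * heatFlow P (2 * b) x * ((L + 1) * (1 + ‖x‖ ^ 2)) := by gcongr
      _ = _ := by ring
  have hint := integrable_one_add_norm_sq_mul_heatFlow hP (t := 2 * b) (by positivity)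
  have hlogc : ∀ τ, 0 < τ → Continuous fun x => log (heatFlow P τ x) + 1 := fun τ hτ =>
    ((continuous_heatFlow hτ).log fun x => (heatFlow_pos hτ x).ne').add continuous_const
  have h2c : ∀ τ, 0 < τ → ∀ j : Fin d, Continuous (heatFlow₂ P τ (stdVec j) (stdVec j)) :=
    fun τ hτ j => (contDiff_heatFlow₂ hτ (norm_stdVec j).le (norm_stdVec j).le).continuous
  have h2b : ∀ τ, a ≤ τ → ∀ (j : Fin d) (x : 𝔼),
      |heatFlow₂ P τ (stdVec j) (stdVec j) x| ≤ 2 * M ^ 2 * heatMaj P τ x := fun τ hτ j x =>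
    abs_heatFlow₂_le ha0 hτ (norm_stdVec j).le (norm_stdVec j).le x
  have h2i : ∀ j : Fin d, Integrable (fun x => heatFlow₂ P t (stdVec j) (stdVec j) x *
      (log (heatFlow P t x) + 1)) := fun j =>
    (hint.const_mul _).mono' ((h2c t ht j).mul (hlogc t ht)).aestronglyMeasurable
      (Eventually.of_forall fun x => hdom (2 * M ^ 2) (by positivity) t hat htb x _
        (h2b t hat j x))
  -- The j-derivative of ∂ⱼu (log u + 1) is ∂ⱼⱼu (log u + 1) + (∂ⱼu)²/u, and its integral vanishes.
  -- The term log u + 1 is the derivative of u log u in u.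
  have hspace : ∀ j : Fin d, ∫ x, heatFlow₂ P t (stdVec j) (stdVec j) x *
      (log (heatFlow P t x) + 1) = -fisher P t j j := fun j => by
    have h1 : ∀ x, HasLineDerivAt ℝ (fun x => heatFlow₁ P t (stdVec j) x *
        (log (heatFlow P t x) - (-1))) (heatFlow₂ P t (stdVec j) (stdVec j) x *
        (log (heatFlow P t x) + 1) + heatFlow P t x * (score P t j x * score P t j x)) x
        (stdVec j) := fun x => by
      have hu := hasLineDerivAt_heatFlow_stdVec (P := P) ht j x
      have hl := HasLineDerivAt.log' hu (heatFlow_pos ht x).ne'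
      have hc : HasLineDerivAt ℝ (fun _ : 𝔼 => (-1 : ℝ)) 0 x (stdVec j) :=
        (hasFDerivAt_const (-1 : ℝ) x).hasLineDerivAt _
      have h := HasLineDerivAt.mul' (hasLineDerivAt_heatFlow₁ (P := P) ht (norm_stdVec j).le x
        (stdVec j)) (HasLineDerivAt.sub' hl hc)
      refine HasDerivAt.congr_deriv h ?_
      have := (heatFlow_pos (P := P) ht x).ne'
      simp only [score]
      field_simp
      ring
    have h2 := integral_lineDeriv_eq_zero h1 ?_
      ((h2i j).add (integrable_heatFlow_mul_score_mul_score ht j j))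
    · rw [integral_add (h2i j) (integrable_heatFlow_mul_score_mul_score ht j j)] at h2
      rw [fisher]
      linarith
    · simp only [sub_neg_eq_add]
      exact (hint.const_mul _).mono' ((contDiff_heatFlow₁ ht
        (norm_stdVec j).le).continuous.mul (hlogc t ht)).aestronglyMeasurable
        (Eventually.of_forall fun x => hdom M hM.le t hat htb x _
          (abs_heatFlow₁_le ha0 hat (norm_stdVec j).le x))
  have key := hasDerivAt_integral_of_dominated_loc_of_deriv_le
    (μ := (volume : Measure 𝔼))
    (F := fun τ x => heatFlow P τ x * log (heatFlow P τ x))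
    (F' := fun τ x => 1 / 2 * ∑ j, heatFlow₂ P τ (stdVec j) (stdVec j) x *
      (log (heatFlow P τ x) + 1))
    (bound := fun x => 1 / 2 * ∑ _j : Fin d, 2 * M ^ 2 * D * (L + 1) *
      ((1 + ‖x‖ ^ 2) * heatFlow P (2 * b) x))
    (s := Set.Ioo a b) (x₀ := t) (Ioo_mem_nhds (by linarith) (by linarith)) ?_
    (integrable_heatFlow_mul_log hP ht) ?_
    (Eventually.of_forall fun x τ hτ => ?_) ?_ (Eventually.of_forall fun x τ hτ => ?_)
  · have := key.2.neg
    rw [integral_const_mul, integral_finsetSum _ fun j _ => h2i j,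
      Finset.sum_congr rfl fun j _ => hspace j, Finset.sum_neg_distrib] at this
    refine this.congr_deriv ?_
    ring
  · filter_upwards [lt_mem_nhds ht] with τ hτ
    exact ((continuous_heatFlow hτ).mul
      ((continuous_heatFlow hτ).log fun x => (heatFlow_pos hτ x).ne')).aestronglyMeasurable
  · exact (continuous_const.mul (continuous_finsetSum _ fun j _ =>
      (h2c t ht j).mul (hlogc t ht))).aestronglyMeasurable
  · rw [norm_mul, norm_of_nonneg (by norm_num : (0 : ℝ) ≤ 1 / 2)]
    refine mul_le_mul_of_nonneg_left ((norm_sum_le _ _).trans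
      (Finset.sum_le_sum fun j _ => ?_)) (by norm_num)
    exact hdom (2 * M ^ 2) (by positivity) τ hτ.1.le hτ.2.le x _ (h2b τ hτ.1.le j x)
  · exact (integrable_finsetSum _ fun j _ => hint.const_mul _).const_mul _
  · have hτ0 : 0 < τ := ha0.trans hτ.1
    have hu := (heatFlow_pos (P := P) hτ0 x).ne'
    have h1 := hasDerivAt_heatFlow (P := P) hτ0 x
    refine (h1.fun_mul (h1.log hu)).congr_deriv ?_
    rw [← Finset.sum_mul]
    field_simp

end EntropyDerivative
end EntropyJump

/-! ### Moments of the flow and elementary Fisher information bounds -/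

namespace EntropyJump

section IsotropicFlow

open Real InnerProductSpace Filter Topology

variable {d : ℕ}

local notation "𝔼" => EuclideanSpace ℝ (Fin d)

lemma integral_add_three {α : Type*} [MeasurableSpace α] {μ : Measure α} {f g h : α → ℝ}
    (hf : Integrable f μ) (hg : Integrable g μ) (hh : Integrable h μ) :
    ∫ x, (f x + (g x + h x)) ∂μ = ∫ x, f x ∂μ + (∫ x, g x ∂μ + ∫ x, h x ∂μ) := by
  rw [← integral_add hg hh]
  exact integral_add hf (hg.add hh)

lemma integral_add_four {α : Type*} [MeasurableSpace α] {μ : Measure α} {f g h k : α → ℝ}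
    (hf : Integrable f μ) (hg : Integrable g μ) (hh : Integrable h μ) (hk : Integrable k μ) :
    ∫ x, (f x + (g x + (h x + k x))) ∂μ =
      ∫ x, f x ∂μ + (∫ x, g x ∂μ + (∫ x, h x ∂μ + ∫ x, k x ∂μ)) := by
  rw [← integral_add_three hg hh hk]
  exact integral_add hf (hg.add (hh.add hk))

/-- A centered measure whose covariance matrix is the identity. -/
structure IsIsotropicMeasure (P : Measure 𝔼) : Prop where
  integrable_sq : Integrable (fun x : 𝔼 => ‖x‖ ^ 2) P
  mean : ∀ i, ∫ x : 𝔼, x i ∂P = 0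
  cov : ∀ i j, ∫ x : 𝔼, x i * x j ∂P = if i = j then 1 else 0

variable {P : Measure (EuclideanSpace ℝ (Fin d))} [IsProbabilityMeasure P] {t : ℝ}

lemma abs_coord_le (x : 𝔼) (i : Fin d) : |x i| ≤ 1 * (1 + ‖x‖ ^ 2) := by
  have := abs_coord_le_norm x i
  nlinarith [sq_nonneg (‖x‖ - 1)]

lemma abs_coord_mul_coord_le (x : 𝔼) (i j : Fin d) : |x i * x j| ≤ 1 * (1 + ‖x‖ ^ 2) := by
  rw [abs_mul]
  nlinarith [abs_coord_le_norm x i, abs_coord_le_norm x j, abs_nonneg (x i), abs_nonneg (x j)]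

lemma integrable_coord (hP : Integrable (fun x : 𝔼 => ‖x‖ ^ 2) P) (i : Fin d) :
    Integrable (fun x : 𝔼 => x i) P :=
  (((integrable_const (1 : ℝ)).add hP).const_mul 1).mono'
    (by fun_prop) (Eventually.of_forall fun x => abs_coord_le x i)

lemma integrable_coord_mul_coord (hP : Integrable (fun x : 𝔼 => ‖x‖ ^ 2) P) (i j : Fin d) :
    Integrable (fun x : 𝔼 => x i * x j) P :=
  (((integrable_const (1 : ℝ)).add hP).const_mul 1).mono'
    (by fun_prop) (Eventually.of_forall fun x => abs_coord_mul_coord_le x i j)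

lemma integrable_coord_mul_heatFlow (hP : Integrable (fun x : 𝔼 => ‖x‖ ^ 2) P) (ht : 0 < t)
    (i : Fin d) : Integrable (fun x => x i * heatFlow P t x) :=
  integrable_mul_heatFlow (φ := fun x : 𝔼 => x i) (by fun_prop)
    (fun x => abs_coord_le x i) hP ht

lemma integrable_coord_mul_coord_mul_heatFlow (hP : Integrable (fun x : 𝔼 => ‖x‖ ^ 2) P)
    (ht : 0 < t) (i j : Fin d) : Integrable (fun x => x i * x j * heatFlow P t x) :=
  integrable_mul_heatFlow (φ := fun x : 𝔼 => x i * x j) (by fun_prop)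
    (fun x => abs_coord_mul_coord_le x i j) hP ht

lemma integral_coord_mul_heatFlow (hP : IsIsotropicMeasure P) (ht : 0 < t) (i : Fin d) :
    ∫ x, x i * heatFlow P t x = 0 := by
  rw [integral_mul_measConv (integrable_prod_heatKernel₀ (φ := fun x : 𝔼 => x i) (by fun_prop)
    (fun x => abs_coord_le x i) hP.integrable_sq ht)]
  have : ∀ y : 𝔼, ∫ z, (y + z) i * heatKernel t z = y i := fun y => by
    simp only [PiLp.add_apply, add_mul]
    rw [integral_add ((integrable_heatKernel ht).const_mul _)
      (integrable_coord_mul_heatKernel ht i), integral_const_mul, integral_heatKernel ht,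
      integral_coord_mul_heatKernel ht]
    ring
  simp_rw [this]
  exact hP.mean i

lemma integral_coord_mul_coord_mul_heatFlow (hP : IsIsotropicMeasure P) (ht : 0 < t)
    (i j : Fin d) : ∫ x, x i * x j * heatFlow P t x = if i = j then 1 + t else 0 := by
  rw [integral_mul_measConv (integrable_prod_heatKernel₀ (φ := fun x : 𝔼 => x i * x j)
    (by fun_prop) (fun x => abs_coord_mul_coord_le x i j) hP.integrable_sq ht)]
  have : ∀ y : 𝔼, ∫ z, (y + z) i * (y + z) j * heatKernel t z =
      y i * y j + if i = j then t else 0 := fun y => by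
    have e : ∀ z : 𝔼, (y + z) i * (y + z) j * heatKernel t z = y i * y j * heatKernel t z +
        (y i * (z j * heatKernel t z) + (y j * (z i * heatKernel t z) +
          z i * z j * heatKernel t z)) := fun z => by
      simp only [PiLp.add_apply]; ring
    simp_rw [e]
    have i1 := (integrable_heatKernel (d := d) ht).const_mul (y i * y j)
    have i2 := (integrable_coord_mul_heatKernel (d := d) ht j).const_mul (y i)
    have i3 := (integrable_coord_mul_heatKernel (d := d) ht i).const_mul (y j)
    have i4 := integrable_coord_mul_coord_mul_heatKernel (d := d) ht i j
    rw [integral_add_four i1 i2 i3 i4,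
      integral_const_mul, integral_const_mul, integral_const_mul, integral_heatKernel ht,
      integral_coord_mul_heatKernel ht, integral_coord_mul_heatKernel ht,
      integral_coord_mul_coord_mul_heatKernel ht]
    ring
  simp_rw [this]
  rw [integral_add (integrable_coord_mul_coord hP.integrable_sq i j) (integrable_const _), hP.cov]
  split_ifs <;> simp

lemma integrable_heatFlow₁ (ht : 0 < t) (i : Fin d) : Integrable (heatFlow₁ P t (stdVec i)) :=
  integrable_measConv (integrable_heatKernel₁ ht _ (norm_stdVec i).le)

lemma integrable_heatFlow₂ (ht : 0 < t) (i j : Fin d) :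
    Integrable (heatFlow₂ P t (stdVec i) (stdVec j)) :=
  integrable_measConv (integrable_heatKernel₂ ht _ _ (norm_stdVec i).le (norm_stdVec j).le)

lemma integral_heatFlow₁ (ht : 0 < t) (i : Fin d) : ∫ x, heatFlow₁ P t (stdVec i) x = 0 := by
  rw [integral_measConv (integrable_heatKernel₁ ht _ (norm_stdVec i).le),
    integral_heatKernel₁ ht _ (norm_stdVec i).le]

lemma integral_heatFlow₂ (ht : 0 < t) (i j : Fin d) :
    ∫ x, heatFlow₂ P t (stdVec i) (stdVec j) x = 0 := by
  rw [integral_measConv (integrable_heatKernel₂ ht _ _ (norm_stdVec i).le (norm_stdVec j).le),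
    integral_heatKernel₂ ht _ _ (norm_stdVec i).le (norm_stdVec j).le]

lemma integrable_coord_mul_heatFlow₁ (hP : Integrable (fun x : 𝔼 => ‖x‖ ^ 2) P) (ht : 0 < t)
    (i j : Fin d) : Integrable (fun x => x j * heatFlow₁ P t (stdVec i) x) :=
  integrable_mul_measConv (integrable_prod_heatKernel (φ := fun x : 𝔼 => x j) (by fun_prop)
    (fun x => abs_coord_le x j) hP (contDiff_heatKernel₁ t (stdVec i) (n := 0)).continuous ht
    (fun z => abs_heatKernel₁_le ht le_rfl (stdVec i) z (norm_stdVec i).le))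

/-- Integration by parts: the derivative falls on the coordinate. This evaluates every pairing of a
score with a linear function. -/
lemma integral_coord_mul_heatFlow₁ (hP : IsIsotropicMeasure P) (ht : 0 < t) (i j : Fin d) :
    ∫ x, x j * heatFlow₁ P t (stdVec i) x = if i = j then -1 else 0 := by
  have hL : ∀ x : 𝔼, HasLineDerivAt ℝ (fun x : 𝔼 => x j) (if i = j then 1 else 0) x
      (stdVec i) := fun x => by
    have h := (hasFDerivAt_inner_left (stdVec j) x).hasLineDerivAt (stdVec i)
    simp only [inner_stdVec, innerSL_apply_apply] at h
    refine HasDerivAt.congr_deriv h ?_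
    simp [stdVec, eq_comm]
  have h1 : ∀ x : 𝔼, HasLineDerivAt ℝ (fun x : 𝔼 => x j * heatFlow P t x)
      ((if i = j then 1 else 0) * heatFlow P t x + x j * heatFlow₁ P t (stdVec i) x) x
      (stdVec i) := fun x =>
    HasLineDerivAt.mul' (hL x) (hasLineDerivAt_heatFlow ht x _)
  have h2 := integral_lineDeriv_eq_zero h1 (integrable_coord_mul_heatFlow hP.integrable_sq ht j)
    (((integrable_heatFlow ht).const_mul _).add
      (integrable_coord_mul_heatFlow₁ hP.integrable_sq ht i j))
  rw [integral_add ((integrable_heatFlow ht).const_mul _)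
    (integrable_coord_mul_heatFlow₁ hP.integrable_sq ht i j), integral_const_mul,
    integral_heatFlow ht] at h2
  split_ifs at h2 ⊢ <;> linarith

lemma heatFlow_mul_negHess (ht : 0 < t) (i j : Fin d) (x : 𝔼) :
    heatFlow P t x * negHess P t i j x = heatFlow P t x * (score P t i x * score P t j x) -
      heatFlow₂ P t (stdVec i) (stdVec j) x := by
  rw [negHess, mul_sub, heatFlow_mul_ratio₂ ht]

/-- The two integrands differ by the second derivative of a density, which integrates to zero. So
the Fisher matrix is the mean of the Hessian of -log u. -/
lemma fisher_eq_integral_negHess (ht : 0 < t) (i j : Fin d) :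
    ∫ x, heatFlow P t x * negHess P t i j x = fisher P t i j := by
  simp_rw [heatFlow_mul_negHess ht]
  rw [integral_sub (integrable_heatFlow_mul_score_mul_score ht i j) (integrable_heatFlow₂ ht i j),
    integral_heatFlow₂ ht, sub_zero, fisher]

/-- Cramér–Rao: expand the square of score + σ xᵢ, which vanishes for the Gaussian of variance 1 + t
when σ = 1/(1+t). -/
lemma fisher_ge (hP : IsIsotropicMeasure P) (ht : 0 < t) (i : Fin d) :
    1 / (1 + t) ≤ fisher P t i i := by
  set σ := (1 + t)⁻¹ with hσ
  have h0 : 0 ≤ ∫ x, heatFlow P t x * (score P t i x + σ * x i) ^ 2 :=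
    integral_nonneg fun x => mul_nonneg (heatFlow_pos ht x).le (sq_nonneg _)
  have e : ∀ x, heatFlow P t x * (score P t i x + σ * x i) ^ 2 =
      heatFlow P t x * (score P t i x * score P t i x) +
        (2 * σ * (x i * heatFlow₁ P t (stdVec i) x) +
          σ ^ 2 * (x i * x i * heatFlow P t x)) := fun x => by
    rw [← heatFlow_mul_score ht]; ring
  simp_rw [e] at h0
  have i1 := integrable_heatFlow_mul_score_mul_score (P := P) ht i i
  have i2 := (integrable_coord_mul_heatFlow₁ hP.integrable_sq ht i i).const_mul (2 * σ)
  have i3 := (integrable_coord_mul_coord_mul_heatFlow hP.integrable_sq ht i i).const_mul (σ ^ 2)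
  rw [integral_add_three i1 i2 i3, integral_const_mul, integral_const_mul,
    integral_coord_mul_heatFlow₁ hP ht, integral_coord_mul_coord_mul_heatFlow hP ht] at h0
  simp only [if_true] at h0
  have : σ ^ 2 * (1 + t) = σ := by rw [hσ]; field_simp
  rw [fisher, one_div]
  linarith

/-- The score is the conditional mean of -zᵢ/t given y + z = x, with y drawn from P and z from the
kernel, so its square is at most the conditional mean of zᵢ²/t². The proof expands (zᵢ/t + s)² ≥ 0.
-/
lemma score_sq_le (ht : 0 < t) (i : Fin d) (x : 𝔼) :
    heatFlow P t x * (score P t i x * score P t i x) ≤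
      measConv P (fun z => z i * z i / t ^ 2 * heatKernel t z) x := by
  have hb : ∀ z : 𝔼, |z i * z i / t ^ 2 * heatKernel t z| ≤
      (t ^ 2)⁻¹ * ((1 + ‖z‖) ^ 2 * heatKernel t z) := fun z => by
    rw [abs_mul, abs_of_pos (heatKernel_pos t z), abs_div, abs_of_pos (pow_pos ht 2), ← mul_assoc]
    refine mul_le_mul_of_nonneg_right ?_ (heatKernel_pos t z).le
    rw [div_eq_inv_mul, abs_mul]
    gcongr
    nlinarith [abs_coord_le_norm z i, abs_nonneg (z i), norm_nonneg z]
  have hc : Continuous fun z : 𝔼 => z i * z i / t ^ 2 * heatKernel t z := by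
    have := continuous_heatKernel (d := d) t
    fun_prop
  obtain ⟨C, hC⟩ := exists_abs_le_of_abs_le_pow_mul_heatKernel (by positivity) ht hb
  have i1 := integrable_comp_sub_of_bounded (P := P) hc hC x
  have i2 := integrable_heatKernel₁_comp_sub (P := P) ht (norm_stdVec i).le x
  have i3 := integrable_heatKernel_comp_sub (P := P) ht x
  set s := score P t i x with hs
  have h := integral_nonneg (μ := P) (f := fun y => (x - y) i * (x - y) i / t ^ 2 *
      heatKernel t (x - y) + (-2 * s * heatKernel₁ t (stdVec i) (x - y) +
        s ^ 2 * heatKernel t (x - y))) fun y => by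
    simp only [heatKernel₁, inner_stdVec, Pi.zero_apply]
    have hk := (heatKernel_pos t (x - y)).le
    have : (x - y) i * (x - y) i / t ^ 2 * heatKernel t (x - y) + (-2 * s *
      (-((x - y) i / t) * heatKernel t (x - y)) + s ^ 2 * heatKernel t (x - y)) =
      ((x - y) i / t + s) ^ 2 * heatKernel t (x - y) := by ring
    rw [this]
    positivity
  rw [integral_add_three i1 (i2.const_mul _) (i3.const_mul _), integral_const_mul, integral_const_mul] at h
  change 0 ≤ measConv P (fun z => z i * z i / t ^ 2 * heatKernel t z) x +
    (-2 * s * heatFlow₁ P t (stdVec i) x + s ^ 2 * heatFlow P t x) at h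
  rw [← heatFlow_mul_score ht, ← hs] at h
  linarith

lemma fisher_le (ht : 0 < t) (i : Fin d) : fisher P t i i ≤ 1 / t := by
  have e : ∀ z : 𝔼, z i * z i / t ^ 2 * heatKernel t z = (t ^ 2)⁻¹ * (z i * z i * heatKernel t z) :=
    fun z => by ring
  have hi : Integrable (fun z : 𝔼 => z i * z i / t ^ 2 * heatKernel t z) := by
    simp_rw [e]
    exact (integrable_coord_mul_coord_mul_heatKernel ht i i).const_mul _
  have h := integral_mono (integrable_heatFlow_mul_score_mul_score (P := P) ht i i)
    (integrable_measConv hi) (score_sq_le ht i)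
  rw [integral_measConv hi] at h
  simp_rw [e] at h
  rw [integral_const_mul, integral_coord_mul_coord_mul_heatKernel ht] at h
  simp only [if_true] at h
  refine h.trans_eq ?_
  field_simp

lemma hessSq_nonneg (ht : 0 < t) (i j : Fin d) : 0 ≤ hessSq P t i j :=
  integral_nonneg fun x => mul_nonneg (heatFlow_pos ht x).le (sq_nonneg _)

/-- The second moment of Hᵢᵢ about σ is nonnegative, and the mean of Hᵢᵢ is the Fisher entry. -/
lemma hessSq_diag_ge (ht : 0 < t) (i : Fin d) (σ : ℝ) :
    2 * σ * fisher P t i i - σ ^ 2 ≤ hessSq P t i i := by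
  have h0 : 0 ≤ ∫ x, heatFlow P t x * (negHess P t i i x - σ) ^ 2 :=
    integral_nonneg fun x => mul_nonneg (heatFlow_pos ht x).le (sq_nonneg _)
  have e : ∀ x, heatFlow P t x * (negHess P t i i x - σ) ^ 2 =
      heatFlow P t x * negHess P t i i x ^ 2 +
        (-2 * σ * (heatFlow P t x * negHess P t i i x) + σ ^ 2 * heatFlow P t x) := fun x => by
    ring
  simp_rw [e] at h0
  have i1 := integrable_heatFlow_mul_negHess_sq (P := P) ht i i
  have i2 := (integrable_heatFlow_mul_negHess (P := P) ht i i).const_mul (-2 * σ)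
  have i3 := (integrable_heatFlow (P := P) ht).const_mul (σ ^ 2)
  rw [integral_add_three i1 i2 i3, integral_const_mul, integral_const_mul,
    integral_heatFlow ht, fisher_eq_integral_negHess ht] at h0
  rw [hessSq]
  linarith

/-- Off-diagonal terms are simply dropped. With σ = 1/(1+t) this is the dissipation bound comparing
the flow of P with the Gaussian. -/
lemma sum_hessSq_ge (ht : 0 < t) (σ : ℝ) :
    2 * σ * ∑ i, fisher P t i i - d * σ ^ 2 ≤ ∑ i, ∑ j, hessSq P t i j := by
  calc 2 * σ * ∑ i, fisher P t i i - d * σ ^ 2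
      = ∑ i : Fin d, (2 * σ * fisher P t i i - σ ^ 2) := by
        rw [Finset.sum_sub_distrib, ← Finset.mul_sum]; simp
    _ ≤ ∑ i, hessSq P t i i := Finset.sum_le_sum fun i _ => hessSq_diag_ge ht i σ
    _ ≤ _ := Finset.sum_le_sum fun i _ =>
        Finset.single_le_sum (f := fun j => hessSq P t i j) (fun j _ => hessSq_nonneg ht i j)
          (Finset.mem_univ i)

end IsotropicFlow
end EntropyJump

/-! ### The Prékopa–Leindler inequality and log-concavity of convolutions -/

namespace EntropyJump

section PrekopaLeindler

open Set ENNReal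

/-- The Brunn–Minkowski inequality on the real line. -/
lemma volume_add_volume_le {A B C : Set ℝ} (hA : MeasurableSet A) (hB : MeasurableSet B)
    (hA0 : A.Nonempty) (hB0 : B.Nonempty) (h : ∀ a ∈ A, ∀ b ∈ B, a + b ∈ C) :
    volume A + volume B ≤ volume C := by
  -- With a the maximum of K and b the minimum of L, the translates K + b and a + L both lie in C
  -- and meet only at a + b.
  have key : ∀ K L : Set ℝ, IsCompact K → IsCompact L → K ⊆ A → L ⊆ B → K.Nonempty → L.Nonempty →
      volume K + volume L ≤ volume C := by
    intro K L hK hL hKA hLB hK0 hL0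
    obtain ⟨a, haK, ha⟩ := hK.exists_isGreatest hK0
    obtain ⟨b, hbL, hb⟩ := hL.exists_isLeast hL0
    have h1 : volume ((fun x => x - b) ⁻¹' K) = volume K := by
      simp [sub_eq_add_neg]
    have h2 : volume ((fun x => x - a) ⁻¹' L) = volume L := by
      simp [sub_eq_add_neg]
    have hm2 : MeasurableSet ((fun x => x - a) ⁻¹' L) := hL.measurableSet.preimage (by fun_prop)
    rw [← h1, ← h2, ← measure_union₀ hm2.nullMeasurableSet]
    · refine measure_mono (union_subset (fun x hx => ?_) fun x hx => ?_)
      · simpa using h _ (hKA hx) b (hLB hbL)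
      · simpa using h a (hKA haK) _ (hLB hx)
    · refine measure_mono_null (t := {a + b}) (fun x hx => ?_) (by simp)
      have e1 := ha hx.1
      have e2 := hb hx.2
      simp only [mem_singleton_iff]
      linarith
  obtain ⟨a0, ha0⟩ := hA0
  obtain ⟨b0, hb0⟩ := hB0
  rw [hA.measure_eq_iSup_isCompact, hB.measure_eq_iSup_isCompact]
  simp only [iSup_and', iSup_subtype']
  have : Nonempty {K : Set ℝ // K ⊆ A ∧ IsCompact K} := ⟨⟨∅, empty_subset _, isCompact_empty⟩⟩
  have : Nonempty {K : Set ℝ // K ⊆ B ∧ IsCompact K} := ⟨⟨∅, empty_subset _, isCompact_empty⟩⟩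
  -- Inner regularity may return empty compact sets; inserting a point of A or of B makes them
  -- nonempty.
  refine ENNReal.iSup_add_iSup_le fun K L => ?_
  refine le_trans (add_le_add (measure_mono (subset_insert a0 K.1))
    (measure_mono (subset_insert b0 L.1))) (key _ _ (K.2.2.insert a0) (L.2.2.insert b0)
    (insert_subset ha0 K.2.1) (insert_subset hb0 L.2.1) (insert_nonempty _ _) (insert_nonempty _ _))

/-- Layer cake plus Brunn–Minkowski on superlevel sets. Normalising both suprema to 1 keeps the
level sets of f and g nonempty for exactly the same levels t < 1; above 1 both are empty. -/
lemma lintegral_add_le_of_normalized {f g h : ℝ → ℝ} (hf : Measurable f) (hg : Measurable g)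
    (hh : Measurable h) (hf0 : ∀ x, 0 ≤ f x) (hg0 : ∀ x, 0 ≤ g x) (hh0 : ∀ x, 0 ≤ h x)
    (hf1 : ∀ x, f x ≤ 1) (hg1 : ∀ x, g x ≤ 1) (hfs : ∀ t < 1, ∃ x, t < f x)
    (hgs : ∀ t < 1, ∃ x, t < g x) (hfg : ∀ x y, f x * g y ≤ h (x + y) ^ 2) :
    (∫⁻ x, ENNReal.ofReal (f x)) + (∫⁻ x, ENNReal.ofReal (g x)) ≤ ∫⁻ x, ENNReal.ofReal (h x) := by
  have hanti : Antitone fun t => volume {a | t < f a} := fun s t hst =>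
    measure_mono fun x hx => lt_of_le_of_lt hst hx
  rw [lintegral_eq_lintegral_meas_lt _ (.of_forall hf0) hf.aemeasurable,
    lintegral_eq_lintegral_meas_lt _ (.of_forall hg0) hg.aemeasurable,
    lintegral_eq_lintegral_meas_lt _ (.of_forall hh0) hh.aemeasurable,
    ← lintegral_add_left' hanti.measurable.aemeasurable]
  refine setLIntegral_mono' measurableSet_Ioi fun t ht => ?_
  rcases lt_or_ge t 1 with ht1 | ht1
  · refine volume_add_volume_le (measurableSet_lt measurable_const hf)
      (measurableSet_lt measurable_const hg) (hfs t ht1) (hgs t ht1) fun a ha b hb => ?_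
    have ht : 0 < t := ht
    simp only [mem_ofPred_eq] at ha hb ⊢
    refine lt_of_pow_lt_pow_left₀ 2 (hh0 _) (lt_of_lt_of_le ?_ (hfg a b))
    nlinarith
  · have e1 : {a | t < f a} = ∅ := eq_empty_of_forall_notMem fun x hx =>
      absurd (lt_of_lt_of_le hx (hf1 x)) (not_lt.2 ht1)
    have e2 : {a | t < g a} = ∅ := eq_empty_of_forall_notMem fun x hx =>
      absurd (lt_of_lt_of_le hx (hg1 x)) (not_lt.2 ht1)
    simp [e1, e2]

lemma four_mul_mul_le_sq_add (x y : ℝ≥0∞) : 4 * x * y ≤ (x + y) ^ 2 := by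
  rcases eq_or_ne x ⊤ with rfl | hx
  · simp
  rcases eq_or_ne y ⊤ with rfl | hy
  · simp
  lift x to NNReal using hx
  lift y to NNReal using hy
  norm_cast
  rw [← NNReal.coe_le_coe]
  push_cast
  nlinarith [sq_nonneg ((x : ℝ) - y)]

/-- Divide f and g by their suprema and h by the geometric mean of these; the additive inequality
then gives the product form through 4AB ≤ (A + B)². -/
lemma prekopaLeindler_real_of_bounded {f g h : ℝ → ℝ≥0∞} (hf : Measurable f) (hg : Measurable g)
    (hh : Measurable h) {n m : ℝ≥0∞} (hn : n ≠ ⊤) (hm : m ≠ ⊤) (hfn : ∀ x, f x ≤ n)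
    (hgm : ∀ x, g x ≤ m) (hfg : ∀ x y, f x * g y ≤ h (x + y) ^ 2) :
    4 * (∫⁻ x, f x) * ∫⁻ x, g x ≤ (∫⁻ x, h x) ^ 2 := by
  set F := ⨆ x, f x with hF
  set G := ⨆ x, g x with hG
  have hFt : F ≠ ⊤ := ne_top_of_le_ne_top hn (iSup_le hfn)
  have hGt : G ≠ ⊤ := ne_top_of_le_ne_top hm (iSup_le hgm)
  have hfF : ∀ x, f x ≤ F := le_iSup f
  have hgG : ∀ x, g x ≤ G := le_iSup g
  rcases eq_or_ne F 0 with hF0 | hF0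
  · have : f = 0 := funext fun x => le_antisymm ((hfF x).trans hF0.le) bot_le
    simp [this]
  rcases eq_or_ne G 0 with hG0 | hG0
  · have : g = 0 := funext fun x => le_antisymm ((hgG x).trans hG0.le) bot_le
    simp [this]
  set α := F.toReal with hα
  set β := G.toReal with hβ
  have hα0 : 0 < α := toReal_pos hF0 hFt
  have hβ0 : 0 < β := toReal_pos hG0 hGt
  set r := √(α * β) with hr
  have hr0 : 0 < r := Real.sqrt_pos.2 (mul_pos hα0 hβ0)
  have hr2 : r ^ 2 = α * β := Real.sq_sqrt (mul_pos hα0 hβ0).le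
  -- Cutting h at r makes it finite and loses nothing: f x * g y never exceeds r².
  have hmt : ∀ x, min (h x) (ENNReal.ofReal r) ≠ ⊤ := fun x =>
    ne_top_of_le_ne_top ofReal_ne_top (min_le_right _ _)
  have key := lintegral_add_le_of_normalized (f := fun x => (f x).toReal / α)
    (g := fun x => (g x).toReal / β) (h := fun x => (min (h x) (ENNReal.ofReal r)).toReal / r)
    (by fun_prop) (by fun_prop) (by fun_prop) (fun x => by positivity) (fun x => by positivity)
    (fun x => by positivity)
    (fun x => (div_le_one hα0).2 (toReal_mono hFt (hfF x)))
    (fun x => (div_le_one hβ0).2 (toReal_mono hGt (hgG x))) ?_ ?_ ?_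
  · have e1 : ∫⁻ x, f x = F * ∫⁻ x, ENNReal.ofReal ((f x).toReal / α) := by
      rw [← lintegral_const_mul' _ _ hFt]
      refine lintegral_congr fun x => ?_
      rw [ofReal_div_of_pos hα0, ofReal_toReal (ne_top_of_le_ne_top hFt (hfF x)), hα,
        ofReal_toReal hFt, ENNReal.mul_div_cancel hF0 hFt]
    have e2 : ∫⁻ x, g x = G * ∫⁻ x, ENNReal.ofReal ((g x).toReal / β) := by
      rw [← lintegral_const_mul' _ _ hGt]
      refine lintegral_congr fun x => ?_
      rw [ofReal_div_of_pos hβ0, ofReal_toReal (ne_top_of_le_ne_top hGt (hgG x)), hβ,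
        ofReal_toReal hGt, ENNReal.mul_div_cancel hG0 hGt]
    have e3 : ENNReal.ofReal r * ∫⁻ x, ENNReal.ofReal
        ((min (h x) (ENNReal.ofReal r)).toReal / r) ≤ ∫⁻ x, h x := by
      rw [← lintegral_const_mul' _ _ ofReal_ne_top]
      refine lintegral_mono fun x => ?_
      rw [ofReal_div_of_pos hr0, ofReal_toReal (hmt x),
        ENNReal.mul_div_cancel (by simpa using hr0) ofReal_ne_top]
      exact min_le_left _ _
    have e4 : F * G = ENNReal.ofReal r ^ 2 := by
      rw [← ofReal_pow hr0.le, hr2, ofReal_mul hα0.le, hα, hβ, ofReal_toReal hFt,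
        ofReal_toReal hGt]
    set A := ∫⁻ x, ENNReal.ofReal ((f x).toReal / α)
    set B := ∫⁻ x, ENNReal.ofReal ((g x).toReal / β)
    calc 4 * (∫⁻ x, f x) * ∫⁻ x, g x = F * G * (4 * A * B) := by rw [e1, e2]; ring
      _ ≤ ENNReal.ofReal r ^ 2 * (A + B) ^ 2 := by
        rw [e4]; gcongr; exact four_mul_mul_le_sq_add A B
      _ = (ENNReal.ofReal r * (A + B)) ^ 2 := by ring
      _ ≤ (ENNReal.ofReal r * ∫⁻ x, ENNReal.ofReal
        ((min (h x) (ENNReal.ofReal r)).toReal / r)) ^ 2 := by gcongr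
      _ ≤ _ := by gcongr
  · intro t ht
    rcases lt_or_ge t 0 with h0 | h0
    · exact ⟨0, h0.trans_le (by positivity)⟩
    have : ENNReal.ofReal (t * α) < F := by
      rw [ofReal_lt_iff_lt_toReal (by positivity) hFt]
      nlinarith
    obtain ⟨x, hx⟩ := lt_iSup_iff.1 this
    refine ⟨x, (lt_div_iff₀ hα0).2 ?_⟩
    rwa [ofReal_lt_iff_lt_toReal (by positivity) (ne_top_of_le_ne_top hFt (hfF x))] at hx
  · intro t ht
    rcases lt_or_ge t 0 with h0 | h0
    · exact ⟨0, h0.trans_le (by positivity)⟩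
    have : ENNReal.ofReal (t * β) < G := by
      rw [ofReal_lt_iff_lt_toReal (by positivity) hGt]
      nlinarith
    obtain ⟨x, hx⟩ := lt_iSup_iff.1 this
    refine ⟨x, (lt_div_iff₀ hβ0).2 ?_⟩
    rwa [ofReal_lt_iff_lt_toReal (by positivity) (ne_top_of_le_ne_top hGt (hgG x))] at hx
  · intro x y
    have h1 : f x * g y ≤ (min (h (x + y)) (ENNReal.ofReal r)) ^ 2 := by
      rcases le_total (h (x + y)) (ENNReal.ofReal r) with hle | hle
      · rw [min_eq_left hle]; exact hfg x y
      · rw [min_eq_right hle, ← ofReal_pow hr0.le, hr2, ofReal_mul hα0.le, hα, hβ,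
          ofReal_toReal hFt, ofReal_toReal hGt]
        exact mul_le_mul' (hfF x) (hgG y)
    have h2 := toReal_mono (pow_ne_top (hmt (x + y))) h1
    rw [toReal_mul, toReal_pow] at h2
    rw [div_pow, hr2, div_mul_div_comm]
    gcongr

/-- The Prékopa–Leindler inequality on the real line (for sums rather than midpoints). -/
lemma prekopaLeindler_real {f g h : ℝ → ℝ≥0∞} (hf : Measurable f) (hg : Measurable g)
    (hh : Measurable h) (hfg : ∀ x y, f x * g y ≤ h (x + y) ^ 2) :
    4 * (∫⁻ x, f x) * ∫⁻ x, g x ≤ (∫⁻ x, h x) ^ 2 := by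
  have trunc : ∀ k : ℝ → ℝ≥0∞, Measurable k → ∫⁻ x, k x = ⨆ n : ℕ, ∫⁻ x, min (k x) n := by
    intro k hk
    rw [← lintegral_iSup (f := fun (n : ℕ) x => min (k x) n) (fun n => by fun_prop)
      fun n m hnm x => min_le_min le_rfl (by exact_mod_cast hnm)]
    refine lintegral_congr fun x => ?_
    exact (by rw [← inf_iSup_eq, ENNReal.iSup_natCast, inf_top_eq] : ⨆ n : ℕ, k x ⊓ n = k x).symm
  -- Only f and g are truncated, which preserves the hypothesis; the bounds pass to the limit by
  -- monotone convergence.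
  rw [trunc f hf, trunc g hg, ENNReal.mul_iSup]
  refine iSup_le fun m => ?_
  rw [ENNReal.mul_iSup, ENNReal.iSup_mul]
  refine iSup_le fun n => ?_
  exact prekopaLeindler_real_of_bounded (by fun_prop) (by fun_prop) hh (natCast_ne_top n)
    (natCast_ne_top m) (fun x => min_le_right _ _) (fun x => min_le_right _ _) fun x y =>
    (mul_le_mul' (min_le_left _ _) (min_le_left _ _)).trans (hfg x y)

/-- The Prékopa–Leindler inequality on `ℝⁿ` (for sums rather than midpoints). -/
lemma prekopaLeindler_pi (n : ℕ) : ∀ {f g h : (Fin n → ℝ) → ℝ≥0∞}, Measurable f → Measurable g →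
    Measurable h → (∀ x y, f x * g y ≤ h (x + y) ^ 2) →
    4 ^ n * (∫⁻ x, f x) * ∫⁻ x, g x ≤ (∫⁻ x, h x) ^ 2 := by
  induction n with
  | zero =>
    intro f g h _ _ _ hfg
    have h0 : ∀ u v w : Fin 0 → ℝ, f u * g v ≤ h w ^ 2 := fun u v w => by
      rw [Subsingleton.elim w (u + v)]
      exact hfg u v
    have hv : volume (univ : Set (Fin 0 → ℝ)) = 1 := by simp [volume_pi]
    rw [lintegral_unique, lintegral_unique, lintegral_unique, hv]
    simpa only [pow_zero, one_mul, mul_one] using h0 _ _ _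
  | succ n ih =>
    intro f g h hf hg hh hfg
    let e := MeasurableEquiv.piFinSuccAbove (fun _ : Fin (n + 1) => ℝ) 0
    have he : MeasurePreserving e.symm :=
      (volume_preserving_piFinSuccAbove (fun _ : Fin (n + 1) => ℝ) 0).symm e
    have hadd : ∀ a b v w, e.symm (a, v) + e.symm (b, w) = e.symm (a + b, v + w) := by
      intro a b v w
      funext i
      refine Fin.cases ?_ (fun j => ?_) i <;> simp [e, MeasurableEquiv.piFinSuccAbove]
    have hint : ∀ k : (Fin (n + 1) → ℝ) → ℝ≥0∞, Measurable k →
        ∫⁻ x, k x = ∫⁻ a, ∫⁻ v, k (e.symm (a, v)) := fun k hk => by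
      rw [← he.lintegral_comp hk, Measure.volume_eq_prod, lintegral_prod _ (by fun_prop)]
    rw [hint f hf, hint g hg, hint h hh]
    have hmeas : ∀ k : (Fin (n + 1) → ℝ) → ℝ≥0∞, Measurable k →
        Measurable fun a => ∫⁻ v, k (e.symm (a, v)) := fun k hk =>
      Measurable.lintegral_prod_right' (f := fun p => k (e.symm p)) (by fun_prop)
    -- The factor 4 ^ n of the inductive hypothesis is shared as 2 ^ n between the marginals of f
    -- and g, so they satisfy the one-dimensional hypothesis against the marginal of h.
    have key := prekopaLeindler_real (f := fun a => 2 ^ n * ∫⁻ v, f (e.symm (a, v)))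
      (g := fun a => 2 ^ n * ∫⁻ v, g (e.symm (a, v))) (h := fun a => ∫⁻ v, h (e.symm (a, v)))
      ((hmeas f hf).const_mul _) ((hmeas g hg).const_mul _) (hmeas h hh) fun a b => by
        have := ih (f := fun v => f (e.symm (a, v))) (g := fun v => g (e.symm (b, v)))
          (h := fun v => h (e.symm (a + b, v))) (by fun_prop) (by fun_prop) (by fun_prop)
          fun v w => by rw [← hadd]; exact hfg _ _
        refine le_trans (le_of_eq ?_) this
        rw [show (4 : ℝ≥0∞) = 2 * 2 by norm_num, mul_pow]
        ring
    rw [lintegral_const_mul _ (hmeas f hf), lintegral_const_mul _ (hmeas g hg)] at key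
    refine le_trans (le_of_eq ?_) key
    rw [pow_succ, show (4 : ℝ≥0∞) = 2 * 2 by norm_num, mul_pow]
    ring

variable {d : ℕ}

local notation "𝔼" => EuclideanSpace ℝ (Fin d)

lemma prekopaLeindler {f g h : 𝔼 → ℝ≥0∞} (hf : Measurable f) (hg : Measurable g)
    (hh : Measurable h) (hfg : ∀ x y, f x * g y ≤ h (x + y) ^ 2) :
    4 ^ d * (∫⁻ x, f x) * ∫⁻ x, g x ≤ (∫⁻ x, h x) ^ 2 := by
  have he := PiLp.volume_preserving_toLp (Fin d)
  rw [← he.lintegral_comp hf, ← he.lintegral_comp hg, ← he.lintegral_comp hh]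
  exact prekopaLeindler_pi d (by fun_prop) (by fun_prop) (by fun_prop) fun x y => hfg _ _

/-- Midpoint log-concavity. -/
def MidLogConcave (a : 𝔼 → ℝ) : Prop := ∀ x y, a x * a y ≤ a ((2⁻¹ : ℝ) • (x + y)) ^ 2

/-- The convolution of log-concave functions is log-concave. -/
lemma MidLogConcave.conv {a b : 𝔼 → ℝ} (ha : MidLogConcave a) (hb : MidLogConcave b)
    (ham : Measurable a) (hbm : Measurable b) (ha0 : ∀ x, 0 ≤ a x) (hb0 : ∀ x, 0 ≤ b x)
    (hint : ∀ x, Integrable fun y => a (x - y) * b y) :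
    MidLogConcave fun x => ∫ y, a (x - y) * b y := by
  intro x x'
  set m := (2⁻¹ : ℝ) • (x + x') with hm
  have hnn : ∀ x y, 0 ≤ a (x - y) * b y := fun x y => mul_nonneg (ha0 _) (hb0 _)
  -- The integrand (x, y) ↦ a(x - y) b(y) is midpoint log-concave jointly. Since the inequality is
  -- stated for sums, h is evaluated at z/2; the Jacobian 2 ^ d, squared, cancels 4 ^ d.
  have key := prekopaLeindler (f := fun y => ENNReal.ofReal (a (x - y) * b y))
    (g := fun y => ENNReal.ofReal (a (x' - y) * b y))
    (h := fun z => ENNReal.ofReal (a (m - (2⁻¹ : ℝ) • z) * b ((2⁻¹ : ℝ) • z)))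
    (by fun_prop) (by fun_prop) (by fun_prop) fun y y' => by
      rw [← ofReal_mul (hnn x y), ← ofReal_pow (hnn m _)]
      refine ofReal_le_ofReal ?_
      have h1 := ha (x - y) (x' - y')
      have h2 := hb y y'
      have e : (2⁻¹ : ℝ) • (x - y + (x' - y')) = m - (2⁻¹ : ℝ) • (y + y') := by
        rw [hm]; module
      rw [e] at h1
      calc _ = (a (x - y) * a (x' - y')) * (b y * b y') := by ring
        _ ≤ _ := mul_le_mul h1 h2 (mul_nonneg (hb0 _) (hb0 _)) (sq_nonneg _)
        _ = _ := by ring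
  rw [← ofReal_integral_eq_lintegral_ofReal (hint x) (.of_forall (hnn x)),
    ← ofReal_integral_eq_lintegral_ofReal (hint x') (.of_forall (hnn x')),
    ← ofReal_integral_eq_lintegral_ofReal ((hint m).comp_smul (by norm_num))
      (.of_forall fun z => hnn m ((2⁻¹ : ℝ) • z)),
    Measure.integral_comp_smul volume (fun y => a (m - y) * b y), finrank_euclideanSpace,
    Fintype.card_fin] at key
  have h4 : (4 : ℝ≥0∞) ^ d = ENNReal.ofReal (4 ^ d) := by
    rw [ofReal_pow (by norm_num)]; simp
  have i1 := integral_nonneg (μ := volume) (f := fun y => a (x - y) * b y) (hnn x)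
  have i2 := integral_nonneg (μ := volume) (f := fun y => a (x' - y) * b y) (hnn x')
  have i3 := integral_nonneg (μ := volume) (f := fun y => a (m - y) * b y) (hnn m)
  rw [h4, ← ofReal_mul (by positivity), ← ofReal_mul (by positivity),
    ← ofReal_pow (by positivity), ofReal_le_ofReal_iff (by positivity)] at key
  have e2 : |((2⁻¹ : ℝ) ^ d)⁻¹| = 2 ^ d := by
    rw [inv_pow, inv_inv, abs_of_pos (by positivity)]
  rw [e2, smul_eq_mul, mul_pow, ← pow_mul, mul_comm d 2, pow_mul, mul_assoc] at key
  norm_num at key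
  exact key

end PrekopaLeindler
end EntropyJump

/-! ### Pointwise bounds on the Hessian of -log u under log-concavity -/

namespace EntropyJump

section HessianBounds

open Real InnerProductSpace Filter Topology

variable {d : ℕ}

local notation "𝔼" => EuclideanSpace ℝ (Fin d)

/-- If L > 0, then l' s - l' (-s) > 0 for small s > 0, so l s + l (-s) would exceed its value at 0
by the mean value theorem. Only differentiability of l' at 0 is required. -/
lemma second_deriv_nonpos_of_forall_le {l l' : ℝ → ℝ} {L : ℝ} (hl : ∀ s, HasDerivAt l (l' s) s)
    (hl' : HasDerivAt l' L 0) (h : ∀ s, l s + l (-s) ≤ 2 * l 0) : L ≤ 0 := by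
  by_contra! hL
  have h1 : HasDerivAt (fun s => l' s - l' (-s)) (2 * L) 0 := by
    have h2 : HasDerivAt (fun s => l' (-s)) (-L) 0 := by
      have := HasDerivAt.scomp (0 : ℝ) (g₁ := l') (h := fun s : ℝ => -s) (g₁' := L) (h' := -1)
        (by simpa using hl') (hasDerivAt_neg 0)
      simpa [Function.comp_def] using this
    exact (hl'.sub h2).congr_deriv (by ring)
  have h3 := hasDerivAt_iff_tendsto_slope_zero.1 h1
  have h4 : ∀ᶠ s in 𝓝[≠] (0 : ℝ), 0 < s⁻¹ • ((l' (0 + s) - l' (-(0 + s))) - (l' 0 - l' (-0))) :=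
    h3.eventually (lt_mem_nhds (by linarith))
  rw [eventually_nhdsWithin_iff, Metric.eventually_nhds_iff] at h4
  obtain ⟨ε, hε, h5⟩ := h4
  have hm : ∀ s, HasDerivAt (fun s => l s + l (-s)) (l' s - l' (-s)) s := fun s => by
    have h2 : HasDerivAt (fun s => l (-s)) (-l' (-s)) s := by
      have := HasDerivAt.scomp s (g₁ := l) (h := fun s : ℝ => -s) (hl (-s)) (hasDerivAt_neg s)
      simpa [Function.comp_def] using this
    exact ((hl s).add h2).congr_deriv (by ring)
  obtain ⟨c, hc, hc'⟩ := exists_hasDerivAt_eq_slope (fun s => l s + l (-s))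
    (fun s => l' s - l' (-s)) (show (0 : ℝ) < ε / 2 by positivity)
    (fun s _ => (hm s).continuousAt.continuousWithinAt) (fun s _ => hm s)
  have h6 := h5 (y := c) (by rw [dist_zero_right, norm_of_nonneg hc.1.le]; linarith [hc.2])
    (by simpa using hc.1.ne')
  simp only [zero_add, neg_zero, sub_self, sub_zero, smul_eq_mul] at h6
  have h7 : 0 < l' c - l' (-c) := (mul_pos_iff_of_pos_left (inv_pos.2 hc.1)).1 h6
  rw [hc'] at h7
  have h8 : 0 < (l (ε / 2) + l (-(ε / 2))) - (l 0 + l (-0)) := by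
    have : 0 < ε / 2 - 0 := by linarith
    exact (div_pos_iff_of_pos_right this).1 h7
  have := h (ε / 2)
  simp only [neg_zero] at h8
  linarith

lemma eq_sum_smul_stdVec (c : 𝔼) : c = ∑ j, c j • stdVec j := by
  ext i
  simp [stdVec, Pi.single_apply]

lemma negHess_symm {P : Measure 𝔼} {t : ℝ} (i j : Fin d) (x : 𝔼) : negHess P t i j x = negHess P t j i x := by
  have : heatFlow₂ P t (stdVec i) (stdVec j) x = heatFlow₂ P t (stdVec j) (stdVec i) x := by
    simp only [measConv, heatKernel₂, real_inner_comm, mul_comm]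
  simp only [negHess, ratio₂, this]
  ring

variable {P : Measure (EuclideanSpace ℝ (Fin d))} [IsProbabilityMeasure P] {t : ℝ}

lemma contDiff_score (ht : 0 < t) (i : Fin d) : ContDiff ℝ 1 (score P t i) :=
  (contDiff_heatFlow₁ ht (norm_stdVec i).le).div (contDiff_heatFlow ht)
    fun x => (heatFlow_pos ht x).ne'

lemma fderiv_score_stdVec (ht : 0 < t) (i j : Fin d) (x : 𝔼) :
    fderiv ℝ (score P t i) x (stdVec j) = -negHess P t i j x := by
  rw [← (hasLineDerivAt_score ht i j x).lineDeriv]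
  exact ((contDiff_score ht i).differentiable one_ne_zero x).lineDeriv_eq_fderiv.symm

lemma fderiv_score (ht : 0 < t) (i : Fin d) (x ξ : 𝔼) :
    fderiv ℝ (score P t i) x ξ = -∑ j, ξ j * negHess P t i j x := by
  conv_lhs => rw [eq_sum_smul_stdVec ξ]
  simp only [map_sum, map_smul, smul_eq_mul, fderiv_score_stdVec ht, mul_neg,
    Finset.sum_neg_distrib]

lemma fderiv_log_heatFlow (ht : 0 < t) (x ξ : 𝔼) :
    fderiv ℝ (fun x => log (heatFlow P t x)) x ξ = ∑ i, ξ i * score P t i x := by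
  have hd : DifferentiableAt ℝ (fun x => log (heatFlow P t x)) x :=
    ((contDiff_heatFlow ht).differentiable one_ne_zero x).log (heatFlow_pos ht x).ne'
  have hj : ∀ j, fderiv ℝ (fun x => log (heatFlow P t x)) x (stdVec j) = score P t j x := fun j => by
    rw [← hd.lineDeriv_eq_fderiv]
    have := HasLineDerivAt.log' (hasLineDerivAt_heatFlow (P := P) ht x (stdVec j))
      (heatFlow_pos ht x).ne'
    rw [this.lineDeriv, score]
  conv_lhs => rw [eq_sum_smul_stdVec ξ]
  simp only [map_sum, map_smul, smul_eq_mul, hj]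

/-- The Hessian of `-log u` is positive semidefinite if `u` is log-concave. -/
lemma negHess_posSemidef (ht : 0 < t) (hlc : MidLogConcave (heatFlow P t)) (x c : 𝔼) :
    0 ≤ ∑ i, ∑ j, c i * c j * negHess P t i j x := by
  have hline : ∀ (f : 𝔼 → ℝ) (s : ℝ), DifferentiableAt ℝ f (x + s • c) →
      HasDerivAt (fun s : ℝ => f (x + s • c)) (fderiv ℝ f (x + s • c) c) s := fun f s hf => by
    have h1 : HasDerivAt (fun s : ℝ => x + s • c) c s := by
      simpa using ((hasDerivAt_id s).smul_const c).const_add x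
    exact hf.hasFDerivAt.comp_hasDerivAt s h1
  -- Restrict log u to the line through x in direction c; midpoint concavity at ±s gives the
  -- hypothesis.
  have key := second_deriv_nonpos_of_forall_le
    (l := fun s : ℝ => log (heatFlow P t (x + s • c)))
    (l' := fun s => ∑ i, c i * score P t i (x + s • c))
    (L := ∑ i, c i * -∑ j, c j * negHess P t i j x) (fun s => ?_) ?_ fun s => ?_
  · have e : ∑ i, ∑ j, c i * c j * negHess P t i j x =
        -∑ i, c i * -∑ j, c j * negHess P t i j x := by
      simp only [mul_neg, Finset.sum_neg_distrib, neg_neg, Finset.mul_sum, mul_assoc]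
    rw [e]
    linarith
  · rw [← fderiv_log_heatFlow ht]
    exact hline _ s (((contDiff_heatFlow ht).differentiable one_ne_zero _).log
      (heatFlow_pos ht _).ne')
  · refine HasDerivAt.fun_sum fun i _ => ?_
    have := hline (score P t i) 0 ((contDiff_score ht i).differentiable one_ne_zero _)
    rw [fderiv_score ht, zero_smul, add_zero] at this
    exact this.const_mul _
  · have h1 := hlc (x + s • c) (x + (-s) • c)
    have e : (2⁻¹ : ℝ) • (x + s • c + (x + (-s) • c)) = x := by module
    rw [e] at h1
    have hp := heatFlow_pos (P := P) ht
    have h2 := log_le_log (mul_pos (hp _) (hp _)) h1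
    rw [log_mul (hp _).ne' (hp _).ne', log_pow] at h2
    simpa using h2

/-- The entry equals 1/t minus the conditional variance of zᵢ/t, so no log-concavity is involved. -/
lemma negHess_diag_le (ht : 0 < t) (i : Fin d) (x : 𝔼) : negHess P t i i x ≤ 1 / t := by
  have h1 := score_sq_le (P := P) ht i x
  have hu := heatFlow_pos (P := P) ht x
  have h2 : heatFlow₂ P t (stdVec i) (stdVec i) x =
      measConv P (fun z => z i * z i / t ^ 2 * heatKernel t z) x - 1 / t * heatFlow P t x := by
    have hb : ∀ z : 𝔼, z i * z i / t ^ 2 * heatKernel t z =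
        heatKernel₂ t (stdVec i) (stdVec i) z + 1 / t * heatKernel t z := fun z => by
      simp only [heatKernel₂, inner_stdVec, stdVec]
      simp
      ring
    simp_rw [hb]
    simp only [measConv]
    rw [integral_add (integrable_heatKernel₂_comp_sub ht (norm_stdVec i).le (norm_stdVec i).le x)
      ((integrable_heatKernel_comp_sub ht x).const_mul _), integral_const_mul]
    ring
  have h3 := heatFlow_mul_negHess (P := P) ht i i x
  rw [h2] at h3
  have h4 : heatFlow P t x * negHess P t i i x ≤ heatFlow P t x * (1 / t) := by linarith
  exact le_of_mul_le_mul_left h4 hu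

/-- Positivity on eᵢ ± eⱼ gives |Hᵢⱼ| ≤ (Hᵢᵢ + Hⱼⱼ)/2. Boundedness of the Hessian lets scores serve
as test functions with bounded derivative and makes u H and u H² bounded for the convolution
identities. -/
lemma abs_negHess_le_of_logConcave (ht : 0 < t) (hlc : MidLogConcave (heatFlow P t))
    (i j : Fin d) (x : 𝔼) : |negHess P t i j x| ≤ 1 / t := by
  have hq : ∀ ε : ℝ, ∑ k, ∑ l, (stdVec i + ε • stdVec j : 𝔼) k * (stdVec i + ε • stdVec j : 𝔼) l *
      negHess P t k l x = negHess P t i i x + 2 * ε * negHess P t i j x +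
        ε ^ 2 * negHess P t j j x := fun ε => by
    have h1 : ∀ k, (stdVec i + ε • stdVec j : 𝔼) k =
        (if k = i then 1 else 0) + ε * (if k = j then 1 else 0) := fun k => by
      simp [stdVec]
    simp only [h1, add_mul, mul_add, Finset.sum_add_distrib, mul_assoc, ← Finset.mul_sum]
    simp only [ite_mul, one_mul, zero_mul, Finset.sum_ite_eq', Finset.mem_univ, if_true]
    rw [negHess_symm j i]
    ring
  have h1 := negHess_posSemidef ht hlc x (stdVec i + (1 : ℝ) • stdVec j)
  have h2 := negHess_posSemidef ht hlc x (stdVec i + (-1 : ℝ) • stdVec j)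
  rw [hq] at h1 h2
  have h3 := negHess_diag_le (P := P) ht i x
  have h4 := negHess_diag_le (P := P) ht j x
  rw [abs_le]
  constructor <;> linarith

end HessianBounds
end EntropyJump

/-! ### The Gaussian Poincaré inequality -/

namespace EntropyJump

section GaussianPoincare

open Real InnerProductSpace Filter Topology

variable {d : ℕ}

local notation "𝔼" => EuclideanSpace ℝ (Fin d)

lemma measurable_heatKernel (t : ℝ) :
    Measurable fun z : 𝔼 => ENNReal.ofReal (heatKernel t z) :=
  (continuous_heatKernel t).measurable.ennreal_ofReal

/-- Both measures are finite, and their characteristic functions agree by the Fourier transform of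
the Gaussian. -/
lemma stdGaussian_eq_withDensity :
    stdGaussian 𝔼 = volume.withDensity fun z => ENNReal.ofReal (heatKernel 1 z) := by
  have : IsFiniteMeasure (volume.withDensity fun z : 𝔼 => ENNReal.ofReal (heatKernel 1 z)) :=
    isFiniteMeasure_withDensity_ofReal (integrable_heatKernel one_pos).2
  refine Measure.ext_of_charFun (funext fun ξ => ?_)
  rw [charFun_stdGaussian, charFun_apply,
    integral_withDensity_eq_integral_toReal_smul (measurable_heatKernel 1)
      (Eventually.of_forall fun _ => ENNReal.ofReal_lt_top)]
  have e : ∀ z : 𝔼, (ENNReal.ofReal (heatKernel 1 z)).toReal •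
      Complex.exp (inner ℝ z ξ * Complex.I) = ((2 * π : ℝ) : ℂ) ^ (-(d / 2 : ℂ)) *
        Complex.exp (-(1 / 2 : ℂ) * ‖z‖ ^ 2 + Complex.I * inner ℝ ξ z) := fun z => by
    rw [ENNReal.toReal_ofReal (heatKernel_pos 1 z).le, heatKernel_eq_mul one_pos, Complex.real_smul,
      Complex.exp_add]
    push_cast
    rw [Complex.ofReal_cpow (by positivity), real_inner_comm]
    push_cast
    rw [mul_comm Complex.I]
    norm_num
    ring
  simp_rw [e]
  rw [integral_const_mul, GaussianFourier.integral_cexp_neg_mul_sq_norm_add (by norm_num),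
    ← mul_assoc, finrank_euclideanSpace, Fintype.card_fin]
  have h2 : (π / (1 / 2) : ℂ) = ((2 * π : ℝ) : ℂ) := by push_cast; ring
  rw [h2, ← Complex.cpow_add _ _ (by simp [pi_ne_zero]), neg_add_cancel, Complex.cpow_zero, one_mul]
  congr 1
  rw [Complex.I_sq]
  ring

lemma integral_stdGaussian (F : 𝔼 → ℝ) :
    ∫ z, F z ∂stdGaussian 𝔼 = ∫ z, F z * heatKernel 1 z := by
  rw [stdGaussian_eq_withDensity,
    integral_withDensity_eq_integral_toReal_smul (measurable_heatKernel 1)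
      (Eventually.of_forall fun _ => ENNReal.ofReal_lt_top)]
  refine integral_congr_ae (Eventually.of_forall fun z => ?_)
  simp only [smul_eq_mul]
  rw [ENNReal.toReal_ofReal (heatKernel_pos 1 z).le, mul_comm]

lemma integrable_stdGaussian_iff (F : 𝔼 → ℝ) :
    Integrable F (stdGaussian 𝔼) ↔ Integrable fun z => F z * heatKernel 1 z := by
  rw [stdGaussian_eq_withDensity, integrable_withDensity_iff (measurable_heatKernel 1)
      (Eventually.of_forall fun _ => ENNReal.ofReal_lt_top)]
  simp only [ENNReal.toReal_ofReal (heatKernel_pos 1 _).le]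

lemma integrable_pow_stdGaussian (m : ℕ) :
    Integrable (fun z : 𝔼 => (1 + ‖z‖) ^ m) (stdGaussian 𝔼) :=
  (integrable_stdGaussian_iff _).2 (integrable_pow_mul_heatKernel m one_pos)

/-- Linear growth of a function with bounded derivative. -/
lemma exists_abs_le_one_add_norm {φ : 𝔼 → ℝ} (hφ : ContDiff ℝ 1 φ) {L : ℝ}
    (hL : ∀ x, ‖fderiv ℝ φ x‖ ≤ L) : ∃ C, 0 ≤ C ∧ ∀ x, |φ x| ≤ C * (1 + ‖x‖) := by
  have hL0 : 0 ≤ L := (norm_nonneg _).trans (hL 0)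
  refine ⟨|φ 0| + L, by positivity, fun x => ?_⟩
  have h := (convex_univ (𝕜 := ℝ) (E := 𝔼)).norm_image_sub_le_of_norm_fderiv_le (f := φ) (C := L)
    (fun x _ => hφ.differentiable one_ne_zero x) (fun x _ => hL x) (Set.mem_univ 0)
    (Set.mem_univ x)
  rw [sub_zero, norm_eq_abs] at h
  have h1 := abs_sub_abs_le_abs_sub (φ x) (φ 0)
  nlinarith [abs_nonneg (φ 0), norm_nonneg x, mul_nonneg (abs_nonneg (φ 0)) (norm_nonneg x)]

/-- Gaussian integration by parts. -/
lemma integral_mul_inner_stdGaussian {ψ : 𝔼 → ℝ} (hψ : ContDiff ℝ 1 ψ) {L : ℝ}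
    (hL : ∀ x, ‖fderiv ℝ ψ x‖ ≤ L) (a : 𝔼) :
    ∫ v, ψ v * inner ℝ a v ∂stdGaussian 𝔼 = ∫ v, fderiv ℝ ψ v a ∂stdGaussian 𝔼 := by
  obtain ⟨C, hC0, hC⟩ := exists_abs_le_one_add_norm hψ hL
  have hcd : Continuous fun v => fderiv ℝ ψ v a :=
    (hψ.continuous_fderiv one_ne_zero).clm_apply continuous_const
  have i1 : Integrable (fun v => ψ v * heatKernel 1 v) :=
    integrable_of_abs_le_pow_mul_heatKernel (hψ.continuous.mul (continuous_heatKernel 1)) one_pos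
      (C := C) (m := 1) fun z => by
        rw [abs_mul, abs_of_pos (heatKernel_pos 1 z), pow_one, ← mul_assoc]
        exact mul_le_mul_of_nonneg_right (hC z) (heatKernel_pos 1 z).le
  have i2 : Integrable (fun v => fderiv ℝ ψ v a * heatKernel 1 v) :=
    integrable_of_abs_le_pow_mul_heatKernel (hcd.mul (continuous_heatKernel 1)) one_pos
      (C := L * ‖a‖) (m := 0) fun z => by
        rw [abs_mul, abs_of_pos (heatKernel_pos 1 z), pow_zero, one_mul]
        refine mul_le_mul_of_nonneg_right ?_ (heatKernel_pos 1 z).le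
        exact ((fderiv ℝ ψ z).le_opNorm a).trans (by gcongr; exact hL z)
  have i3 : Integrable (fun v => ψ v * heatKernel₁ 1 a v) :=
    integrable_of_abs_le_pow_mul_heatKernel
      (hψ.continuous.mul (contDiff_heatKernel₁ 1 a (n := 0)).continuous) one_pos
      (C := C * ‖a‖) (m := 2) fun z => by
        rw [heatKernel₁, ← mul_assoc, ← mul_assoc, abs_mul, abs_of_pos (heatKernel_pos 1 z)]
        refine mul_le_mul_of_nonneg_right ?_ (heatKernel_pos 1 z).le
        rw [abs_mul, abs_neg, div_one]
        have h1 := abs_real_inner_le_norm a z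
        calc |ψ z| * |inner ℝ a z| ≤ (C * (1 + ‖z‖)) * (‖a‖ * (1 + ‖z‖)) := by
              gcongr
              · exact hC z
              · exact h1.trans (by gcongr; linarith [norm_nonneg z])
          _ = _ := by ring
  have h := integral_lineDeriv_eq_zero (F := fun v => ψ v * heatKernel 1 v) (ξ := a)
    (F' := fun v => fderiv ℝ ψ v a * heatKernel 1 v + ψ v * heatKernel₁ 1 a v) (fun x => ?_)
    i1 (i2.add i3)
  · rw [integral_add i2 i3] at h
    rw [integral_stdGaussian, integral_stdGaussian]
    have e : ∀ v, ψ v * inner ℝ a v * heatKernel 1 v = -(ψ v * heatKernel₁ 1 a v) := fun v => by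
      rw [heatKernel₁]; ring
    simp_rw [e]
    rw [integral_neg]
    linarith
  · refine HasLineDerivAt.mul' (HasFDerivAt.lineDeriv_of_fderiv hψ x a) ?_
    rw [← fderiv_heatKernel]
    exact HasFDerivAt.lineDeriv_of_fderiv (contDiff_heatKernel 1) x a

/-- Two independent standard Gaussians are jointly rotation invariant; the angle θ interpolates
between a Gaussian vector and an independent copy. -/
lemma measurePreserving_rotation (θ : ℝ) :
    MeasurePreserving (fun p : 𝔼 × 𝔼 =>
      (Real.cos θ • p.1 + Real.sin θ • p.2, -Real.sin θ • p.1 + Real.cos θ • p.2))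
      ((stdGaussian 𝔼).prod (stdGaussian 𝔼)) ((stdGaussian 𝔼).prod (stdGaussian 𝔼)) := by
  have h := IsGaussian.map_rotation_eq_self_of_forall_strongDual_eq_zero
    (μ := stdGaussian 𝔼) integral_strongDual_stdGaussian θ
  have e : (fun p : 𝔼 × 𝔼 =>
      (Real.cos θ • p.1 + Real.sin θ • p.2, -Real.sin θ • p.1 + Real.cos θ • p.2)) =
      ContinuousLinearMap.rotation θ := by
    funext p
    rw [ContinuousLinearMap.rotation_apply]
  rw [e]
  exact ⟨(ContinuousLinearMap.rotation θ).continuous.measurable, h⟩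

lemma integral_comp_rotation {F : 𝔼 × 𝔼 → ℝ} (hF : Continuous F) (θ : ℝ) :
    ∫ p, F (Real.cos θ • p.1 + Real.sin θ • p.2, -Real.sin θ • p.1 + Real.cos θ • p.2)
      ∂((stdGaussian 𝔼).prod (stdGaussian 𝔼)) =
    ∫ p, F p ∂((stdGaussian 𝔼).prod (stdGaussian 𝔼)) := by
  have h := measurePreserving_rotation (d := d) θ
  conv_rhs => rw [← h.map_eq]
  rw [integral_map h.measurable.aemeasurable hF.aestronglyMeasurable]

lemma integrable_prod_stdGaussian {F : 𝔼 × 𝔼 → ℝ} (hF : Continuous F) {C : ℝ} {m : ℕ}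
    (h : ∀ p, |F p| ≤ C * ((1 + ‖p.1‖) ^ m * (1 + ‖p.2‖) ^ m)) :
    Integrable F ((stdGaussian 𝔼).prod (stdGaussian 𝔼)) :=
  (((integrable_pow_stdGaussian m).mul_prod (integrable_pow_stdGaussian m)).const_mul C).mono'
    hF.aestronglyMeasurable (Eventually.of_forall h)

/-- The Gaussian Poincaré inequality for functions with bounded derivative. -/
lemma poincare_stdGaussian {φ : 𝔼 → ℝ} (hφ : ContDiff ℝ 1 φ) {L : ℝ}
    (hL : ∀ x, ‖fderiv ℝ φ x‖ ≤ L) :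
    ∫ x, φ x ^ 2 ∂stdGaussian 𝔼 - (∫ x, φ x ∂stdGaussian 𝔼) ^ 2 ≤
      ∫ x, ‖fderiv ℝ φ x‖ ^ 2 ∂stdGaussian 𝔼 := by
  have hL0 : 0 ≤ L := (norm_nonneg _).trans (hL 0)
  obtain ⟨C, hC0, hC⟩ := exists_abs_le_one_add_norm hφ hL
  have hcφ := hφ.continuous
  have hcD : Continuous (fderiv ℝ φ) := hφ.continuous_fderiv one_ne_zero
  set γ := stdGaussian 𝔼
  set D := ∫ x, ‖fderiv ℝ φ x‖ ^ 2 ∂γ with hD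
  have hiD : Integrable (fun x => ‖fderiv ℝ φ x‖ ^ 2) γ :=
    (integrable_const (L ^ 2)).mono' (by fun_prop) (Eventually.of_forall fun x => by
      rw [norm_of_nonneg (by positivity)]; gcongr; exact hL x)
  have hnorm : ∀ (θ : ℝ) (p : 𝔼 × 𝔼), ‖Real.cos θ • p.1 + Real.sin θ • p.2‖ ≤ ‖p.1‖ + ‖p.2‖ :=
    fun θ p => by
      refine (norm_add_le _ _).trans ?_
      rw [norm_smul, norm_smul, norm_eq_abs, norm_eq_abs]
      nlinarith [abs_cos_le_one θ, abs_sin_le_one θ, norm_nonneg p.1, norm_nonneg p.2]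
  have hnorm' : ∀ (θ : ℝ) (p : 𝔼 × 𝔼), ‖-Real.sin θ • p.1 + Real.cos θ • p.2‖ ≤ ‖p.1‖ + ‖p.2‖ :=
    fun θ p => by
      refine (norm_add_le _ _).trans ?_
      rw [norm_smul, norm_smul, norm_eq_abs, norm_eq_abs, abs_neg]
      nlinarith [abs_cos_le_one θ, abs_sin_le_one θ, norm_nonneg p.1, norm_nonneg p.2]
  -- The correlation of φ at U and at cos θ U + sin θ V: it equals ∫ φ² at θ = 0 and (∫ φ)² at θ =
  -- π/2, so the variance is minus its total increment.
  set m : ℝ → ℝ := fun θ => ∫ p, φ p.1 * φ (Real.cos θ • p.1 + Real.sin θ • p.2) ∂(γ.prod γ)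
    with hm
  set m' : ℝ → ℝ := fun θ => ∫ p, φ p.1 * fderiv ℝ φ (Real.cos θ • p.1 + Real.sin θ • p.2)
    (-Real.sin θ • p.1 + Real.cos θ • p.2) ∂(γ.prod γ) with hm'
  have hb2 : ∀ (θ : ℝ) (p : 𝔼 × 𝔼), |φ p.1 * fderiv ℝ φ (Real.cos θ • p.1 + Real.sin θ • p.2)
      (-Real.sin θ • p.1 + Real.cos θ • p.2)| ≤
        C * L * ((1 + ‖p.1‖) ^ 2 * (1 + ‖p.2‖) ^ 2) := fun θ p => by
    rw [abs_mul]
    have h1 := hC p.1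
    have h2 : |fderiv ℝ φ (Real.cos θ • p.1 + Real.sin θ • p.2)
        (-Real.sin θ • p.1 + Real.cos θ • p.2)| ≤ L * (‖p.1‖ + ‖p.2‖) :=
      ((fderiv ℝ φ _).le_opNorm _).trans
        (mul_le_mul (hL _) (hnorm' θ p) (norm_nonneg _) hL0)
    have hx := norm_nonneg p.1
    have hy := norm_nonneg p.2
    calc _ ≤ (C * (1 + ‖p.1‖)) * (L * (‖p.1‖ + ‖p.2‖)) := by gcongr
      _ = C * L * ((1 + ‖p.1‖) * (‖p.1‖ + ‖p.2‖)) := by ring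
      _ ≤ C * L * ((1 + ‖p.1‖) * ((1 + ‖p.1‖) * (1 + ‖p.2‖) ^ 2)) := by
        gcongr
        nlinarith [mul_nonneg hx hy, mul_nonneg hx (sq_nonneg ‖p.2‖), sq_nonneg ‖p.2‖]
      _ = _ := by ring
  have hb1 : ∀ (θ : ℝ) (p : 𝔼 × 𝔼), |φ p.1 * φ (Real.cos θ • p.1 + Real.sin θ • p.2)| ≤
      C * C * ((1 + ‖p.1‖) ^ 2 * (1 + ‖p.2‖) ^ 2) := fun θ p => by
    rw [abs_mul]
    have h1 := hC p.1
    have h2 := (hC (Real.cos θ • p.1 + Real.sin θ • p.2)).trans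
      (mul_le_mul_of_nonneg_left (add_le_add le_rfl (hnorm θ p)) hC0)
    have hx := norm_nonneg p.1
    have hy := norm_nonneg p.2
    calc _ ≤ (C * (1 + ‖p.1‖)) * (C * (1 + (‖p.1‖ + ‖p.2‖))) := by gcongr
      _ = C * C * ((1 + ‖p.1‖) * (1 + (‖p.1‖ + ‖p.2‖))) := by ring
      _ ≤ C * C * ((1 + ‖p.1‖) * ((1 + ‖p.1‖) * (1 + ‖p.2‖) ^ 2)) := by
        gcongr
        nlinarith [mul_nonneg hx hy, mul_nonneg hx (sq_nonneg ‖p.2‖), sq_nonneg ‖p.2‖]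
      _ = _ := by ring
  have hderiv : ∀ θ, HasDerivAt m (m' θ) θ := fun θ => by
    refine (hasDerivAt_integral_of_dominated_loc_of_deriv_le (s := Set.univ)
      (F := fun θ (p : 𝔼 × 𝔼) => φ p.1 * φ (Real.cos θ • p.1 + Real.sin θ • p.2))
      (F' := fun θ (p : 𝔼 × 𝔼) => φ p.1 * fderiv ℝ φ (Real.cos θ • p.1 + Real.sin θ • p.2)
        (-Real.sin θ • p.1 + Real.cos θ • p.2))
      (bound := fun p => C * L * ((1 + ‖p.1‖) ^ 2 * (1 + ‖p.2‖) ^ 2)) univ_mem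
      (Eventually.of_forall fun τ => ?_) (integrable_prod_stdGaussian (by fun_prop) (hb1 θ)) ?_
      (Eventually.of_forall fun p τ _ => hb2 τ p)
      (((integrable_pow_stdGaussian 2).mul_prod (integrable_pow_stdGaussian 2)).const_mul _)
      (Eventually.of_forall fun p τ _ => ?_)).2
    · exact Continuous.aestronglyMeasurable (by fun_prop)
    · exact Continuous.aestronglyMeasurable (by fun_prop)
    · refine HasDerivAt.const_mul _ ?_
      have h1 : HasDerivAt (fun θ : ℝ => Real.cos θ • p.1 + Real.sin θ • p.2)
          (-Real.sin τ • p.1 + Real.cos τ • p.2) τ :=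
        ((hasDerivAt_cos τ).smul_const p.1).add ((hasDerivAt_sin τ).smul_const p.2)
      exact (hφ.differentiable one_ne_zero _).hasFDerivAt.comp_hasDerivAt τ h1
  -- the derivative after rotation and integration by parts
  set grad : 𝔼 → 𝔼 := fun x => (toDual ℝ 𝔼).symm (fderiv ℝ φ x) with hgrad
  have hgradc : Continuous grad := (toDual ℝ 𝔼).symm.continuous.comp hcD
  -- Rotating makes the direction of differentiation an independent Gaussian; integrating by parts
  -- in it gives -sin θ times the mean inner product of two gradients.
  have hm'_eq : ∀ θ, m' θ = ∫ p, -Real.sin θ *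
      fderiv ℝ φ (Real.cos (-θ) • p.1 + Real.sin (-θ) • p.2) (grad p.1) ∂(γ.prod γ) := fun θ => by
    have h1 := integral_comp_rotation (d := d)
      (F := fun p => φ (Real.cos θ • p.1 - Real.sin θ • p.2) * fderiv ℝ φ p.1 p.2)
      (by fun_prop) θ
    have e1 : ∀ p : 𝔼 × 𝔼, Real.cos θ • (Real.cos θ • p.1 + Real.sin θ • p.2) -
        Real.sin θ • (-Real.sin θ • p.1 + Real.cos θ • p.2) = p.1 := fun p => by
      have : Real.cos θ • (Real.cos θ • p.1 + Real.sin θ • p.2) -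
        Real.sin θ • (-Real.sin θ • p.1 + Real.cos θ • p.2) =
          (Real.cos θ ^ 2 + Real.sin θ ^ 2) • p.1 := by module
      rw [this, Real.cos_sq_add_sin_sq, one_smul]
    simp only [e1] at h1
    rw [hm']
    simp only
    rw [h1]
    have hb3 : ∀ p : 𝔼 × 𝔼, |φ (Real.cos θ • p.1 - Real.sin θ • p.2) * fderiv ℝ φ p.1 p.2| ≤
        C * L * ((1 + ‖p.1‖) ^ 2 * (1 + ‖p.2‖) ^ 2) := fun p => by
      rw [abs_mul]
      have h1 := hC (Real.cos θ • p.1 - Real.sin θ • p.2)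
      have h2 : |fderiv ℝ φ p.1 p.2| ≤ L * ‖p.2‖ :=
        ((fderiv ℝ φ _).le_opNorm _).trans (by gcongr; exact hL _)
      have h3 := hnorm (-θ) p
      rw [Real.cos_neg, Real.sin_neg, neg_smul, ← sub_eq_add_neg] at h3
      have hx := norm_nonneg p.1
      have hy := norm_nonneg p.2
      calc _ ≤ (C * (1 + ‖Real.cos θ • p.1 - Real.sin θ • p.2‖)) * (L * ‖p.2‖) := by gcongr
        _ ≤ (C * (1 + (‖p.1‖ + ‖p.2‖))) * (L * ‖p.2‖) := by gcongr
        _ = C * L * ((1 + (‖p.1‖ + ‖p.2‖)) * ‖p.2‖) := by ring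
        _ ≤ C * L * ((1 + ‖p.1‖) ^ 2 * (1 + ‖p.2‖) ^ 2) := by
          refine mul_le_mul_of_nonneg_left ?_ (by positivity)
          have h5 : 0 ≤ ‖p.1‖ * ‖p.2‖ := by positivity
          have h6 : 0 ≤ ‖p.1‖ * ‖p.2‖ ^ 2 := by positivity
          have h7 : 0 ≤ ‖p.1‖ ^ 2 * (1 + ‖p.2‖) ^ 2 := by positivity
          nlinarith
    have hb4 : ∀ p : 𝔼 × 𝔼, |-Real.sin θ *
        fderiv ℝ φ (Real.cos (-θ) • p.1 + Real.sin (-θ) • p.2) (grad p.1)| ≤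
        L * L * ((1 + ‖p.1‖) ^ 0 * (1 + ‖p.2‖) ^ 0) := fun p => by
      rw [abs_mul, abs_neg, pow_zero, pow_zero, mul_one, mul_one]
      have h2 : |fderiv ℝ φ (Real.cos (-θ) • p.1 + Real.sin (-θ) • p.2) (grad p.1)| ≤ L * L :=
        ((fderiv ℝ φ _).le_opNorm _).trans (mul_le_mul (hL _)
          (by rw [hgrad]; simp only [LinearIsometryEquiv.norm_map]; exact hL _)
          (norm_nonneg _) hL0)
      have := mul_le_mul (abs_sin_le_one θ) h2 (abs_nonneg _) zero_le_one
      linarith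
    rw [integral_prod _ (integrable_prod_stdGaussian (by fun_prop) hb3),
      integral_prod _ (integrable_prod_stdGaussian (by fun_prop) hb4)]
    refine integral_congr_ae (Eventually.of_forall fun u => ?_)
    simp only
    have hψ : ContDiff ℝ 1 (fun v : 𝔼 => φ (Real.cos θ • u - Real.sin θ • v)) := by fun_prop
    have hψd : ∀ v a : 𝔼, fderiv ℝ (fun v : 𝔼 => φ (Real.cos θ • u - Real.sin θ • v)) v a =
        -Real.sin θ * fderiv ℝ φ (Real.cos (-θ) • u + Real.sin (-θ) • v) a := fun v a => by
      have h1 : HasFDerivAt (fun v : 𝔼 => Real.cos θ • u - Real.sin θ • v)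
          (-(Real.sin θ • ContinuousLinearMap.id ℝ 𝔼)) v :=
        ((hasFDerivAt_id v).const_smul (Real.sin θ)).const_sub _
      have h2 := ((hφ.differentiable one_ne_zero _).hasFDerivAt.comp v h1).fderiv
      have h3 : (fun v : 𝔼 => φ (Real.cos θ • u - Real.sin θ • v)) =
        φ ∘ fun v => Real.cos θ • u - Real.sin θ • v := rfl
      rw [h3, h2]
      simp [sub_eq_add_neg]
    have hψL : ∀ v : 𝔼, ‖fderiv ℝ (fun v : 𝔼 => φ (Real.cos θ • u - Real.sin θ • v)) v‖ ≤ L :=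
      fun v => norm_le_of_forall_unit_abs_le fun η hη => by
        rw [hψd, abs_mul, abs_neg]
        have h2 : |fderiv ℝ φ (Real.cos (-θ) • u + Real.sin (-θ) • v) η| ≤ L * 1 :=
          ((fderiv ℝ φ _).le_opNorm _).trans (mul_le_mul (hL _) hη (norm_nonneg _) hL0)
        have := mul_le_mul (abs_sin_le_one θ) h2 (abs_nonneg _) zero_le_one
        linarith
    have h5 := integral_mul_inner_stdGaussian hψ hψL (grad u)
    simp_rw [hψd] at h5
    rw [← h5]
    refine integral_congr_ae (Eventually.of_forall fun v => ?_)
    simp only [hgrad, toDual_symm_apply]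
  -- The inner product is at most the average of the two squared norms; by rotation invariance each
  -- has mean D.
  have hlow : ∀ θ, 0 ≤ Real.sin θ → 0 ≤ m' θ + D * Real.sin θ := fun θ hθ => by
    have hiF : Integrable (fun p : 𝔼 × 𝔼 => ‖fderiv ℝ φ p.1‖ ^ 2) (γ.prod γ) := hiD.comp_fst γ
    have hF : Continuous (fun p : 𝔼 × 𝔼 => ‖fderiv ℝ φ p.1‖ ^ 2) := by fun_prop
    have h1 := integral_comp_rotation hF (-θ)
    have hiR : Integrable (fun p : 𝔼 × 𝔼 =>
        ‖fderiv ℝ φ (Real.cos (-θ) • p.1 + Real.sin (-θ) • p.2)‖ ^ 2) (γ.prod γ) :=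
      (measurePreserving_rotation (-θ)).integrable_comp_of_integrable hiF
    have hDF : ∫ p, ‖fderiv ℝ φ p.1‖ ^ 2 ∂(γ.prod γ) = D := by
      rw [integral_fun_fst (fun x => ‖fderiv ℝ φ x‖ ^ 2)]
      simp [hD]
    rw [hm'_eq]
    have h2 : ∫ p, -Real.sin θ * ((1 / 2) * (‖fderiv ℝ φ p.1‖ ^ 2) + (1 / 2) *
        ‖fderiv ℝ φ (Real.cos (-θ) • p.1 + Real.sin (-θ) • p.2)‖ ^ 2) ∂(γ.prod γ) ≤
        ∫ p, -Real.sin θ * fderiv ℝ φ (Real.cos (-θ) • p.1 + Real.sin (-θ) • p.2) (grad p.1)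
          ∂(γ.prod γ) := by
      refine integral_mono (((hiF.const_mul _).add (hiR.const_mul _)).const_mul _) ?_ fun p => ?_
      · refine integrable_prod_stdGaussian (C := L * L) (m := 0) (by fun_prop) fun p => ?_
        rw [abs_mul, abs_neg, pow_zero, pow_zero, mul_one, mul_one]
        have h2 : |fderiv ℝ φ (Real.cos (-θ) • p.1 + Real.sin (-θ) • p.2) (grad p.1)| ≤ L * L :=
          ((fderiv ℝ φ _).le_opNorm _).trans (mul_le_mul (hL _)
            (by rw [hgrad]; simp only [LinearIsometryEquiv.norm_map]; exact hL _)
            (norm_nonneg _) hL0)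
        have := mul_le_mul (abs_sin_le_one θ) h2 (abs_nonneg _) zero_le_one
        linarith
      · have h3 : fderiv ℝ φ (Real.cos (-θ) • p.1 + Real.sin (-θ) • p.2) (grad p.1) ≤
            (1 / 2) * (‖fderiv ℝ φ p.1‖ ^ 2) + (1 / 2) *
            ‖fderiv ℝ φ (Real.cos (-θ) • p.1 + Real.sin (-θ) • p.2)‖ ^ 2 := by
          have h4 := (le_abs_self _).trans
            ((fderiv ℝ φ (Real.cos (-θ) • p.1 + Real.sin (-θ) • p.2)).le_opNorm (grad p.1))
          have h5 : ‖grad p.1‖ = ‖fderiv ℝ φ p.1‖ := by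
            rw [hgrad]; simp only [LinearIsometryEquiv.norm_map]
          rw [h5] at h4
          nlinarith [sq_nonneg (‖fderiv ℝ φ p.1‖ -
            ‖fderiv ℝ φ (Real.cos (-θ) • p.1 + Real.sin (-θ) • p.2)‖)]
        simp only
        nlinarith
    rw [integral_const_mul, integral_add (hiF.const_mul _) (hiR.const_mul _), integral_const_mul,
      integral_const_mul] at h2
    rw [h1, hDF] at h2
    linarith
  -- Integrating m' ≥ -D sin θ over [0, π/2] gives exactly the constant 1.
  have hmono : MonotoneOn (fun θ => m θ - D * Real.cos θ) (Set.Icc 0 (π / 2)) := by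
    have hd : ∀ θ, HasDerivAt (fun θ => m θ - D * Real.cos θ) (m' θ + D * Real.sin θ) θ :=
      fun θ => ((hderiv θ).sub ((hasDerivAt_cos θ).const_mul D)).congr_deriv (by ring)
    refine monotoneOn_of_deriv_nonneg (convex_Icc _ _)
      (fun θ _ => (hd θ).continuousAt.continuousWithinAt)
      (fun θ _ => (hd θ).differentiableAt.differentiableWithinAt) fun θ hθ => ?_
    rw [interior_Icc] at hθ
    rw [(hd θ).deriv]
    exact hlow θ (sin_nonneg_of_nonneg_of_le_pi hθ.1.le (by linarith [hθ.2, pi_pos]))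
  have hfin := hmono (Set.left_mem_Icc.2 (by positivity)) (Set.right_mem_Icc.2 (by positivity))
    (by positivity : (0 : ℝ) ≤ π / 2)
  have hm0 : m 0 = ∫ x, φ x ^ 2 ∂γ := by
    rw [hm]
    simp only [Real.cos_zero, Real.sin_zero, one_smul, zero_smul, add_zero, ← sq]
    rw [integral_fun_fst (fun x => φ x ^ 2)]
    simp
  have hm1 : m (π / 2) = (∫ x, φ x ∂γ) ^ 2 := by
    rw [hm]
    simp only [Real.cos_pi_div_two, Real.sin_pi_div_two, one_smul, zero_smul, zero_add]
    rw [integral_prod_mul, sq]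
  simp only [hm0, hm1, Real.cos_zero, Real.cos_pi_div_two, mul_one, mul_zero, sub_zero] at hfin
  linarith

end GaussianPoincare
end EntropyJump

/-! ### The Poincaré inequality for C¹ functions and along the heat flow -/

namespace EntropyJump

section PoincareTransfer

open Real InnerProductSpace Filter Topology

variable {d : ℕ}

local notation "𝔼" => EuclideanSpace ℝ (Fin d)

section Density

variable {f : EuclideanSpace ℝ (Fin d) → ℝ}

lemma integral_withDensity_ofReal {F : Type*} [NormedAddCommGroup F] [NormedSpace ℝ F]
    (hf : AEMeasurable f volume) (hf0 : ∀ x, 0 ≤ f x) (g : 𝔼 → F) :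
    ∫ x, g x ∂volume.withDensity (fun x => ENNReal.ofReal (f x)) = ∫ x, f x • g x := by
  rw [integral_withDensity_eq_integral_toReal_smul₀ hf.ennreal_ofReal
    (Eventually.of_forall fun _ => ENNReal.ofReal_lt_top)]
  simp only [ENNReal.toReal_ofReal (hf0 _)]

lemma integrable_withDensity_ofReal_iff (hf : AEMeasurable f volume) (hf0 : ∀ x, 0 ≤ f x)
    {g : 𝔼 → ℝ} : Integrable g (volume.withDensity (fun x => ENNReal.ofReal (f x))) ↔
      Integrable (fun x => f x * g x) := by
  rw [integrable_withDensity_iff_integrable_smul₀' hf.ennreal_ofReal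
    (Eventually.of_forall fun _ => ENNReal.ofReal_lt_top)]
  simp only [ENNReal.toReal_ofReal (hf0 _), smul_eq_mul]

end Density

/-- The Poincaré inequality for a measure, on functions of class `C¹` with bounded derivative. -/
def SatisfiesLipPoincare (P : Measure 𝔼) (c : ℝ) : Prop :=
  ∀ φ : 𝔼 → ℝ, ContDiff ℝ 1 φ → ∀ L, (∀ x, ‖fderiv ℝ φ x‖ ≤ L) →
    c * (∫ x, φ x ^ 2 ∂P - (∫ x, φ x ∂P) ^ 2) ≤ ∫ x, ‖fderiv ℝ φ x‖ ^ 2 ∂P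

/-- Mollification of a `C¹` function with bounded derivative. -/
lemma exists_smooth_approx {φ : 𝔼 → ℝ} (hφ : ContDiff ℝ 1 φ) {L : ℝ}
    (hL : ∀ x, ‖fderiv ℝ φ x‖ ≤ L) :
    ∃ (ψ : ℕ → 𝔼 → ℝ) (C : ℝ), 0 ≤ C ∧ (∀ n, ContDiff ℝ (↑(⊤ : ℕ∞)) (ψ n)) ∧
      (∀ n x, ‖fderiv ℝ (ψ n) x‖ ≤ L) ∧ (∀ n x, |ψ n x| ≤ C * (1 + ‖x‖)) ∧
      (∀ x, Tendsto (fun n => ψ n x) atTop (𝓝 (φ x))) ∧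
      (∀ x, Tendsto (fun n => fderiv ℝ (ψ n) x) atTop (𝓝 (fderiv ℝ φ x))) := by
  obtain ⟨C, hC0, hC⟩ := exists_abs_le_one_add_norm hφ hL
  set r : ℕ → ContDiffBump (0 : 𝔼) := fun n =>
    ⟨1 / (2 * ((n : ℝ) + 1)), 1 / ((n : ℝ) + 1), by positivity,
      one_div_lt_one_div_of_lt (by positivity) (by linarith [(n.cast_nonneg : (0 : ℝ) ≤ n)])⟩ with hr
  have hrout : ∀ n, (r n).rOut = 1 / ((n : ℝ) + 1) := fun n => rfl
  have hr0 : Tendsto (fun n => (r n).rOut) atTop (𝓝 0) := by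
    simp only [hrout]
    exact tendsto_one_div_add_atTop_nhds_zero_nat
  have hr1 : ∀ n, (r n).rOut ≤ 1 := fun n => by
    rw [hrout, div_le_one (by positivity)]
    linarith [(n.cast_nonneg : (0 : ℝ) ≤ n)]
  set ρ : ℕ → 𝔼 → ℝ := fun n => (r n).normed volume with hρ
  have hρ0 : ∀ n x, 0 ≤ ρ n x := fun n x => (r n).nonneg_normed x
  have hρc : ∀ n, Continuous (ρ n) := fun n => (r n).continuous_normed
  have hρi : ∀ n, Integrable (ρ n) := fun n => (r n).integrable_normed
  set Q : ℕ → Measure 𝔼 := fun n => volume.withDensity fun x => ENNReal.ofReal (ρ n x) with hQ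
  have hQp : ∀ n, IsProbabilityMeasure (Q n) := fun n => ⟨by
    rw [hQ, withDensity_apply _ MeasurableSet.univ, Measure.restrict_univ,
      ← ofReal_integral_eq_lintegral_ofReal (hρi n) (Eventually.of_forall (hρ0 n)),
      (r n).integral_normed, ENNReal.ofReal_one]⟩
  have hQint : ∀ n x, Integrable (fun y => φ (x - y)) (Q n) := fun n x => by
    rw [hQ, integrable_withDensity_ofReal_iff (hρc n).aemeasurable (hρ0 n)]
    exact ((hρc n).mul (hφ.continuous.comp (by fun_prop))).integrable_of_hasCompactSupport
      ((r n).hasCompactSupport_normed.mul_right)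
  have hconv : ∀ n, measConv (Q n) φ =
      convolution (ρ n) φ (ContinuousLinearMap.lsmul ℝ ℝ) volume := fun n => funext fun x => by
    rw [measConv, hQ, integral_withDensity_ofReal (hρc n).aemeasurable (hρ0 n)]
    rfl
  have hcD := hφ.continuous_fderiv one_ne_zero
  refine ⟨fun n => measConv (Q n) φ, C * 2, by positivity, fun n => ?_, fun n x => ?_,
    fun n x => ?_, fun x => ?_, fun x => ?_⟩
  · simp only [hconv]
    exact (r n).hasCompactSupport_normed.contDiff_convolution_left _ (r n).contDiff_normed
      hφ.continuous.locallyIntegrable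
  · rw [(hasFDerivAt_measConv hφ hL (hQint n) x).fderiv]
    refine (norm_integral_le_of_norm_le (integrable_const L)
      (Eventually.of_forall fun y => hL _)).trans ?_
    simp
  · have h1 : ∀ y, ‖ρ n y * φ (x - y)‖ ≤ C * 2 * (1 + ‖x‖) * ρ n y := fun y => by
      rw [norm_mul, norm_of_nonneg (hρ0 n y), mul_comm]
      by_cases hy : y ∈ Metric.ball (0 : 𝔼) (r n).rOut
      · refine mul_le_mul_of_nonneg_right ?_ (hρ0 n y)
        rw [mem_ball_zero_iff] at hy
        have h2 := norm_sub_le x y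
        have h3 := hC (x - y)
        have h4 := hr1 n
        rw [norm_eq_abs]
        nlinarith [norm_nonneg x]
      · rw [← (r n).support_normed_eq (μ := volume), Function.notMem_support] at hy
        have : ρ n y = 0 := hy
        rw [this]; simp
    have h2 := norm_integral_le_of_norm_le ((hρi n).const_mul (C * 2 * (1 + ‖x‖)))
      (Eventually.of_forall h1)
    rw [integral_const_mul, (r n).integral_normed, mul_one] at h2
    simp only [measConv, hQ]
    rw [integral_withDensity_ofReal (hρc n).aemeasurable (hρ0 n)]
    exact h2
  · simp only [hconv]
    exact ContDiffBump.convolution_tendsto_right_of_continuous hr0 hφ.continuous x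
  · have h1 : ∀ n, fderiv ℝ (measConv (Q n) φ) x =
        convolution (ρ n) (fderiv ℝ φ) (ContinuousLinearMap.lsmul ℝ ℝ) volume x := fun n => by
      rw [(hasFDerivAt_measConv hφ hL (hQint n) x).fderiv, hQ,
        integral_withDensity_ofReal (hρc n).aemeasurable (hρ0 n)]
      rfl
    simp only [h1]
    exact ContDiffBump.convolution_tendsto_right_of_continuous hr0 hcD x

section Moments

variable {P : Measure (EuclideanSpace ℝ (Fin d))} [IsProbabilityMeasure P]

lemma integrable_one_add_norm_sq (hP : Integrable (fun x : 𝔼 => ‖x‖ ^ 2) P) :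
    Integrable (fun x : 𝔼 => (1 + ‖x‖) ^ 2) P := by
  have h : (fun x : 𝔼 => (1 + ‖x‖) ^ 2) = fun x => (1 + 2 * ‖x‖) + ‖x‖ ^ 2 := by
    funext x; ring
  rw [h]
  exact ((integrable_const 1).add ((integrable_norm_of_sq hP).const_mul 2)).add hP

lemma integrable_of_abs_le_one_add_norm (hP : Integrable (fun x : 𝔼 => ‖x‖ ^ 2) P) {φ : 𝔼 → ℝ}
    (hφ : Continuous φ) {C : ℝ} (h : ∀ x, |φ x| ≤ C * (1 + ‖x‖)) : Integrable φ P :=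
  (((integrable_const 1).add (integrable_norm_of_sq hP)).const_mul C).mono'
    hφ.aestronglyMeasurable (Eventually.of_forall h)

lemma sq_le_of_abs_le_one_add_norm {φ : 𝔼 → ℝ} {C : ℝ} {x : 𝔼} (h : |φ x| ≤ C * (1 + ‖x‖)) :
    φ x ^ 2 ≤ C ^ 2 * (1 + ‖x‖) ^ 2 := by
  rw [← sq_abs, ← mul_pow]
  exact pow_le_pow_left₀ (abs_nonneg _) h 2

lemma integrable_sq_of_abs_le_one_add_norm (hP : Integrable (fun x : 𝔼 => ‖x‖ ^ 2) P)
    {φ : 𝔼 → ℝ} (hφ : Continuous φ) {C : ℝ} (h : ∀ x, |φ x| ≤ C * (1 + ‖x‖)) :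
    Integrable (fun x => φ x ^ 2) P :=
  ((integrable_one_add_norm_sq hP).const_mul (C ^ 2)).mono' (hφ.pow 2).aestronglyMeasurable
    (Eventually.of_forall fun x => by
      rw [norm_of_nonneg (sq_nonneg _)]
      exact sq_le_of_abs_le_one_add_norm (h x))

lemma integral_sub_mean_sq {φ : 𝔼 → ℝ} (h1 : Integrable φ P)
    (h2 : Integrable (fun x => φ x ^ 2) P) :
    ∫ x, (φ x - ∫ y, φ y ∂P) ^ 2 ∂P = ∫ x, φ x ^ 2 ∂P - (∫ x, φ x ∂P) ^ 2 := by
  set m := ∫ y, φ y ∂P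
  have h : ∀ x, (φ x - m) ^ 2 = φ x ^ 2 + (-(2 * m) * φ x + m ^ 2) := fun x => by ring
  simp_rw [h]
  rw [integral_add_three h2 (h1.const_mul _) (integrable_const _), integral_const_mul,
    integral_const, probReal_univ, one_smul]
  ring

end Moments

/-- A density with a Poincaré inequality for smooth functions. -/
theorem SatisfiesPoincare.lipPoincare {f : 𝔼 → ℝ} {c : ℝ} (hfc : SatisfiesPoincare f c)
    (hf : AEMeasurable f volume) (hf0 : ∀ x, 0 ≤ f x) {P : Measure 𝔼} [IsProbabilityMeasure P]
    (hPf : P = volume.withDensity fun x => ENNReal.ofReal (f x))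
    (hP : Integrable (fun x : 𝔼 => ‖x‖ ^ 2) P) : SatisfiesLipPoincare P c := by
  have hint : ∀ g : 𝔼 → ℝ, ∫ x, f x * g x = ∫ x, g x ∂P := fun g => by
    rw [hPf, integral_withDensity_ofReal hf hf0]; rfl
  have hintg : ∀ g : 𝔼 → ℝ, Integrable g P → Integrable (fun x => f x * g x) := fun g hg =>
    (integrable_withDensity_ofReal_iff hf hf0).1 (hPf ▸ hg)
  -- Smooth functions first: subtract the mean. A bounded derivative forces linear growth, so the
  -- second moment of P supplies every integrability condition of the hypothesis. General C¹
  -- functions follow by mollification and dominated convergence.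
  have hsmooth : ∀ φ : 𝔼 → ℝ, ContDiff ℝ (↑(⊤ : ℕ∞)) φ → ∀ L, (∀ x, ‖fderiv ℝ φ x‖ ≤ L) →
      c * (∫ x, φ x ^ 2 ∂P - (∫ x, φ x ∂P) ^ 2) ≤ ∫ x, ‖fderiv ℝ φ x‖ ^ 2 ∂P := by
    intro φ hφ L hL
    have hφ1 : ContDiff ℝ 1 φ := hφ.of_le (by exact_mod_cast le_top)
    obtain ⟨C, hC0, hC⟩ := exists_abs_le_one_add_norm hφ1 hL
    have hi1 := integrable_of_abs_le_one_add_norm hP hφ.continuous hC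
    have hi2 := integrable_sq_of_abs_le_one_add_norm hP hφ.continuous hC
    set m := ∫ y, φ y ∂P with hm
    have hg : ∀ x, ‖gradient (fun x => φ x - m) x‖ = ‖fderiv ℝ φ x‖ := fun x => by
      rw [gradient, LinearIsometryEquiv.norm_map, fderiv_sub_const]
    have hi3 : Integrable (fun x => (φ x - m) ^ 2) P := by
      have h : ∀ x, (φ x - m) ^ 2 = (φ x ^ 2 + -(2 * m) * φ x) + m ^ 2 := fun x => by ring
      simp_rw [h]
      exact (hi2.add (hi1.const_mul _)).add (integrable_const _)
    have hi4 : Integrable (fun x => ‖fderiv ℝ φ x‖ ^ 2) P :=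
      (integrable_const (L ^ 2)).mono'
        ((hφ1.continuous_fderiv one_ne_zero).norm.pow 2).aestronglyMeasurable
        (Eventually.of_forall fun x => by
          rw [norm_of_nonneg (sq_nonneg _)]
          exact pow_le_pow_left₀ (norm_nonneg _) (hL x) 2)
    have key := hfc (fun x => φ x - m) (hφ.sub contDiff_const)
      (hintg _ (hi1.sub (integrable_const m))) (hintg _ hi3)
      (by simp only [hg]; exact hintg _ hi4)
      (by rw [hint (fun x => φ x - m), integral_sub hi1 (integrable_const m)]; simp [hm])
    simp only [hg] at key
    rw [hint (fun x => (φ x - m) ^ 2), hint (fun x => ‖fderiv ℝ φ x‖ ^ 2),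
      integral_sub_mean_sq hi1 hi2] at key
    exact key
  intro φ hφ L hL
  obtain ⟨ψ, C, hC0, hψ, hψL, hψC, hψt, hψt'⟩ := exists_smooth_approx hφ hL
  have t1 : Tendsto (fun n => ∫ x, ψ n x ∂P) atTop (𝓝 (∫ x, φ x ∂P)) :=
    tendsto_integral_of_dominated_convergence (fun x => C * (1 + ‖x‖))
      (fun n => (hψ n).continuous.aestronglyMeasurable)
      (((integrable_const 1).add (integrable_norm_of_sq hP)).const_mul C)
      (fun n => Eventually.of_forall (hψC n)) (Eventually.of_forall hψt)
  have t2 : Tendsto (fun n => ∫ x, ψ n x ^ 2 ∂P) atTop (𝓝 (∫ x, φ x ^ 2 ∂P)) :=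
    tendsto_integral_of_dominated_convergence (fun x => C ^ 2 * (1 + ‖x‖) ^ 2)
      (fun n => ((hψ n).continuous.pow 2).aestronglyMeasurable)
      ((integrable_one_add_norm_sq hP).const_mul _)
      (fun n => Eventually.of_forall fun x => by
        rw [norm_of_nonneg (sq_nonneg _)]
        exact sq_le_of_abs_le_one_add_norm (hψC n x))
      (Eventually.of_forall fun x => (hψt x).pow 2)
  have t3 : Tendsto (fun n => ∫ x, ‖fderiv ℝ (ψ n) x‖ ^ 2 ∂P) atTop
      (𝓝 (∫ x, ‖fderiv ℝ φ x‖ ^ 2 ∂P)) :=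
    tendsto_integral_of_dominated_convergence (fun _ => L ^ 2)
      (fun n => (((hψ n).continuous_fderiv (by simp)).norm.pow 2).aestronglyMeasurable)
      (integrable_const _)
      (fun n => Eventually.of_forall fun x => by
        rw [norm_of_nonneg (sq_nonneg _)]
        exact pow_le_pow_left₀ (norm_nonneg _) (hψL n x) 2)
      (Eventually.of_forall fun x => (hψt' x).norm.pow 2)
  exact le_of_tendsto_of_tendsto' ((t2.sub (t1.pow 2)).const_mul c) t3
    fun n => hsmooth (ψ n) (hψ n) L (hψL n)

/-- The Poincaré constant of an isotropic measure in positive dimension is at most one. -/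
lemma SatisfiesLipPoincare.le_one {P : Measure 𝔼} [IsProbabilityMeasure P] {c : ℝ}
    (h : SatisfiesLipPoincare P c) (hP : IsIsotropicMeasure P) (i : Fin d) : c ≤ 1 := by
  have hd : ∀ x : 𝔼, fderiv ℝ (fun x : 𝔼 => x i) x = EuclideanSpace.proj i := fun x =>
    (EuclideanSpace.proj (𝕜 := ℝ) i).hasFDerivAt.fderiv
  have hn : ‖(EuclideanSpace.proj i : 𝔼 →L[ℝ] ℝ)‖ ≤ 1 :=
    ContinuousLinearMap.opNorm_le_bound _ zero_le_one fun x => by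
      simpa using abs_coord_le_norm x i
  -- A coordinate has variance 1 and a differential of norm at most 1.
  have key := h (fun x => x i) (by fun_prop) 1 (fun x => by rw [hd]; exact hn)
  have h2 : ∫ x : 𝔼, x i ^ 2 ∂P = 1 := by simpa [sq] using hP.cov i i
  rw [h2, hP.mean] at key
  simp only [hd, integral_const, probReal_univ, one_smul] at key
  nlinarith [norm_nonneg (EuclideanSpace.proj i : 𝔼 →L[ℝ] ℝ)]

/-- Scaling by √t turns the kernel at time t into the standard Gaussian, so the flow is the density
of y + √t z with y drawn from P and z standard Gaussian, independent. -/
lemma integral_mul_heatKernel {t : ℝ} (ht : 0 < t) (F : 𝔼 → ℝ) :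
    ∫ z, F z * heatKernel t z = ∫ z, F (√t • z) ∂stdGaussian 𝔼 := by
  rw [integral_stdGaussian]
  have hs : 0 < √t := sqrt_pos.2 ht
  have h := Measure.integral_comp_smul (volume : Measure 𝔼)
    (fun z => F z * heatKernel t z) (√t)
  have hk : ∀ z : 𝔼, heatKernel t (√t • z) = (√t ^ d)⁻¹ * heatKernel 1 z := fun z => by
    have e : (√t ^ d)⁻¹ = exp (-(d / 2) * log t) := by
      rw [← rpow_natCast, sqrt_eq_rpow, ← rpow_mul ht.le, ← rpow_neg ht.le, rpow_def_of_pos ht]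
      congr 1; ring
    rw [e, heatKernel, heatKernel, ← exp_add, norm_smul, mul_pow, norm_of_nonneg hs.le,
      sq_sqrt ht.le, log_mul (by positivity) ht.ne']
    congr 1
    field_simp
    ring
  rw [finrank_euclideanSpace, Fintype.card_fin, abs_of_pos (by positivity), smul_eq_mul] at h
  simp only [hk] at h
  have h2 : ∀ z : 𝔼, F (√t • z) * ((√t ^ d)⁻¹ * heatKernel 1 z) =
      (√t ^ d)⁻¹ * (F (√t • z) * heatKernel 1 z) := fun z => by ring
  simp only [h2] at h
  rw [integral_const_mul] at h
  exact (mul_left_cancel₀ (by positivity) h).symm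

section Flow

variable {P : Measure (EuclideanSpace ℝ (Fin d))} [IsProbabilityMeasure P] {t : ℝ}

lemma integral_mul_heatFlow (hP : Integrable (fun x : 𝔼 => ‖x‖ ^ 2) P) (ht : 0 < t) {φ : 𝔼 → ℝ}
    (hφ : Continuous φ) {C : ℝ} (hφC : ∀ x, |φ x| ≤ C * (1 + ‖x‖ ^ 2)) :
    ∫ x, φ x * heatFlow P t x = ∫ y, (∫ z, φ (y + √t • z) ∂stdGaussian 𝔼) ∂P := by
  rw [integral_mul_measConv (integrable_prod_heatKernel₀ hφ hφC hP ht)]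
  exact integral_congr_ae (Eventually.of_forall fun y =>
    integral_mul_heatKernel ht fun z => φ (y + z))

lemma integrable_integral_stdGaussian (hP : Integrable (fun x : 𝔼 => ‖x‖ ^ 2) P) (ht : 0 < t)
    {φ : 𝔼 → ℝ} (hφ : Continuous φ) {C : ℝ} (hφC : ∀ x, |φ x| ≤ C * (1 + ‖x‖ ^ 2)) :
    Integrable (fun y => ∫ z, φ (y + √t • z) ∂stdGaussian 𝔼) P := by
  have h := (integrable_prod_heatKernel₀ hφ hφC hP ht).integral_prod_left
  refine h.congr (Eventually.of_forall fun y => ?_)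
  exact integral_mul_heatKernel ht fun z => φ (y + z)

/-- The Poincaré inequality along the heat flow. -/
theorem SatisfiesLipPoincare.heatFlow {c : ℝ} (h : SatisfiesLipPoincare P c) (hc : 0 < c)
    (hc1 : c ≤ 1) (hP : Integrable (fun x : 𝔼 => ‖x‖ ^ 2) P) (ht : 0 < t) {φ : 𝔼 → ℝ}
    (hφ : ContDiff ℝ 1 φ) {L : ℝ} (hL : ∀ x, ‖fderiv ℝ φ x‖ ≤ L)
    (hmean : ∫ x, φ x * EntropyJump.heatFlow P t x = 0) :
    c * ∫ x, φ x ^ 2 * EntropyJump.heatFlow P t x ≤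
      (1 + t) * ∫ x, ‖fderiv ℝ φ x‖ ^ 2 * EntropyJump.heatFlow P t x := by
  set γ := stdGaussian 𝔼 with hγ
  have hL0 : 0 ≤ L := (norm_nonneg _).trans (hL 0)
  obtain ⟨C, hC0, hC⟩ := exists_abs_le_one_add_norm hφ hL
  have hcD := hφ.continuous_fderiv one_ne_zero
  have b1 : ∀ x, |φ x| ≤ 2 * C * (1 + ‖x‖ ^ 2) := fun x => (hC x).trans (by
    nlinarith [mul_nonneg hC0 (sq_nonneg (‖x‖ - 1)), mul_nonneg hC0 (sq_nonneg ‖x‖)])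
  have b2 : ∀ x, |φ x ^ 2| ≤ 2 * C ^ 2 * (1 + ‖x‖ ^ 2) := fun x => by
    rw [abs_of_nonneg (sq_nonneg _)]
    refine (sq_le_of_abs_le_one_add_norm (hC x)).trans ?_
    nlinarith [mul_nonneg (sq_nonneg C) (sq_nonneg (‖x‖ - 1))]
  have bL : ∀ x, ‖fderiv ℝ φ x‖ ^ 2 ≤ L ^ 2 := fun x => pow_le_pow_left₀ (norm_nonneg _) (hL x) 2
  have b3 : ∀ x, |‖fderiv ℝ φ x‖ ^ 2| ≤ L ^ 2 * (1 + ‖x‖ ^ 2) := fun x => by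
    rw [abs_of_nonneg (sq_nonneg _)]
    nlinarith [bL x, mul_nonneg (sq_nonneg L) (sq_nonneg ‖x‖)]
  -- the semigroup as a convolution with a probability measure
  set Q : Measure 𝔼 := γ.map fun z => -(√t • z) with hQ
  have hmeas : Measurable fun z : 𝔼 => -(√t • z) := by fun_prop
  have hQp : IsProbabilityMeasure Q := Measure.isProbabilityMeasure_map hmeas.aemeasurable
  have hγsq : Integrable (fun z : 𝔼 => ‖z‖ ^ 2) γ :=
    (integrable_pow_stdGaussian 2).mono' (by fun_prop) (Eventually.of_forall fun z => by
      rw [norm_of_nonneg (sq_nonneg _)]; nlinarith [norm_nonneg z])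
  have hshift : ∀ y : 𝔼, ContDiff ℝ 1 fun z : 𝔼 => φ (y + √t • z) := fun y => by fun_prop
  have hshiftd : ∀ y z : 𝔼, fderiv ℝ (fun z : 𝔼 => φ (y + √t • z)) z =
      √t • fderiv ℝ φ (y + √t • z) := fun y z => by
    have h1 : HasFDerivAt (fun z : 𝔼 => y + √t • z) (√t • ContinuousLinearMap.id ℝ 𝔼) z :=
      ((hasFDerivAt_id z).const_smul (√t)).const_add _
    have h2 := ((hφ.differentiable one_ne_zero _).hasFDerivAt.comp z h1).fderiv
    have h3 : (fun z : 𝔼 => φ (y + √t • z)) = φ ∘ fun z => y + √t • z := rfl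
    rw [h3, h2]
    ext; simp
  have hshiftL : ∀ y z : 𝔼, ‖fderiv ℝ (fun z : 𝔼 => φ (y + √t • z)) z‖ ≤ √t * L := fun y z => by
    rw [hshiftd, norm_smul, norm_of_nonneg (sqrt_nonneg t)]
    exact mul_le_mul_of_nonneg_left (hL _) (sqrt_nonneg t)
  have hQi : ∀ y, Integrable (fun z => φ (y - z)) Q := fun y => by
    have hc : Continuous fun z => φ (y - z) := hφ.continuous.comp (by fun_prop)
    rw [hQ, integrable_map_measure hc.aestronglyMeasurable hmeas.aemeasurable]
    obtain ⟨C', _, hC'⟩ := exists_abs_le_one_add_norm (hshift y) (hshiftL y)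
    have := integrable_of_abs_le_one_add_norm hγsq (hshift y).continuous hC'
    simpa [Function.comp_def] using this
  have hconv : ∀ y, measConv Q φ y = ∫ z, φ (y + √t • z) ∂γ := fun y => by
    have hc : Continuous fun z => φ (y - z) := hφ.continuous.comp (by fun_prop)
    rw [measConv, hQ, integral_map hmeas.aemeasurable hc.aestronglyMeasurable]
    simp
  have hQφ := contDiff_measConv hφ hL hQi
  have hD2i : ∀ y, Integrable (fun z => ‖fderiv ℝ φ (y + √t • z)‖ ^ 2) γ := fun y =>
    (integrable_const (L ^ 2)).mono' (by fun_prop) (Eventually.of_forall fun z => by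
      rw [norm_of_nonneg (sq_nonneg _)]; exact bL _)
  -- The gradient of the Gaussian average is the average of the gradient; Jensen is used as
  -- nonnegativity of the variance of its norm.
  have hQD : ∀ y, ‖fderiv ℝ (measConv Q φ) y‖ ^ 2 ≤ ∫ z, ‖fderiv ℝ φ (y + √t • z)‖ ^ 2 ∂γ :=
    fun y => by
    have hc : Continuous fun z => fderiv ℝ φ (y - z) := hcD.comp (by fun_prop)
    rw [(hasFDerivAt_measConv hφ hL hQi y).fderiv, hQ, integral_map hmeas.aemeasurable
      hc.aestronglyMeasurable]
    simp only [sub_neg_eq_add]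
    have hDi : Integrable (fun z => ‖fderiv ℝ φ (y + √t • z)‖) γ :=
      (integrable_const L).mono' (by fun_prop) (Eventually.of_forall fun z => by
        rw [norm_norm]; exact hL _)
    have h1 := norm_integral_le_integral_norm (μ := γ) fun z : 𝔼 => fderiv ℝ φ (y + √t • z)
    have h2 : 0 ≤ ∫ z, (‖fderiv ℝ φ (y + √t • z)‖ - ∫ z, ‖fderiv ℝ φ (y + √t • z)‖ ∂γ) ^ 2 ∂γ :=
      integral_nonneg fun z => sq_nonneg _
    rw [integral_sub_mean_sq hDi (hD2i y)] at h2
    have h3 := pow_le_pow_left₀ (norm_nonneg _) h1 2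
    linarith
  have hQL : ∀ y, ‖fderiv ℝ (measConv Q φ) y‖ ≤ L := fun y => by
    rw [(hasFDerivAt_measConv hφ hL hQi y).fderiv]
    refine (norm_integral_le_of_norm_le (integrable_const L)
      (Eventually.of_forall fun y => hL _)).trans ?_
    simp
  have key1 := h _ hQφ L hQL
  have hm0 : ∫ y, measConv Q φ y ∂P = 0 := by
    rw [← hmean, integral_mul_heatFlow hP ht hφ.continuous b1]
    simp only [hconv, hγ]
  rw [hm0, zero_pow two_ne_zero, sub_zero] at key1
  -- Variance in z for fixed y; the scaling by √t puts the factor t into the Gaussian Poincaré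
  -- inequality.
  have hvar : ∀ y, ∫ z, φ (y + √t • z) ^ 2 ∂γ ≤
      measConv Q φ y ^ 2 + t * ∫ z, ‖fderiv ℝ φ (y + √t • z)‖ ^ 2 ∂γ := fun y => by
    have h1 := poincare_stdGaussian (hshift y) (hshiftL y)
    simp only [hshiftd, norm_smul, mul_pow, norm_of_nonneg (sqrt_nonneg t), sq_sqrt ht.le] at h1
    rw [integral_const_mul] at h1
    rw [hconv]
    linarith
  have hiD := integrable_integral_stdGaussian hP ht (φ := fun x => ‖fderiv ℝ φ x‖ ^ 2)
    (by fun_prop) b3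
  obtain ⟨C', hC'0, hC'⟩ := exists_abs_le_one_add_norm hQφ hQL
  have hiQ := integrable_sq_of_abs_le_one_add_norm hP hQφ.continuous hC'
  have key2 : ∫ x, φ x ^ 2 * EntropyJump.heatFlow P t x ≤ ∫ y, measConv Q φ y ^ 2 ∂P +
      t * ∫ x, ‖fderiv ℝ φ x‖ ^ 2 * EntropyJump.heatFlow P t x := by
    rw [integral_mul_heatFlow hP ht (φ := fun x => φ x ^ 2) (hφ.continuous.pow 2) b2,
      integral_mul_heatFlow hP ht (φ := fun x => ‖fderiv ℝ φ x‖ ^ 2) (by fun_prop) b3,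
      ← integral_const_mul, ← integral_add hiQ (hiD.const_mul t)]
    exact integral_mono (integrable_integral_stdGaussian hP ht (φ := fun x => φ x ^ 2)
      (hφ.continuous.pow 2) b2) (hiQ.add (hiD.const_mul t)) hvar
  have key3 : ∫ y, ‖fderiv ℝ (measConv Q φ) y‖ ^ 2 ∂P ≤
      ∫ x, ‖fderiv ℝ φ x‖ ^ 2 * EntropyJump.heatFlow P t x := by
    rw [integral_mul_heatFlow hP ht (φ := fun x => ‖fderiv ℝ φ x‖ ^ 2) (by fun_prop) b3]
    refine integral_mono ((integrable_const (L ^ 2)).mono'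
      ((hQφ.continuous_fderiv one_ne_zero).norm.pow 2).aestronglyMeasurable
      (Eventually.of_forall fun x => ?_)) hiD hQD
    rw [norm_of_nonneg (sq_nonneg _)]
    exact pow_le_pow_left₀ (norm_nonneg _) (hQL x) 2
  have h0 : 0 ≤ ∫ x, ‖fderiv ℝ φ x‖ ^ 2 * EntropyJump.heatFlow P t x :=
    integral_nonneg fun x => mul_nonneg (sq_nonneg _) (heatFlow_pos ht x).le
  -- The two variances give the factor 1 + c t in front of the gradient term; c ≤ 1 weakens it to 1
  -- + t.
  nlinarith [mul_le_mul_of_nonneg_left key2 hc.le, mul_nonneg (mul_nonneg (sub_nonneg.2 hc1) ht.le) h0]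

end Flow
end PoincareTransfer
end EntropyJump

/-! ### The Poincaré inequality applied to the scores -/

namespace EntropyJump

section FisherSq

open Real InnerProductSpace Filter Topology

variable {d : ℕ}

local notation "𝔼" => EuclideanSpace ℝ (Fin d)

lemma norm_sq_eq_sum_of_apply {L : 𝔼 →L[ℝ] ℝ} {a : Fin d → ℝ} (h : ∀ ξ : 𝔼, L ξ = ∑ j, ξ j * a j) :
    ‖L‖ ^ 2 = ∑ j, a j ^ 2 := by
  have : L = innerSL ℝ (WithLp.toLp 2 a : 𝔼) := by
    ext ξ
    rw [h, innerSL_apply_apply, PiLp.inner_apply]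
    simp
  rw [this, innerSL_apply_norm, EuclideanSpace.real_norm_sq_eq]

variable {P : Measure (EuclideanSpace ℝ (Fin d))} [IsProbabilityMeasure P] {t : ℝ}

lemma integral_score_mul_heatFlow (ht : 0 < t) (i : Fin d) :
    ∫ x, score P t i x * heatFlow P t x = 0 := by
  simp_rw [mul_comm (score P t i _), heatFlow_mul_score ht]
  exact integral_heatFlow₁ ht i

/-- For each i, Poincaré for the flow is tested on the score corrected by the linear function with
coefficients Iᵢⱼ, whose gradient is Iᵢⱼ - Hᵢⱼ and thus has mean zero. The energy is Σⱼ (∫ u Hᵢⱼ² -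
Iᵢⱼ²), a variance of the Hessian, and the L² norm is (1+t) Σⱼ Iᵢⱼ² - Iᵢᵢ. Dividing by 1+t and
summing over i gives the claim. -/
theorem sum_fisher_sq_le {c : ℝ} (h : SatisfiesLipPoincare P c) (hc : 0 < c)
    (hP : IsIsotropicMeasure P) (ht : 0 < t) (hlc : MidLogConcave (heatFlow P t)) :
    (1 + c) * ∑ i, ∑ j, fisher P t i j ^ 2 ≤
      ∑ i, ∑ j, hessSq P t i j + c / (1 + t) * ∑ i, fisher P t i i := by
  have ht1 : 0 < 1 + t := by linarith
  have key : ∀ i, (1 + c) * ∑ j, fisher P t i j ^ 2 ≤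
      ∑ j, hessSq P t i j + c / (1 + t) * fisher P t i i := fun i => by
    set J : Fin d → ℝ := fisher P t i with hJ
    set φ : 𝔼 → ℝ := fun x => score P t i x + ∑ j, J j * x j with hφ
    have hlin : ContDiff ℝ 1 fun x : 𝔼 => ∑ j, J j * x j := by fun_prop
    have hφ1 : ContDiff ℝ 1 φ := (contDiff_score ht i).add hlin
    have hfd : ∀ x ξ : 𝔼, fderiv ℝ φ x ξ = ∑ j, ξ j * (J j - negHess P t i j x) := fun x ξ => by
      have h1 : HasFDerivAt (fun x : 𝔼 => ∑ j, J j * x j)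
          (∑ j, J j • (EuclideanSpace.proj j : 𝔼 →L[ℝ] ℝ)) x :=
        HasFDerivAt.fun_sum fun j _ =>
          ((EuclideanSpace.proj (𝕜 := ℝ) j).hasFDerivAt (x := x)).const_mul (J j)
      have h2 := (((contDiff_score (P := P) ht i).differentiable one_ne_zero x).hasFDerivAt.add
        h1).fderiv
      have h3 : φ = score P t i + fun x : 𝔼 => ∑ j, J j * x j := rfl
      rw [h3, h2]
      simp only [add_apply, fderiv_score ht, sum_apply,
        smul_apply, smul_eq_mul, mul_sub, Finset.sum_sub_distrib,
        PiLp.proj_apply]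
      rw [Finset.sum_congr rfl fun j _ => mul_comm (J j) (ξ j)]
      ring
    have hnorm : ∀ x, ‖fderiv ℝ φ x‖ ^ 2 = ∑ j, (J j - negHess P t i j x) ^ 2 := fun x =>
      norm_sq_eq_sum_of_apply (hfd x)
    -- The Hessian bound 1/t, valid by log-concavity, makes φ admissible.
    have hL : ∀ x, ‖fderiv ℝ φ x‖ ≤ √(∑ j, (|J j| + 1 / t) ^ 2) := fun x => by
      refine le_sqrt_of_sq_le ?_
      rw [hnorm]
      refine Finset.sum_le_sum fun j _ => sq_le_sq' ?_ ?_
      · have h1 := abs_le.1 (abs_negHess_le_of_logConcave ht hlc i j x)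
        have h2 := neg_abs_le (J j)
        linarith [h1.2]
      · have h1 := abs_le.1 (abs_negHess_le_of_logConcave ht hlc i j x)
        have h2 := le_abs_self (J j)
        linarith [h1.1]
    have hcomm : ∀ x, score P t i x * heatFlow P t x = heatFlow₁ P t (stdVec i) x := fun x => by
      rw [mul_comm, heatFlow_mul_score ht]
    have is1 : Integrable fun x => score P t i x * heatFlow P t x := by
      simp_rw [hcomm]; exact integrable_heatFlow₁ ht i
    have ic : ∀ j, Integrable fun x : 𝔼 => J j * (x j * heatFlow P t x) := fun j =>
      (integrable_coord_mul_heatFlow hP.integrable_sq ht j).const_mul _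
    have hmean : ∫ x, φ x * heatFlow P t x = 0 := by
      have e : ∀ x, φ x * heatFlow P t x =
          score P t i x * heatFlow P t x + ∑ j, J j * (x j * heatFlow P t x) := fun x => by
        simp only [hφ, add_mul, Finset.sum_mul, mul_assoc]
      simp_rw [e]
      rw [integral_add is1 (integrable_finsetSum _ fun j _ => ic j),
        integral_finsetSum _ fun j _ => ic j, integral_score_mul_heatFlow ht]
      simp [integral_const_mul, integral_coord_mul_heatFlow hP ht]
    have iss := integrable_heatFlow_mul_score_mul_score (P := P) ht i i
    have isx : ∀ j, Integrable fun x : 𝔼 => 2 * J j * (x j * heatFlow₁ P t (stdVec i) x) :=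
      fun j => (integrable_coord_mul_heatFlow₁ hP.integrable_sq ht i j).const_mul _
    have ixx : ∀ j k, Integrable fun x : 𝔼 => J j * J k * (x j * x k * heatFlow P t x) :=
      fun j k => (integrable_coord_mul_coord_mul_heatFlow hP.integrable_sq ht j k).const_mul _
    -- The square of the score contributes Iᵢᵢ, the cross term -2 Iᵢᵢ, and the linear part has
    -- covariance (1+t) times the identity.
    have hsq : ∫ x, φ x ^ 2 * heatFlow P t x = (1 + t) * ∑ j, J j ^ 2 - J i := by
      have e : ∀ x, φ x ^ 2 * heatFlow P t x =
          heatFlow P t x * (score P t i x * score P t i x) +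
            (∑ j, 2 * J j * (x j * heatFlow₁ P t (stdVec i) x) +
              ∑ j, ∑ k, J j * J k * (x j * x k * heatFlow P t x)) := fun x => by
        have e1 : ∑ j, 2 * J j * (x j * heatFlow₁ P t (stdVec i) x) =
            2 * (∑ j, J j * x j) * (score P t i x * heatFlow P t x) := by
          rw [Finset.mul_sum, Finset.sum_mul]
          exact Finset.sum_congr rfl fun j _ => by rw [hcomm]; ring
        have e2 : ∑ j, ∑ k, J j * J k * (x j * x k * heatFlow P t x) =
            (∑ j, J j * x j) * (∑ k, J k * x k) * heatFlow P t x := by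
          rw [Finset.sum_mul_sum, Finset.sum_mul]
          refine Finset.sum_congr rfl fun j _ => ?_
          rw [Finset.sum_mul]
          exact Finset.sum_congr rfl fun k _ => by ring
        rw [e1, e2]
        simp only [hφ]
        ring
      simp_rw [e]
      rw [integral_add_three iss (integrable_finsetSum _ fun j _ => isx j)
        (integrable_finsetSum _ fun j _ => integrable_finsetSum _ fun k _ => ixx j k),
        integral_finsetSum _ fun j _ => isx j,
        integral_finsetSum _ fun j _ => integrable_finsetSum _ fun k _ => ixx j k]
      simp_rw [integral_finsetSum _ fun k _ => ixx _ k, integral_const_mul,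
        integral_coord_mul_coord_mul_heatFlow hP ht, integral_coord_mul_heatFlow₁ hP ht]
      simp only [mul_ite, mul_neg, mul_one, mul_zero, Finset.sum_ite_eq, Finset.mem_univ, if_true]
      have : ∫ x, heatFlow P t x * (score P t i x * score P t i x) = J i := rfl
      rw [this, Finset.mul_sum]
      have e3 : ∀ j, J j * J j * (1 + t) = (1 + t) * J j ^ 2 := fun j => by ring
      simp_rw [e3]
      ring
    have hgrad : ∫ x, ‖fderiv ℝ φ x‖ ^ 2 * heatFlow P t x =
        ∑ j, hessSq P t i j - ∑ j, J j ^ 2 := by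
      have e : ∀ x, ‖fderiv ℝ φ x‖ ^ 2 * heatFlow P t x =
          ∑ j, (heatFlow P t x * negHess P t i j x ^ 2 +
            (-(2 * J j) * (heatFlow P t x * negHess P t i j x) + J j ^ 2 * heatFlow P t x)) :=
        fun x => by
        rw [hnorm, Finset.sum_mul]
        exact Finset.sum_congr rfl fun j _ => by ring
      simp_rw [e]
      have i1 := fun j => integrable_heatFlow_mul_negHess_sq (P := P) ht i j
      have i2 := fun j => (integrable_heatFlow_mul_negHess (P := P) ht i j).const_mul (-(2 * J j))
      have i3 := fun j => (integrable_heatFlow (P := P) ht).const_mul (J j ^ 2)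
      have i4 : ∀ j, Integrable fun x => heatFlow P t x * negHess P t i j x ^ 2 +
          (-(2 * J j) * (heatFlow P t x * negHess P t i j x) + J j ^ 2 * heatFlow P t x) :=
        fun j => (i1 j).add ((i2 j).add (i3 j))
      rw [integral_finsetSum _ fun j _ => i4 j, ← Finset.sum_sub_distrib]
      refine Finset.sum_congr rfl fun j _ => ?_
      rw [integral_add_three (i1 j) (i2 j) (i3 j), integral_const_mul, integral_const_mul,
        integral_heatFlow ht, fisher_eq_integral_negHess ht, hessSq]
      simp only [hJ]
      ring
    -- The bound c ≤ 1 uses an index i, available here; in dimension zero all sums are empty.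
    have hp := h.heatFlow hc (h.le_one hP i) hP.integrable_sq ht hφ1 hL hmean
    rw [hsq, hgrad] at hp
    rw [← sub_nonneg]
    have : ∑ j, hessSq P t i j + c / (1 + t) * J i - (1 + c) * ∑ j, J j ^ 2 =
        ((1 + t) * (∑ j, hessSq P t i j - ∑ j, J j ^ 2) -
          c * ((1 + t) * ∑ j, J j ^ 2 - J i)) / (1 + t) := by
      field_simp
      ring
    rw [this]
    exact div_nonneg (by linarith) ht1.le
  calc _ = ∑ i, (1 + c) * ∑ j, fisher P t i j ^ 2 := by rw [Finset.mul_sum]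
    _ ≤ ∑ i, (∑ j, hessSq P t i j + c / (1 + t) * fisher P t i i) :=
      Finset.sum_le_sum fun i _ => key i
    _ = _ := by rw [Finset.sum_add_distrib, ← Finset.mul_sum]

end FisherSq
end EntropyJump

/-! ### The self-convolution and its heat flow -/

namespace EntropyJump

section SelfConvolution

open Real InnerProductSpace Filter Topology

variable {d : ℕ}

local notation "𝔼" => EuclideanSpace ℝ (Fin d)

/-- The convolution of two functions. -/
noncomputable def funConv (F H : 𝔼 → ℝ) (z : 𝔼) : ℝ := ∫ y, F (z - y) * H y

/-- Continuous, bounded and integrable functions. -/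
structure IsBoundedIntegrable (F : 𝔼 → ℝ) : Prop where
  continuous : Continuous F
  integrable : Integrable F
  bounded : ∃ C, ∀ x, |F x| ≤ C

lemma IsBoundedIntegrable.integrable_mul {F H : 𝔼 → ℝ} (hF : IsBoundedIntegrable F)
    (hH : IsBoundedIntegrable H) (z : 𝔼) : Integrable fun y => F (z - y) * H y := by
  obtain ⟨C, hC⟩ := hF.bounded
  exact hH.integrable.bdd_mul (hF.continuous.comp (by fun_prop)).aestronglyMeasurable
    (Eventually.of_forall fun y => hC _)

lemma funConv_comm (F H : 𝔼 → ℝ) (z : 𝔼) : funConv F H z = funConv H F z := by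
  have := integral_sub_left_eq_self (fun y => F (z - y) * H y) (volume : Measure 𝔼) z
  rw [funConv, ← this, funConv]
  simp only [sub_sub_cancel, mul_comm]

lemma funConv_eq_convolution (F H : 𝔼 → ℝ) :
    funConv F H = convolution H F (ContinuousLinearMap.mul ℝ ℝ) volume := by
  funext z
  simp only [funConv, convolution_def, ContinuousLinearMap.mul_apply', mul_comm]

lemma IsBoundedIntegrable.integrable_funConv {F H : 𝔼 → ℝ} (hF : IsBoundedIntegrable F)
    (hH : IsBoundedIntegrable H) : Integrable (funConv F H) := by
  rw [funConv_eq_convolution]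
  exact hH.integrable.integrable_convolution _ hF.integrable

lemma IsBoundedIntegrable.integral_funConv {F H : 𝔼 → ℝ} (hF : IsBoundedIntegrable F)
    (hH : IsBoundedIntegrable H) : ∫ z, funConv F H z = (∫ x, F x) * ∫ x, H x := by
  rw [funConv_eq_convolution, integral_convolution _ hH.integrable hF.integrable,
    ContinuousLinearMap.mul_apply', mul_comm]

/-- The law of `(X + Y) / √2` for independent `X`, `Y` with law `P`. -/
noncomputable def selfConv (P : Measure 𝔼) : Measure 𝔼 :=
  (P.prod P).map fun p => (√2)⁻¹ • (p.1 + p.2)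

lemma measurable_selfConv : Measurable fun p : 𝔼 × 𝔼 => (√2)⁻¹ • (p.1 + p.2) := by fun_prop

lemma heatKernel_sub_inv_sqrt_two_smul {t : ℝ} (ht : 0 < t) (w v : 𝔼) :
    heatKernel t (w - (√2)⁻¹ • v) = √2 ^ d * heatKernel (2 * t) (√2 • w - v) := by
  have e : √2 ^ d = exp (d / 2 * log 2) := by
    rw [← rpow_natCast, sqrt_eq_rpow, ← rpow_mul zero_le_two, rpow_def_of_pos two_pos]
    congr 1; ring
  have e2 : √2 • w - v = √2 • (w - (√2)⁻¹ • v) := by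
    rw [smul_sub, smul_smul, mul_inv_cancel₀ (by positivity), one_smul]
  have e3 : log (2 * π * (2 * t)) = log 2 + log (2 * π * t) := by
    rw [← log_mul (by positivity) (by positivity)]; congr 1; ring
  rw [e, e2, heatKernel, heatKernel, ← exp_add, norm_smul, mul_pow, norm_of_nonneg (sqrt_nonneg 2),
    sq_sqrt zero_le_two, e3]
  congr 1
  field_simp
  ring

variable {P : Measure (EuclideanSpace ℝ (Fin d))} [IsProbabilityMeasure P] {t : ℝ}

instance isProbabilityMeasure_selfConv : IsProbabilityMeasure (selfConv P) :=
  Measure.isProbabilityMeasure_map measurable_selfConv.aemeasurable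

lemma isBoundedIntegrable_heatFlow (ht : 0 < t) : IsBoundedIntegrable (heatFlow P t) :=
  ⟨continuous_heatFlow ht, integrable_heatFlow ht, heatKernel t 0, fun x => by
    rw [abs_of_pos (heatFlow_pos ht x)]; exact heatFlow_le_heatKernel_zero ht x⟩

lemma abs_measConv_le_of_abs_le {q : 𝔼 → ℝ} {C : ℝ} (hC : ∀ z, |q z| ≤ C) (x : 𝔼) :
    |measConv P q x| ≤ C := by
  have h := norm_integral_le_of_norm_le (f := fun y => q (x - y)) (integrable_const (μ := P) C)
    (Eventually.of_forall fun y => hC (x - y))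
  simpa [measConv] using h

lemma isBoundedIntegrable_heatFlow₁ (ht : 0 < t) (i : Fin d) :
    IsBoundedIntegrable (heatFlow₁ P t (stdVec i)) := by
  obtain ⟨C, hC⟩ := exists_abs_heatKernel₁_le (d := d) ht
  exact ⟨(contDiff_heatFlow₁ ht (norm_stdVec i).le).continuous, integrable_heatFlow₁ ht i, C,
    abs_measConv_le_of_abs_le (hC _ (norm_stdVec i).le)⟩

lemma isBoundedIntegrable_heatFlow₂ (ht : 0 < t) (i j : Fin d) :
    IsBoundedIntegrable (heatFlow₂ P t (stdVec i) (stdVec j)) := by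
  obtain ⟨C, hC⟩ := exists_abs_heatKernel₂_le (d := d) ht
  exact ⟨(contDiff_heatFlow₂ ht (norm_stdVec i).le (norm_stdVec j).le).continuous,
    integrable_heatFlow₂ ht i j, C,
    abs_measConv_le_of_abs_le (hC _ _ (norm_stdVec i).le (norm_stdVec j).le)⟩

lemma isBoundedIntegrable_heatFlow_mul_negHess (ht : 0 < t) (hlc : MidLogConcave (heatFlow P t))
    (i j : Fin d) : IsBoundedIntegrable fun x => heatFlow P t x * negHess P t i j x :=
  ⟨(continuous_heatFlow ht).mul (continuous_negHess ht i j), integrable_heatFlow_mul_negHess ht i j,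
    heatKernel t 0 * (1 / t), fun x => by
      rw [abs_mul, abs_of_pos (heatFlow_pos ht x)]
      exact mul_le_mul (heatFlow_le_heatKernel_zero ht x)
        (abs_negHess_le_of_logConcave ht hlc i j x) (abs_nonneg _) (heatKernel_pos t _).le⟩

lemma isBoundedIntegrable_heatFlow_mul_negHess_sq (ht : 0 < t)
    (hlc : MidLogConcave (heatFlow P t)) (i j : Fin d) :
    IsBoundedIntegrable fun x => heatFlow P t x * negHess P t i j x ^ 2 :=
  ⟨(continuous_heatFlow ht).mul ((continuous_negHess ht i j).pow 2),
    integrable_heatFlow_mul_negHess_sq ht i j, heatKernel t 0 * (1 / t) ^ 2, fun x => by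
      rw [abs_mul, abs_of_pos (heatFlow_pos ht x), abs_pow]
      exact mul_le_mul (heatFlow_le_heatKernel_zero ht x)
        (pow_le_pow_left₀ (abs_nonneg _) (abs_negHess_le_of_logConcave ht hlc i j x) 2)
        (by positivity) (heatKernel_pos t _).le⟩

/-- The heat flow of the self-convolution is the self-convolution of the heat flow. -/
lemma heatFlow_selfConv (ht : 0 < t) (w : 𝔼) :
    heatFlow (selfConv P) t w = √2 ^ d * funConv (heatFlow P t) (heatFlow P t) (√2 • w) := by
  have hk := continuous_heatKernel (d := d) t
  have h1 : heatFlow (selfConv P) t w =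
      √2 ^ d * ∫ p, heatKernel (2 * t) (√2 • w - (p.1 + p.2)) ∂P.prod P := by
    rw [heatFlow, measConv, selfConv, integral_map measurable_selfConv.aemeasurable
      (Continuous.aestronglyMeasurable (by fun_prop)), ← integral_const_mul]
    simp only [heatKernel_sub_inv_sqrt_two_smul ht]
  -- The kernel at time 2t splits into two kernels at time t, one for each independent copy;
  -- swapping integrals then produces the convolution of the flow with itself.
  have hin : ∀ p : 𝔼 × 𝔼, ∫ y, heatKernel t (√2 • w - y - p.1) * heatKernel t (y - p.2) =
      heatKernel (2 * t) (√2 • w - (p.1 + p.2)) := fun p => by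
    rw [← integral_heatKernel_mul_heatKernel ht, ← integral_add_right_eq_self
      (fun y => heatKernel t (√2 • w - y - p.1) * heatKernel t (y - p.2)) p.2]
    refine integral_congr_ae (Eventually.of_forall fun y => ?_)
    simp only [add_sub_cancel_right]
    congr 2
    abel
  obtain ⟨C, hC⟩ := exists_abs_heatKernel_le (d := d) ht
  have hsw : Integrable (fun q : (𝔼 × 𝔼) × 𝔼 =>
      heatKernel t (√2 • w - q.2 - q.1.1) * heatKernel t (q.2 - q.1.2))
      ((P.prod P).prod volume) := by
    rw [integrable_prod_iff (Continuous.aestronglyMeasurable (by fun_prop))]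
    refine ⟨Eventually.of_forall fun p => ?_, ?_⟩
    · exact ((integrable_heatKernel ht).comp_sub_right p.2).bdd_mul
        (Continuous.aestronglyMeasurable (by fun_prop)) (Eventually.of_forall fun y => hC _)
    · have e : ∀ p : 𝔼 × 𝔼, ∫ y, ‖heatKernel t (√2 • w - y - p.1) * heatKernel t (y - p.2)‖ =
          heatKernel (2 * t) (√2 • w - (p.1 + p.2)) := fun p => by
        rw [← hin]
        refine integral_congr_ae (Eventually.of_forall fun y => ?_)
        exact norm_of_nonneg (mul_nonneg (heatKernel_pos t _).le (heatKernel_pos t _).le)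
      simp only [e]
      obtain ⟨C', hC'⟩ := exists_abs_heatKernel_le (d := d) (mul_pos two_pos ht)
      have hk2 := continuous_heatKernel (d := d) (2 * t)
      exact (integrable_const C').mono' (Continuous.aestronglyMeasurable (by fun_prop))
        (Eventually.of_forall fun p => hC' _)
  rw [h1]
  simp only [← hin]
  rw [integral_integral_swap (f := fun (p : 𝔼 × 𝔼) y =>
    heatKernel t (√2 • w - y - p.1) * heatKernel t (y - p.2)) hsw]
  congr 1
  refine integral_congr_ae (Eventually.of_forall fun y => ?_)
  exact integral_prod_mul (fun x => heatKernel t (√2 • w - y - x)) fun x => heatKernel t (y - x)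

/-- Taking the flow as a probability measure lets the derivative fall on the other factor through
the lemmas on convolutions with measures. -/
lemma funConv_eq_measConv (ht : 0 < t) (F : 𝔼 → ℝ) (z : 𝔼) :
    funConv F (heatFlow P t) z =
      measConv (volume.withDensity fun x => ENNReal.ofReal (heatFlow P t x)) F z := by
  rw [measConv, integral_withDensity_ofReal (continuous_heatFlow ht).aemeasurable
    fun x => (heatFlow_pos ht x).le]
  simp only [funConv, smul_eq_mul, mul_comm]

lemma isProbabilityMeasure_withDensity_heatFlow (ht : 0 < t) :
    IsProbabilityMeasure (volume.withDensity fun x => ENNReal.ofReal (heatFlow P t x)) := ⟨by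
  rw [withDensity_apply _ MeasurableSet.univ, Measure.restrict_univ,
    ← ofReal_integral_eq_lintegral_ofReal (integrable_heatFlow ht)
      (Eventually.of_forall fun x => (heatFlow_pos ht x).le), integral_heatFlow ht,
    ENNReal.ofReal_one]⟩

/-- Differentiation of a convolution with the heat flow, after a dilation. -/
lemma fderiv_funConv_sqrt_two_smul (ht : 0 < t) {F : 𝔼 → ℝ} (hF : ContDiff ℝ 1 F) {C L : ℝ}
    (hC : ∀ x, |F x| ≤ C) (hL : ∀ x, ‖fderiv ℝ F x‖ ≤ L) (a : ℝ) (w ξ : 𝔼) :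
    fderiv ℝ (fun w => a * funConv F (heatFlow P t) (√2 • w)) w ξ =
      a * √2 * funConv (fun z => fderiv ℝ F z ξ) (heatFlow P t) (√2 • w) := by
  have := isProbabilityMeasure_withDensity_heatFlow (P := P) ht
  set Q : Measure 𝔼 := volume.withDensity fun x => ENNReal.ofReal (heatFlow P t x)
  have hQ : ∀ z, Integrable (fun y => F (z - y)) Q := fun z =>
    integrable_comp_sub_of_bounded hF.continuous hC z
  have hd := (contDiff_measConv hF hL hQ).differentiable one_ne_zero (√2 • w)
  have h1 : HasFDerivAt (fun w : 𝔼 => √2 • w) (√2 • ContinuousLinearMap.id ℝ 𝔼) w :=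
    (hasFDerivAt_id w).const_smul (√2)
  have h2 := (hd.hasFDerivAt.comp w h1).const_mul a
  simp only [funConv_eq_measConv ht]
  have h3 : (fun w => a * measConv Q F (√2 • w)) =
    fun y => a * (measConv Q F ∘ fun w => √2 • w) y := rfl
  rw [h3, h2.fderiv, ← fderiv_measConv hF hL hQ]
  simp
  ring

lemma heatFlow₁_selfConv (ht : 0 < t) (i : Fin d) (w : 𝔼) :
    heatFlow₁ (selfConv P) t (stdVec i) w =
      √2 ^ d * √2 * funConv (heatFlow₁ P t (stdVec i)) (heatFlow P t) (√2 • w) := by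
  obtain ⟨C, hC⟩ := (isBoundedIntegrable_heatFlow (P := P) ht).bounded
  obtain ⟨L, hL⟩ := exists_abs_heatKernel₁_le (d := d) ht
  rw [← fderiv_heatFlow ht, funext (heatFlow_selfConv ht), fderiv_funConv_sqrt_two_smul ht
    (contDiff_heatFlow ht) hC (L := L)]
  · simp only [fderiv_heatFlow ht]
  · exact fun x => norm_le_of_forall_unit_abs_le fun ξ hξ => by
      rw [fderiv_heatFlow ht]; exact abs_measConv_le_of_abs_le (P := P) (hL ξ hξ) x

/-- Each derivative contributes √2 by the chain rule; both are placed on the first factor, and one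
is moved across later. -/
lemma heatFlow₂_selfConv (ht : 0 < t) (i j : Fin d) (w : 𝔼) :
    heatFlow₂ (selfConv P) t (stdVec i) (stdVec j) w =
      2 * √2 ^ d * funConv (heatFlow₂ P t (stdVec i) (stdVec j)) (heatFlow P t) (√2 • w) := by
  obtain ⟨C, hC⟩ := (isBoundedIntegrable_heatFlow₁ (P := P) ht i).bounded
  obtain ⟨L, hL⟩ := exists_abs_heatKernel₂_le (d := d) ht
  have hi := (norm_stdVec i).le
  rw [← fderiv_heatFlow₁ ht hi, funext (heatFlow₁_selfConv ht i),
    fderiv_funConv_sqrt_two_smul ht (contDiff_heatFlow₁ ht hi) hC (L := L)]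
  · simp only [fderiv_heatFlow₁ ht hi]
    rw [mul_assoc (√2 ^ d), mul_self_sqrt zero_le_two]
    ring
  · exact fun x => norm_le_of_forall_unit_abs_le fun ξ hξ => by
      rw [fderiv_heatFlow₁ ht hi]; exact abs_measConv_le_of_abs_le (P := P) (hL _ ξ hi hξ) x

/-- Moving a derivative from one factor of a convolution to the other. -/
lemma funConv_heatFlow₂ (ht : 0 < t) (i j : Fin d) (z : 𝔼) :
    funConv (heatFlow₂ P t (stdVec i) (stdVec j)) (heatFlow P t) z =
      funConv (heatFlow₁ P t (stdVec i)) (heatFlow₁ P t (stdVec j)) z := by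
  have i1 := (isBoundedIntegrable_heatFlow₂ (P := P) ht i j).integrable_mul
    (isBoundedIntegrable_heatFlow (P := P) ht) z
  have i2 := (isBoundedIntegrable_heatFlow₁ (P := P) ht i).integrable_mul
    (isBoundedIntegrable_heatFlow₁ (P := P) ht j) z
  have h : ∀ y, HasLineDerivAt ℝ (fun y => heatFlow₁ P t (stdVec i) (z - y) * heatFlow P t y)
      (-heatFlow₂ P t (stdVec i) (stdVec j) (z - y) * heatFlow P t y +
        heatFlow₁ P t (stdVec i) (z - y) * heatFlow₁ P t (stdVec j) y) y (stdVec j) := fun y => by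
    refine HasLineDerivAt.mul' ?_ (hasLineDerivAt_heatFlow ht y _)
    have h1 : HasFDerivAt (fun y : 𝔼 => z - y) (-ContinuousLinearMap.id ℝ 𝔼) y :=
      (hasFDerivAt_id y).const_sub z
    have h2 := (((contDiff_heatFlow₁ (P := P) ht (norm_stdVec i).le).differentiable one_ne_zero
      (z - y)).hasFDerivAt.comp y h1).hasLineDerivAt (stdVec j)
    have e : (fderiv ℝ (heatFlow₁ P t (stdVec i)) (z - y)).comp
        (-ContinuousLinearMap.id ℝ 𝔼) (stdVec j) =
        -heatFlow₂ P t (stdVec i) (stdVec j) (z - y) := by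
      simp [fderiv_heatFlow₁ ht (norm_stdVec i).le]
    rw [e] at h2
    exact h2
  have h0 := integral_lineDeriv_eq_zero h ((isBoundedIntegrable_heatFlow₁ ht i).integrable_mul
    (isBoundedIntegrable_heatFlow ht) z) (by simpa only [neg_mul] using! i1.neg.add i2)
  have i3 : Integrable fun y => -heatFlow₂ P t (stdVec i) (stdVec j) (z - y) *
      heatFlow P t y := by simpa only [neg_mul] using! i1.neg
  rw [integral_add i3 i2] at h0
  simp only [neg_mul, integral_neg] at h0
  simp only [funConv]
  linarith

/-- The flow of the self-convolution is a dilated convolution of the log-concave function u with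
itself, so Prékopa–Leindler applies. -/
lemma MidLogConcave.heatFlow_selfConv (ht : 0 < t) (hlc : MidLogConcave (heatFlow P t)) :
    MidLogConcave (heatFlow (selfConv P) t) := by
  have hu := isBoundedIntegrable_heatFlow (P := P) ht
  have h := hlc.conv hlc hu.continuous.measurable hu.continuous.measurable
    (fun x => (heatFlow_pos ht x).le) (fun x => (heatFlow_pos ht x).le) (hu.integrable_mul hu)
  intro x y
  have h1 := h (√2 • x) (√2 • y)
  have e : (2⁻¹ : ℝ) • (√2 • x + √2 • y) = √2 • (2⁻¹ : ℝ) • (x + y) := by module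
  rw [e] at h1
  simp only [EntropyJump.heatFlow_selfConv ht]
  have h2 : (0 : ℝ) ≤ √2 ^ d * √2 ^ d := by positivity
  have h3 := mul_le_mul_of_nonneg_left h1 h2
  simp only [funConv]
  linarith

/-- Variance identity for the Hessian of the self-convolution. -/
lemma funConv_mul_negHess_selfConv (ht : 0 < t) (i j : Fin d) (w : 𝔼) :
    funConv (heatFlow P t) (heatFlow P t) (√2 • w) * negHess (selfConv P) t i j w =
      2 * (funConv (heatFlow₁ P t (stdVec i)) (heatFlow P t) (√2 • w) *
        funConv (heatFlow₁ P t (stdVec j)) (heatFlow P t) (√2 • w) /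
        funConv (heatFlow P t) (heatFlow P t) (√2 • w)) -
      2 * funConv (heatFlow₁ P t (stdVec i)) (heatFlow₁ P t (stdVec j)) (√2 • w) := by
  have hpos := heatFlow_pos (P := selfConv P) ht w
  rw [heatFlow_selfConv ht] at hpos
  have hC : (0 : ℝ) < √2 ^ d := by positivity
  have hG := pos_of_mul_pos_right hpos hC.le
  have h2 : √2 * √2 = 2 := mul_self_sqrt zero_le_two
  rw [negHess, score, score, ratio₂, heatFlow_selfConv ht, heatFlow₁_selfConv ht,
    heatFlow₁_selfConv ht, heatFlow₂_selfConv ht, funConv_heatFlow₂ ht]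
  generalize funConv (heatFlow P t) (heatFlow P t) (√2 • w) = G at *
  field_simp
  linear_combination (funConv (heatFlow₁ P t (stdVec i)) (heatFlow P t) (√2 • w) *
    funConv (heatFlow₁ P t (stdVec j)) (heatFlow P t) (√2 • w)) * h2

end SelfConvolution
end EntropyJump

/-! ### Comparison of the dissipation of P and of its self-convolution -/

namespace EntropyJump

section HessianComparison

open Real InnerProductSpace Filter Topology

variable {d : ℕ}

local notation "𝔼" => EuclideanSpace ℝ (Fin d)

lemma IsBoundedIntegrable.add {F H : 𝔼 → ℝ} (hF : IsBoundedIntegrable F)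
    (hH : IsBoundedIntegrable H) : IsBoundedIntegrable fun x => F x + H x := by
  obtain ⟨C, hC⟩ := hF.bounded
  obtain ⟨D, hD⟩ := hH.bounded
  exact ⟨hF.continuous.add hH.continuous, hF.integrable.add hH.integrable, C + D,
    fun x => (abs_add_le _ _).trans (add_le_add (hC x) (hD x))⟩

lemma funConv_add_left {F F' H : 𝔼 → ℝ} (hF : IsBoundedIntegrable F)
    (hF' : IsBoundedIntegrable F') (hH : IsBoundedIntegrable H) (z : 𝔼) :
    funConv (fun x => F x + F' x) H z = funConv F H z + funConv F' H z := by
  simp only [funConv, add_mul]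
  exact integral_add (hF.integrable_mul hH z) (hF'.integrable_mul hH z)

/-- `f` is integrable with integral `a`. -/
def HasIntegralValue (f : 𝔼 → ℝ) (a : ℝ) : Prop := Integrable f ∧ ∫ x, f x = a

lemma HasIntegralValue.add {f g : 𝔼 → ℝ} {a b : ℝ} (hf : HasIntegralValue f a)
    (hg : HasIntegralValue g b) : HasIntegralValue (fun x => f x + g x) (a + b) :=
  ⟨hf.1.add hg.1, by rw [integral_add hf.1 hg.1, hf.2, hg.2]⟩

lemma HasIntegralValue.const_mul {f : 𝔼 → ℝ} {a : ℝ} (hf : HasIntegralValue f a) (c : ℝ) :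
    HasIntegralValue (fun x => c * f x) (c * a) :=
  ⟨hf.1.const_mul c, by rw [integral_const_mul, hf.2]⟩

lemma HasIntegralValue.sum {ι : Type*} (s : Finset ι) {f : ι → 𝔼 → ℝ} {a : ι → ℝ}
    (hf : ∀ i, HasIntegralValue (f i) (a i)) :
    HasIntegralValue (fun x => ∑ i ∈ s, f i x) (∑ i ∈ s, a i) :=
  ⟨integrable_finsetSum _ fun i _ => (hf i).1, by
    rw [integral_finsetSum _ fun i _ => (hf i).1]
    exact Finset.sum_congr rfl fun i _ => (hf i).2⟩

lemma HasIntegralValue.nonneg {f : 𝔼 → ℝ} {a : ℝ} (hf : HasIntegralValue f a)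
    (h0 : ∀ x, 0 ≤ f x) : 0 ≤ a := hf.2 ▸ integral_nonneg h0

lemma HasIntegralValue.congr' {f g : 𝔼 → ℝ} {a b : ℝ} (hf : HasIntegralValue f a)
    (h : ∀ x, g x = f x) (hab : b = a) : HasIntegralValue g b := by
  rw [funext h, hab]; exact hf

lemma IsBoundedIntegrable.hasIntegralValue {F H : 𝔼 → ℝ} (hF : IsBoundedIntegrable F)
    (hH : IsBoundedIntegrable H) (z : 𝔼) :
    HasIntegralValue (fun y => F (z - y) * H y) (funConv F H z) := ⟨hF.integrable_mul hH z, rfl⟩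

variable {P : Measure (EuclideanSpace ℝ (Fin d))} [IsProbabilityMeasure P] {t : ℝ}

/-- Covariance of the sum of scores under the conditional density. -/
lemma hasIntegralValue_score_cov (ht : 0 < t) (hlc : MidLogConcave (heatFlow P t)) (i j : Fin d)
    (w : 𝔼) :
    HasIntegralValue (fun y => heatFlow P t (√2 • w - y) * heatFlow P t y *
      ((score P t i (√2 • w - y) + score P t i y -
        2 * (funConv (heatFlow₁ P t (stdVec i)) (heatFlow P t) (√2 • w) /
          funConv (heatFlow P t) (heatFlow P t) (√2 • w))) *
      (score P t j (√2 • w - y) + score P t j y -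
        2 * (funConv (heatFlow₁ P t (stdVec j)) (heatFlow P t) (√2 • w) /
          funConv (heatFlow P t) (heatFlow P t) (√2 • w)))))
      (2 * funConv (fun x => heatFlow P t x * negHess P t i j x) (heatFlow P t) (√2 • w) -
        2 * (funConv (heatFlow P t) (heatFlow P t) (√2 • w) * negHess (selfConv P) t i j w)) := by
  set z := √2 • w
  have hu := isBoundedIntegrable_heatFlow (P := P) ht
  have hi := isBoundedIntegrable_heatFlow₁ (P := P) ht i
  have hj := isBoundedIntegrable_heatFlow₁ (P := P) ht j
  have hij := isBoundedIntegrable_heatFlow₂ (P := P) ht i j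
  have hA := isBoundedIntegrable_heatFlow_mul_negHess (P := P) ht hlc i j
  have hW : IsBoundedIntegrable fun x => heatFlow P t x * (score P t i x * score P t j x) := by
    have := hA.add hij
    simp only [heatFlow_mul_negHess ht, sub_add_cancel] at this
    exact this
  -- Score products are u H plus second derivatives of u; one of the latter's derivatives moves to
  -- the other factor.
  have eW : funConv (fun x => heatFlow P t x * (score P t i x * score P t j x))
      (heatFlow P t) z = funConv (fun x => heatFlow P t x * negHess P t i j x) (heatFlow P t) z +
        funConv (heatFlow₁ P t (stdVec i)) (heatFlow₁ P t (stdVec j)) z := by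
    rw [← funConv_heatFlow₂ ht, ← funConv_add_left hA hij hu]
    simp only [heatFlow_mul_negHess ht, sub_add_cancel]
  have hG : 0 < funConv (heatFlow P t) (heatFlow P t) z := by
    have hpos := heatFlow_pos (P := selfConv P) ht w
    rw [heatFlow_selfConv ht] at hpos
    exact pos_of_mul_pos_right hpos (by positivity)
  rw [funConv_mul_negHess_selfConv ht]
  set G := funConv (heatFlow P t) (heatFlow P t) z with hGd
  set Ui := funConv (heatFlow₁ P t (stdVec i)) (heatFlow P t) z with hUi
  set Uj := funConv (heatFlow₁ P t (stdVec j)) (heatFlow P t) z with hUj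
  set V := funConv (heatFlow₁ P t (stdVec i)) (heatFlow₁ P t (stdVec j)) z with hV
  have h1 := hW.hasIntegralValue hu z
  have h2 := hu.hasIntegralValue hW z
  have h3 := hi.hasIntegralValue hj z
  have h4 := hj.hasIntegralValue hi z
  have h5 := hi.hasIntegralValue hu z
  have h6 := hu.hasIntegralValue hi z
  have h7 := hj.hasIntegralValue hu z
  have h8 := hu.hasIntegralValue hj z
  have h9 := hu.hasIntegralValue hu z
  rw [funConv_comm] at h2 h4 h6 h8
  rw [eW] at h1 h2
  -- The weight u(z - y) u(y) has total mass G and gives the sum of scores the mean 2 Uᵢ/G.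
  -- Expanding the centred product leaves only convolutions already evaluated; symmetric pairs agree
  -- by commutativity.
  refine ((h1.add h2).add (((h3.add h4).add (((h5.add h6).const_mul (-(2 * (Uj / G)))).add
    ((h7.add h8).const_mul (-(2 * (Ui / G)))))).add
      (h9.const_mul (4 * (Ui / G * (Uj / G)))))).congr' (fun y => ?_) ?_
  · simp only [← heatFlow_mul_score ht]
    ring
  · rw [← hUi, ← hUj, ← hV, ← hGd]
    field_simp
    ring

/-- The integrated squared deviation of the averaged Hessians from a constant. -/
lemma hasIntegralValue_negHess_sub_sq (ht : 0 < t) (hlc : MidLogConcave (heatFlow P t))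
    (i j : Fin d) (z : 𝔼) (a : ℝ) :
    HasIntegralValue (fun y => heatFlow P t (z - y) * heatFlow P t y *
      ((negHess P t i j (z - y) + negHess P t i j y) / 2 - a) ^ 2)
      (funConv (heatFlow P t) (heatFlow P t) z * a ^ 2 -
        2 * a * funConv (fun x => heatFlow P t x * negHess P t i j x) (heatFlow P t) z +
        1 / 2 * (funConv (fun x => heatFlow P t x * negHess P t i j x ^ 2) (heatFlow P t) z +
          funConv (fun x => heatFlow P t x * negHess P t i j x)
            (fun x => heatFlow P t x * negHess P t i j x) z)) := by
  have hu := isBoundedIntegrable_heatFlow (P := P) ht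
  have hA := isBoundedIntegrable_heatFlow_mul_negHess (P := P) ht hlc i j
  have hA2 := isBoundedIntegrable_heatFlow_mul_negHess_sq (P := P) ht hlc i j
  have h1 := hA2.hasIntegralValue hu z
  have h2 := hu.hasIntegralValue hA2 z
  have h3 := hA.hasIntegralValue hu z
  have h4 := hu.hasIntegralValue hA z
  have h5 := hA.hasIntegralValue hA z
  have h6 := hu.hasIntegralValue hu z
  rw [funConv_comm] at h2 h4
  refine ((((h1.add h2).add (h5.const_mul 2)).const_mul (1 / 4)).add
    (((h3.add h4).const_mul (-a)).add (h6.const_mul (a ^ 2)))).congr' (fun y => ?_) ?_ <;> ring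

/-- Pointwise comparison of the Hessian of the self-convolution. -/
lemma funConv_mul_sum_negHess_selfConv_sq_le (ht : 0 < t) (hlc : MidLogConcave (heatFlow P t))
    (w : 𝔼) : funConv (heatFlow P t) (heatFlow P t) (√2 • w) *
        ∑ i, ∑ j, negHess (selfConv P) t i j w ^ 2 ≤
      1 / 2 * ∑ i, ∑ j,
        (funConv (fun x => heatFlow P t x * negHess P t i j x ^ 2) (heatFlow P t) (√2 • w) +
          funConv (fun x => heatFlow P t x * negHess P t i j x)
            (fun x => heatFlow P t x * negHess P t i j x) (√2 • w)) := by
  have hpsd := negHess_posSemidef ht (hlc.heatFlow_selfConv ht) w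
  -- The matrix H₂ is positive semidefinite, so its pairing with the score covariance is
  -- nonnegative: the quadratic form is applied to the centred sum of scores for each y.
  have h1 := HasIntegralValue.nonneg (HasIntegralValue.sum Finset.univ fun i =>
    HasIntegralValue.sum Finset.univ fun j =>
      (hasIntegralValue_score_cov ht hlc i j w).const_mul (negHess (selfConv P) t i j w))
    fun y => by
      have h2 := hpsd (WithLp.toLp 2 fun i => score P t i (√2 • w - y) + score P t i y -
        2 * (funConv (heatFlow₁ P t (stdVec i)) (heatFlow P t) (√2 • w) /
          funConv (heatFlow P t) (heatFlow P t) (√2 • w)))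
      have h3 := mul_nonneg (mul_nonneg (heatFlow_pos (P := P) ht (√2 • w - y)).le
        (heatFlow_pos (P := P) ht y).le) h2
      rw [Finset.mul_sum] at h3
      refine h3.trans_eq (Finset.sum_congr rfl fun i _ => ?_)
      rw [Finset.mul_sum]
      exact Finset.sum_congr rfl fun j _ => by ring
  -- Nonnegativity of the squared distance between averaged Hessian and H₂. Added to the previous
  -- inequality, the terms mixing H and H₂ cancel exactly.
  have h2 := HasIntegralValue.nonneg (HasIntegralValue.sum Finset.univ fun i =>
    HasIntegralValue.sum Finset.univ fun j =>
      hasIntegralValue_negHess_sub_sq ht hlc i j (√2 • w) (negHess (selfConv P) t i j w))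
    fun y => Finset.sum_nonneg fun i _ => Finset.sum_nonneg fun j _ =>
      mul_nonneg (mul_nonneg (heatFlow_pos ht _).le (heatFlow_pos ht _).le) (sq_nonneg _)
  rw [Finset.mul_sum, Finset.mul_sum]
  simp only [Finset.mul_sum]
  rw [← sub_nonneg]
  refine (add_nonneg h1 h2).trans_eq ?_
  rw [← Finset.sum_add_distrib, ← Finset.sum_sub_distrib]
  refine Finset.sum_congr rfl fun i _ => ?_
  rw [← Finset.sum_add_distrib, ← Finset.sum_sub_distrib]
  exact Finset.sum_congr rfl fun j _ => by ring

/-- Comparison of the entropy dissipation rates of `P` and its self-convolution. -/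
theorem sum_hessSq_selfConv_le (ht : 0 < t) (hlc : MidLogConcave (heatFlow P t)) :
    ∑ i, ∑ j, hessSq (selfConv P) t i j ≤
      1 / 2 * (∑ i, ∑ j, hessSq P t i j + ∑ i, ∑ j, fisher P t i j ^ 2) := by
  have hu := isBoundedIntegrable_heatFlow (P := P) ht
  have hA := isBoundedIntegrable_heatFlow_mul_negHess (P := P) ht hlc
  have hA2 := isBoundedIntegrable_heatFlow_mul_negHess_sq (P := P) ht hlc
  set Φ : 𝔼 → ℝ := fun z => ∑ i, ∑ j,
    (funConv (fun x => heatFlow P t x * negHess P t i j x ^ 2) (heatFlow P t) z +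
      funConv (fun x => heatFlow P t x * negHess P t i j x)
        (fun x => heatFlow P t x * negHess P t i j x) z) with hΦ
  have hΦi : HasIntegralValue Φ (∑ i, ∑ j, (hessSq P t i j + fisher P t i j ^ 2)) :=
    HasIntegralValue.sum _ fun i => HasIntegralValue.sum _ fun j =>
      HasIntegralValue.add (a := hessSq P t i j) (b := fisher P t i j ^ 2)
        ⟨(hA2 i j).integrable_funConv hu, by
          rw [(hA2 i j).integral_funConv hu, integral_heatFlow ht, mul_one, hessSq]⟩
        ⟨(hA i j).integrable_funConv (hA i j), by
          rw [(hA i j).integral_funConv (hA i j), fisher_eq_integral_negHess ht, sq]⟩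
  -- The Jacobian of the dilation cancels the prefactor √2 ^ d of the self-convolution. In the
  -- integral of Φ the two convolutions become Kᵢⱼ and Iᵢⱼ².
  have hs : ∫ w, Φ (√2 • w) = (√2 ^ d)⁻¹ * ∫ z, Φ z := by
    rw [Measure.integral_comp_smul, finrank_euclideanSpace, Fintype.card_fin,
      abs_of_pos (by positivity), smul_eq_mul]
  have hsi : Integrable fun w => Φ (√2 • w) := hΦi.1.comp_smul (by positivity)
  have hl : HasIntegralValue (fun w => ∑ i, ∑ j,
      heatFlow (selfConv P) t w * negHess (selfConv P) t i j w ^ 2)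
      (∑ i, ∑ j, hessSq (selfConv P) t i j) :=
    HasIntegralValue.sum _ fun i => HasIntegralValue.sum _ fun j =>
      ⟨integrable_heatFlow_mul_negHess_sq ht i j, rfl⟩
  rw [← hl.2]
  calc _ ≤ ∫ w, √2 ^ d * (1 / 2) * Φ (√2 • w) := by
        refine integral_mono hl.1 (hsi.const_mul _) fun w => ?_
        simp only [← Finset.mul_sum]
        rw [heatFlow_selfConv ht, mul_assoc, mul_assoc]
        exact mul_le_mul_of_nonneg_left (funConv_mul_sum_negHess_selfConv_sq_le ht hlc w)
          (by positivity)
    _ = _ := by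
        rw [integral_const_mul, hs, hΦi.2]
        simp only [Finset.sum_add_distrib]
        field_simp

end HessianComparison
end EntropyJump

/-! ### Entropy bounds, Jensen's inequality and behaviour at time zero -/

namespace EntropyJump

section EntropyBounds

open Real InnerProductSpace Filter Topology

variable {d : ℕ}

local notation "𝔼" => EuclideanSpace ℝ (Fin d)

/-- The entropy of a centered Gaussian vector with covariance `s • 1` in dimension `d`. -/
noncomputable def gaussEntropy (d : ℕ) (s : ℝ) : ℝ := d / 2 + d / 2 * log (2 * π * s)

lemma gaussEntropy_mono (d : ℕ) {s t : ℝ} (hs : 0 < s) (hst : s ≤ t) :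
    gaussEntropy d s ≤ gaussEntropy d t := by
  rw [gaussEntropy, gaussEntropy]
  gcongr

/-- The pointwise Gibbs inequality, from log r ≤ r - 1. It includes s = 0, where s * log s = 0, so
no positivity of densities is needed. -/
lemma sub_le_mul_log_sub {s g : ℝ} (hs : 0 ≤ s) (hg : 0 < g) :
    s - g ≤ s * log s - s * log g := by
  rcases hs.eq_or_lt with rfl | hs
  · simp [hg.le]
  · have h := log_le_sub_one_of_pos (div_pos hg hs)
    rw [log_div hg.ne' hs.ne'] at h
    have h2 := mul_le_mul_of_nonneg_left h hs.le
    rw [mul_sub, mul_sub, mul_div_cancel₀ _ hs.ne'] at h2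
    linarith

lemma abs_mul_log_le {s M : ℝ} (hs : 0 ≤ s) (hM : s ≤ M) : |s * log s| ≤ 1 + M ^ 2 := by
  have h1 := sub_le_mul_log_sub hs one_pos
  rw [log_one, mul_zero, sub_zero] at h1
  have h2 : s * log s ≤ s * s := by
    rcases hs.eq_or_lt with rfl | hs'
    · simp
    · exact mul_le_mul_of_nonneg_left ((log_le_sub_one_of_pos hs').trans (by linarith)) hs
  rw [abs_le]
  constructor <;> nlinarith

lemma measurable_mul_log {q : 𝔼 → ℝ} (hq : Measurable q) : Measurable fun x => q x * log (q x) :=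
  hq.mul (measurable_log.comp hq)

lemma integral_norm_sq_eq_sum {μ : Measure 𝔼} (h : ∀ i, Integrable (fun x : 𝔼 => x i * x i) μ) :
    ∫ x, ‖x‖ ^ 2 ∂μ = ∑ i, ∫ x : 𝔼, x i * x i ∂μ := by
  rw [← integral_finsetSum _ fun i _ => h i]
  refine integral_congr_ae (Eventually.of_forall fun x => ?_)
  simp only [EuclideanSpace.real_norm_sq_eq]
  simp only [sq]

lemma integral_norm_sq_mul_heatKernel {t : ℝ} (ht : 0 < t) :
    ∫ z : 𝔼, ‖z‖ ^ 2 * heatKernel t z = d * t := by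
  have hi : ∀ i : Fin d, Integrable fun z : 𝔼 => z i * z i * heatKernel t z := fun i => by
    have hk := continuous_heatKernel (d := d) t
    refine integrable_of_abs_le_pow_mul_heatKernel (m := 2) (C := 1) (by fun_prop) ht fun z => ?_
    rw [abs_mul, abs_mul, abs_of_pos (heatKernel_pos t z), one_mul]
    have h1 := abs_coord_le_norm z i
    refine mul_le_mul_of_nonneg_right ?_ (heatKernel_pos t z).le
    nlinarith [abs_nonneg (z i), norm_nonneg z]
  have e : ∀ z : 𝔼, ‖z‖ ^ 2 * heatKernel t z = ∑ i, z i * z i * heatKernel t z := fun z => by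
    rw [EuclideanSpace.real_norm_sq_eq, Finset.sum_mul]
    simp only [sq]
  simp_rw [e]
  rw [integral_finsetSum _ fun i _ => hi i]
  simp [integral_coord_mul_coord_mul_heatKernel ht]

lemma integral_mul_log_heatKernel {s : ℝ} {q : 𝔼 → ℝ} (hq : Integrable q)
    (hq2 : Integrable fun x => ‖x‖ ^ 2 * q x) :
    Integrable (fun x => q x * log (heatKernel s x)) ∧ ∫ x, q x * log (heatKernel s x) =
      -(2 * s)⁻¹ * (∫ x, ‖x‖ ^ 2 * q x) - d / 2 * log (2 * π * s) * ∫ x, q x := by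
  have e : ∀ x, q x * log (heatKernel s x) =
      -(2 * s)⁻¹ * (‖x‖ ^ 2 * q x) - d / 2 * log (2 * π * s) * q x := fun x => by
    rw [log_heatKernel]; ring
  simp_rw [e]
  refine ⟨(hq2.const_mul _).sub (hq.const_mul _), ?_⟩
  rw [integral_sub (hq2.const_mul _) (hq.const_mul _), integral_const_mul, integral_const_mul]

lemma integrable_norm_sq_mul_heatKernel {t : ℝ} (ht : 0 < t) :
    Integrable fun z : 𝔼 => ‖z‖ ^ 2 * heatKernel t z := by
  have hk := continuous_heatKernel (d := d) t
  refine integrable_of_abs_le_pow_mul_heatKernel (m := 2) (C := 1) (by fun_prop) ht fun z => ?_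
  rw [abs_mul, abs_of_pos (heatKernel_pos t z), one_mul, abs_of_nonneg (sq_nonneg _)]
  refine mul_le_mul_of_nonneg_right ?_ (heatKernel_pos t z).le
  nlinarith [norm_nonneg z]

lemma integral_heatKernel_mul_log {t : ℝ} (ht : 0 < t) :
    Integrable (fun z : 𝔼 => heatKernel t z * log (heatKernel t z)) ∧
      ∫ z : 𝔼, heatKernel t z * log (heatKernel t z) = -gaussEntropy d t := by
  have h := integral_mul_log_heatKernel (s := t) (integrable_heatKernel (d := d) ht)
    (integrable_norm_sq_mul_heatKernel ht)
  refine ⟨h.1, ?_⟩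
  rw [h.2, integral_norm_sq_mul_heatKernel ht, integral_heatKernel ht, gaussEntropy]
  field_simp
  ring

/-- `q` is a bounded probability density of `P`. -/
structure IsBoundedDensity (P : Measure 𝔼) (q : 𝔼 → ℝ) : Prop where
  measurable : Measurable q
  nonneg : ∀ x, 0 ≤ q x
  bounded : ∃ M, ∀ x, q x ≤ M
  eq : P = volume.withDensity fun x => ENNReal.ofReal (q x)

lemma IsBoundedDensity.integrable_iff {P : Measure 𝔼} {q : 𝔼 → ℝ} (h : IsBoundedDensity P q)
    {g : 𝔼 → ℝ} : Integrable g P ↔ Integrable fun x => q x * g x := by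
  rw [h.eq]; exact integrable_withDensity_ofReal_iff h.measurable.aemeasurable h.nonneg

lemma IsBoundedDensity.integral_eq {P : Measure 𝔼} {q : 𝔼 → ℝ} (h : IsBoundedDensity P q)
    (g : 𝔼 → ℝ) : ∫ x, g x ∂P = ∫ x, q x * g x := by
  rw [h.eq]; exact integral_withDensity_ofReal h.measurable.aemeasurable h.nonneg g

lemma IsBoundedDensity.integrable_norm_sq_mul {P : Measure 𝔼} {q : 𝔼 → ℝ}
    (h : IsBoundedDensity P q)
    (hP : Integrable (fun x : 𝔼 => ‖x‖ ^ 2) P) : Integrable fun x => ‖x‖ ^ 2 * q x := by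
  simpa only [mul_comm] using h.integrable_iff.1 hP

/-- Exchanges the roles of the factors: the density is averaged against the Gaussian instead of the
Gaussian against P. -/
lemma IsBoundedDensity.heatFlow_eq {P : Measure 𝔼} {q : 𝔼 → ℝ} {t : ℝ}
    (h : IsBoundedDensity P q) (x : 𝔼) :
    heatFlow P t x = ∫ z, q (x - z) * heatKernel t z := by
  have h1 : heatFlow P t x = funConv (heatKernel t) q x := by
    rw [heatFlow, measConv, h.integral_eq, funConv]
    simp only [mul_comm]
  rw [h1, funConv_comm, funConv]

/-- The flow is a Gaussian average of q at scale √t; boundedness and continuity of q give the limit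
by dominated convergence. -/
lemma IsBoundedDensity.tendsto_heatFlow {P : Measure 𝔼} {q : 𝔼 → ℝ}
    (h : IsBoundedDensity P q) (hq : Continuous q) (x : 𝔼) :
    Tendsto (fun n : ℕ => heatFlow P (1 / ((n : ℝ) + 1)) x) atTop (𝓝 (q x)) := by
  obtain ⟨M, hM⟩ := h.bounded
  have h1 : ∀ n : ℕ, heatFlow P (1 / ((n : ℝ) + 1)) x =
      ∫ z, q (x - √(1 / ((n : ℝ) + 1)) • z) ∂stdGaussian 𝔼 := fun n => by
    rw [h.heatFlow_eq, integral_mul_heatKernel (by positivity) fun z => q (x - z)]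
  simp only [h1]
  have h2 : q x = ∫ z, q x ∂stdGaussian 𝔼 := by simp
  rw [h2]
  have hs : Tendsto (fun n : ℕ => √(1 / ((n : ℝ) + 1))) atTop (𝓝 0) := by
    have := (continuous_sqrt.tendsto 0).comp (tendsto_one_div_add_atTop_nhds_zero_nat (𝕜 := ℝ))
    simpa [Function.comp_def] using this
  refine tendsto_integral_of_dominated_convergence (fun _ => M)
    (fun n => (hq.comp (by fun_prop)).aestronglyMeasurable) (integrable_const M)
    (fun n => Eventually.of_forall fun z => ?_) (Eventually.of_forall fun z => ?_)
  · rw [norm_of_nonneg (h.nonneg _)]; exact hM _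
  · have h3 : Tendsto (fun n : ℕ => x - √(1 / ((n : ℝ) + 1)) • z) atTop (𝓝 (x - (0 : ℝ) • z)) :=
      tendsto_const_nhds.sub (hs.smul_const z)
    rw [zero_smul, sub_zero] at h3
    exact (hq.tendsto x).comp h3

lemma isBoundedDensity_stdGaussian : IsBoundedDensity (stdGaussian 𝔼) (heatKernel 1) :=
  ⟨(continuous_heatKernel 1).measurable, fun x => (heatKernel_pos 1 x).le,
    ⟨_, heatKernel_le 1 one_pos⟩, stdGaussian_eq_withDensity⟩

/-- Jensen's inequality: convolution with a probability measure does not decrease the entropy. -/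
lemma integral_measConv_mul_log_le {Q : Measure 𝔼} [IsProbabilityMeasure Q] {k : 𝔼 → ℝ}
    (hk : Measurable k) (hk0 : ∀ x, 0 ≤ k x) {M : ℝ} (hM : ∀ x, k x ≤ M)
    (hkl : Integrable fun x => k x * log (k x)) (hpos : ∀ x, 0 < measConv Q k x)
    (hul : Integrable fun x => measConv Q k x * log (measConv Q k x)) :
    ∫ x, measConv Q k x * log (measConv Q k x) ≤ ∫ x, k x * log (k x) := by
  rw [← integral_measConv (P := Q) hkl]
  refine integral_mono hul (integrable_measConv hkl) fun x => ?_
  set u := measConv Q k x with hu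
  have hsub : Measurable fun y : 𝔼 => x - y := by fun_prop
  have i1 : Integrable (fun y => k (x - y)) Q :=
    (integrable_const M).mono' (hk.comp hsub).aestronglyMeasurable
      (Eventually.of_forall fun y => by rw [norm_of_nonneg (hk0 _)]; exact hM _)
  have i2 : Integrable (fun y => k (x - y) * log (k (x - y))) Q :=
    (integrable_const (1 + M ^ 2)).mono' ((measurable_mul_log hk).comp hsub).aestronglyMeasurable
      (Eventually.of_forall fun y => abs_mul_log_le (hk0 _) (hM _))
  -- Gibbs at the mean u: the left side integrates to zero, which is Jensen's inequality for s log
  -- s.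
  have h1 : ∫ y, (k (x - y) - u) ∂Q ≤ ∫ y, (k (x - y) * log (k (x - y)) - k (x - y) * log u) ∂Q :=
    integral_mono (i1.sub (integrable_const u)) (i2.sub (i1.mul_const _))
      fun y => sub_le_mul_log_sub (hk0 _) (hpos x)
  rw [integral_sub i1 (integrable_const u), integral_sub i2 (i1.mul_const _),
    integral_mul_const] at h1
  have h2 : ∫ y, k (x - y) ∂Q = u := rfl
  rw [h2, integral_const, probReal_univ, one_smul, sub_self] at h1
  have h3 : measConv Q (fun x => k x * log (k x)) x = ∫ y, k (x - y) * log (k (x - y)) ∂Q := rfl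
  simp only [h3]
  linarith

variable {P : Measure (EuclideanSpace ℝ (Fin d))} [IsProbabilityMeasure P] {t : ℝ}

lemma integral_norm_sq_mul_heatFlow (hP : IsIsotropicMeasure P) (ht : 0 < t) :
    Integrable (fun x => ‖x‖ ^ 2 * heatFlow P t x) ∧
      ∫ x, ‖x‖ ^ 2 * heatFlow P t x = d * (1 + t) := by
  have hi := fun i : Fin d => integrable_coord_mul_coord_mul_heatFlow hP.integrable_sq ht i i
  have e : ∀ z : 𝔼, ‖z‖ ^ 2 * heatFlow P t z = ∑ i, z i * z i * heatFlow P t z := fun z => by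
    rw [EuclideanSpace.real_norm_sq_eq, Finset.sum_mul]
    simp only [sq]
  simp_rw [e]
  refine ⟨integrable_finsetSum _ fun i _ => hi i, ?_⟩
  rw [integral_finsetSum _ fun i _ => hi i]
  simp [integral_coord_mul_coord_mul_heatFlow hP ht, mul_add]

/-- Jensen with the Gaussian as the function and P as the averaging measure. With the matching upper
bound it controls the flow as t → ∞. -/
lemma gaussEntropy_le_flowEntropy (hP : Integrable (fun x : 𝔼 => ‖x‖ ^ 2) P) (ht : 0 < t) :
    gaussEntropy d t ≤ flowEntropy P t := by
  have h := integral_measConv_mul_log_le (Q := P) (k := heatKernel t)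
    (continuous_heatKernel t).measurable (fun x => (heatKernel_pos t x).le) (heatKernel_le t ht)
    (integral_heatKernel_mul_log ht).1 (heatFlow_pos ht) (integrable_heatFlow_mul_log hP ht)
  rw [(integral_heatKernel_mul_log ht).2] at h
  rw [flowEntropy]
  exact le_neg_of_le_neg h

/-- Gaussians maximise entropy: integrate Gibbs against the Gaussian of variance 1 + t, which has
the same second moment as the flow. -/
lemma flowEntropy_le_gaussEntropy (hP : IsIsotropicMeasure P) (ht : 0 < t) :
    flowEntropy P t ≤ gaussEntropy d (1 + t) := by
  have ht1 : 0 < 1 + t := by linarith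
  have hu := integrable_heatFlow (P := P) ht
  have h2 := integral_norm_sq_mul_heatFlow hP ht
  have hl := integral_mul_log_heatKernel (s := 1 + t) hu h2.1
  have hul := integrable_heatFlow_mul_log hP.integrable_sq ht
  have h := integral_mono (hu.sub (integrable_heatKernel (d := d) ht1)) (hul.sub hl.1)
    fun x => sub_le_mul_log_sub (heatFlow_pos (P := P) ht x).le (heatKernel_pos (1 + t) x)
  simp only [Pi.sub_apply] at h
  rw [integral_sub hu (integrable_heatKernel ht1), integral_sub hul hl.1, hl.2, h2.2,
    integral_heatFlow ht, integral_heatKernel ht1] at h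
  rw [flowEntropy, gaussEntropy]
  have e : -(2 * (1 + t))⁻¹ * (d * (1 + t)) = -((d : ℝ) / 2) := by field_simp
  rw [e] at h
  linarith

section Density

variable {q : EuclideanSpace ℝ (Fin d) → ℝ}

lemma IsBoundedDensity.integrable (h : IsBoundedDensity P q) : Integrable q := by
  simpa using h.integrable_iff.1 (integrable_const (1 : ℝ))

lemma IsBoundedDensity.integral_eq_one (h : IsBoundedDensity P q) : ∫ x, q x = 1 := by
  simpa using (h.integral_eq fun _ => 1).symm

/-- A bounded density with finite second moment has finite entropy. -/
lemma IsBoundedDensity.integrable_mul_log (h : IsBoundedDensity P q)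
    (hP : Integrable (fun x : 𝔼 => ‖x‖ ^ 2) P) : Integrable fun x => q x * log (q x) := by
  obtain ⟨M, hM⟩ := h.bounded
  have hl := integral_mul_log_heatKernel (s := 1) h.integrable (h.integrable_norm_sq_mul hP)
  refine (((hl.1.abs.add h.integrable).add (integrable_heatKernel (d := d) one_pos)).add
    (h.integrable.const_mul |M|)).mono' (measurable_mul_log h.measurable).aestronglyMeasurable
    (Eventually.of_forall fun x => ?_)
  have h1 := sub_le_mul_log_sub (h.nonneg x) (heatKernel_pos 1 x)
  have h2 : q x * log (q x) ≤ |M| * q x := by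
    rcases (h.nonneg x).eq_or_lt with h0 | h0
    · simp [← h0]
    · rw [mul_comm]
      refine mul_le_mul_of_nonneg_right ?_ h0.le
      have := log_le_sub_one_of_pos h0
      linarith [hM x, le_abs_self M]
  simp only [Pi.add_apply]
  have h3 := neg_abs_le (q x * log (heatKernel 1 x))
  have h4 := abs_nonneg (q x * log (heatKernel 1 x))
  have h5 := heatKernel_pos 1 x
  have h6 := h.nonneg x
  have h7 := mul_nonneg (abs_nonneg M) h6
  rw [norm_eq_abs, abs_le]
  constructor <;> linarith

/-- The same Jensen inequality with the roles reversed: the density is the function and the Gaussian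
is the averaging measure. -/
lemma IsBoundedDensity.le_flowEntropy (h : IsBoundedDensity P q)
    (hP : Integrable (fun x : 𝔼 => ‖x‖ ^ 2) P) (ht : 0 < t) :
    -∫ x, q x * log (q x) ≤ flowEntropy P t := by
  obtain ⟨M, hM⟩ := h.bounded
  set Q : Measure 𝔼 := volume.withDensity fun x => ENNReal.ofReal (heatKernel t x)
  have : IsProbabilityMeasure Q := ⟨by
    rw [withDensity_apply _ MeasurableSet.univ, Measure.restrict_univ,
      ← ofReal_integral_eq_lintegral_ofReal (integrable_heatKernel ht)
        (Eventually.of_forall fun x => (heatKernel_pos t x).le), integral_heatKernel ht,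
      ENNReal.ofReal_one]⟩
  have e : measConv Q q = heatFlow P t := funext fun x => by
    rw [h.heatFlow_eq, measConv, integral_withDensity_ofReal (continuous_heatKernel t).aemeasurable
      fun x => (heatKernel_pos t x).le]
    simp only [smul_eq_mul, mul_comm]
  have h1 := integral_measConv_mul_log_le (Q := Q) h.measurable h.nonneg hM
    (h.integrable_mul_log hP) (by rw [e]; exact heatFlow_pos ht)
    (by rw [e]; exact integrable_heatFlow_mul_log hP ht)
  rw [e] at h1
  exact neg_le_neg h1

/-- Upper semicontinuity of the entropy along the heat flow at time zero. -/
lemma IsBoundedDensity.le_of_forall_le_flowEntropy (h : IsBoundedDensity P q) (hq : Continuous q)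
    (hP : IsIsotropicMeasure P) {R : ℝ} (hR : ∀ t, 0 < t → R ≤ flowEntropy P t) :
    R ≤ -∫ x, q x * log (q x) := by
  -- The integrand of relative entropy to the standard Gaussian, made pointwise nonnegative by
  -- subtracting s minus the Gaussian density. Nonnegativity is what Fatou requires; its integral is
  -- minus the entropy plus a second-moment term that converges.
  set F : ℝ → 𝔼 → ℝ := fun s x => s * log s - s * log (heatKernel 1 x) - (s - heatKernel 1 x)
    with hF
  have hF0 : ∀ s x, 0 ≤ s → 0 ≤ F s x := fun s x hs =>
    sub_nonneg.2 (sub_le_mul_log_sub hs (heatKernel_pos 1 x))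
  have hFval : ∀ p : 𝔼 → ℝ, Integrable p → ∫ x, p x = 1 →
      Integrable (fun x => ‖x‖ ^ 2 * p x) → Integrable (fun x => p x * log (p x)) →
      Integrable (fun x => F (p x) x) ∧ ∫ x, F (p x) x = (∫ x, p x * log (p x)) +
        (1 / 2 * (∫ x, ‖x‖ ^ 2 * p x) + d / 2 * log (2 * π)) := by
    intro p h1 h2 h3 h4
    have hl := integral_mul_log_heatKernel (s := 1) h1 h3
    have hk := integrable_heatKernel (d := d) one_pos
    refine ⟨(h4.sub hl.1).sub (h1.sub hk), ?_⟩
    have e1 : ∫ x, F (p x) x = (∫ x, (p x * log (p x) - p x * log (heatKernel 1 x))) -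
        ∫ x, (p x - heatKernel 1 x) := integral_sub (h4.sub hl.1) (h1.sub hk)
    rw [e1, integral_sub h4 hl.1, integral_sub h1 hk, hl.2, h2, integral_heatKernel one_pos]
    norm_num
    ring
  set τ : ℕ → ℝ := fun n => 1 / ((n : ℝ) + 1) with hτ
  have hτ0 : ∀ n, 0 < τ n := fun n => by positivity
  have hτt : Tendsto τ atTop (𝓝 0) := tendsto_one_div_add_atTop_nhds_zero_nat
  have hn : ∀ n, Integrable (fun x => F (heatFlow P (τ n) x) x) ∧
      ∫ x, F (heatFlow P (τ n) x) x = -flowEntropy P (τ n) +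
        (1 / 2 * (d * (1 + τ n)) + d / 2 * log (2 * π)) := fun n => by
    have h2 := integral_norm_sq_mul_heatFlow hP (hτ0 n)
    have := hFval _ (integrable_heatFlow (P := P) (hτ0 n)) (integral_heatFlow (hτ0 n)) h2.1
      (integrable_heatFlow_mul_log hP.integrable_sq (hτ0 n))
    rw [h2.2] at this
    rw [flowEntropy, neg_neg]
    exact this
  have hqq := hFval q h.integrable h.integral_eq_one (h.integrable_norm_sq_mul hP.integrable_sq)
    (h.integrable_mul_log hP.integrable_sq)
  have hm2 : ∫ x, ‖x‖ ^ 2 * q x = d := by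
    have e : ∫ x, ‖x‖ ^ 2 * q x = ∫ x, ‖x‖ ^ 2 ∂P := by
      rw [h.integral_eq]; simp only [mul_comm]
    rw [e, integral_norm_sq_eq_sum fun i => integrable_coord_mul_coord hP.integrable_sq i i]
    simp [hP.cov]
  rw [hm2] at hqq
  have hlim : ∀ x, Tendsto (fun n => F (heatFlow P (τ n) x) x) atTop (𝓝 (F (q x) x)) := fun x => by
    have hc : Continuous fun s => F s x :=
      (continuous_mul_log.sub (continuous_id.mul continuous_const)).sub
        (continuous_id.sub continuous_const)
    exact (hc.tendsto _).comp (h.tendsto_heatFlow hq x)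
  have hb : ∀ n, ∫ x, F (heatFlow P (τ n) x) x ≤
      -R + (1 / 2 * (d * (1 + τ n)) + d / 2 * log (2 * π)) := fun n => by
    rw [(hn n).2]; linarith [hR _ (hτ0 n)]
  -- Fatou along t = 1/(n+1), using pointwise convergence of the flow to q; the second moment d(1+t)
  -- tends to d.
  have hfatou : ∫⁻ x, ENNReal.ofReal (F (q x) x) ≤
      ENNReal.ofReal (-R + (1 / 2 * (d * (1 + 0)) + d / 2 * log (2 * π))) := by
    have h1 : ∀ x, ENNReal.ofReal (F (q x) x) =
        liminf (fun n => ENNReal.ofReal (F (heatFlow P (τ n) x) x)) atTop := fun x =>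
      (((ENNReal.continuous_ofReal.tendsto _).comp (hlim x)).liminf_eq).symm
    have h2 : Tendsto (fun n => ENNReal.ofReal
        (-R + (1 / 2 * (d * (1 + τ n)) + d / 2 * log (2 * π)))) atTop
        (𝓝 (ENNReal.ofReal (-R + (1 / 2 * (d * (1 + 0)) + d / 2 * log (2 * π))))) :=
      (ENNReal.continuous_ofReal.tendsto _).comp (tendsto_const_nhds.add
        ((((hτt.const_add 1).const_mul (d : ℝ)).const_mul (1 / 2)).add_const _))
    simp only [h1]
    refine (lintegral_liminf_le' fun n => (hn n).1.aemeasurable.ennreal_ofReal).trans ?_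
    rw [← h2.liminf_eq]
    refine liminf_le_liminf (Eventually.of_forall fun n => ?_)
    rw [← ofReal_integral_eq_lintegral_ofReal (hn n).1
      (Eventually.of_forall fun x => hF0 _ x (heatFlow_pos (hτ0 n) x).le)]
    exact ENNReal.ofReal_le_ofReal (hb n)
  -- `ENNReal.ofReal` clips negative numbers, so the bound must be known nonnegative before it is
  -- read in the reals.
  have hb0 : 0 ≤ -R + (1 / 2 * (d * (1 + 0)) + d / 2 * log (2 * π)) := by
    have h0 : ∀ n, 0 ≤ -R + (1 / 2 * (d * (1 + τ n)) + d / 2 * log (2 * π)) := fun n =>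
      (integral_nonneg fun x => hF0 _ x (heatFlow_pos (hτ0 n) x).le).trans (hb n)
    exact ge_of_tendsto' (tendsto_const_nhds.add
      ((((hτt.const_add 1).const_mul (d : ℝ)).const_mul (1 / 2)).add_const _)) h0
  rw [← ofReal_integral_eq_lintegral_ofReal hqq.1
    (Eventually.of_forall fun x => hF0 _ x (h.nonneg x)), ENNReal.ofReal_le_ofReal_iff hb0,
    hqq.2] at hfatou
  linarith

end Density

end EntropyBounds
end EntropyJump

/-! ### From dissipation to entropy: the differential inequality -/

namespace EntropyJump

section DifferentialInequality

open Real InnerProductSpace Filter Topology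

variable {d : ℕ}

local notation "𝔼" => EuclideanSpace ℝ (Fin d)

/-- A nonincreasing function on (0, ∞) with lower bound -C/t has a nonnegative limit inferior at
infinity, hence is nonnegative everywhere. This is how the argument integrates back from t = ∞. -/
lemma nonneg_of_deriv_nonpos {f f' : ℝ → ℝ} (hd : ∀ t, 0 < t → HasDerivAt f (f' t) t)
    (h' : ∀ t, 0 < t → f' t ≤ 0) {C : ℝ} (hC : ∀ t, 0 < t → -(C / t) ≤ f t) {t : ℝ}
    (ht : 0 < t) : 0 ≤ f t := by
  have hanti : AntitoneOn f (Set.Ioi 0) := by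
    refine antitoneOn_of_deriv_nonpos (convex_Ioi 0)
      (fun s hs => (hd s hs).continuousAt.continuousWithinAt)
      (fun s hs => (hd s (interior_subset hs)).differentiableAt.differentiableWithinAt)
      fun s hs => ?_
    rw [(hd s (interior_subset hs)).deriv]
    exact h' s (interior_subset hs)
  have hlim : Tendsto (fun s : ℝ => -(C / s)) atTop (𝓝 (-0)) :=
    (tendsto_const_nhds.div_atTop tendsto_id).neg
  rw [neg_zero] at hlim
  refine le_of_tendsto hlim ?_
  filter_upwards [eventually_ge_atTop t] with s hs
  exact (hC s (ht.trans_le hs)).trans (hanti ht (ht.trans_le hs : (0 : ℝ) < s) hs)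

/-- The differential inequality behind the entropy jump: `E₁`, `E₂` are entropies along the heat
flow, `J₁`, `J₂` twice their derivatives, and `K₁`, `K₂` the dissipation of these. -/
lemma entropy_jump_of_dissipation {J₁ J₂ K₁ K₂ E₁ E₂ g : ℝ → ℝ} {n θ : ℝ} (hn : 0 ≤ n)
    (hθ : 0 ≤ θ) (hJ₁ : ∀ t, 0 < t → HasDerivAt J₁ (-K₁ t) t)
    (hJ₂ : ∀ t, 0 < t → HasDerivAt J₂ (-K₂ t) t)
    (hE₁ : ∀ t, 0 < t → HasDerivAt E₁ (1 / 2 * J₁ t) t)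
    (hE₂ : ∀ t, 0 < t → HasDerivAt E₂ (1 / 2 * J₂ t) t)
    (hg : ∀ t, 0 < t → HasDerivAt g (n / (2 * (1 + t))) t)
    (hJ₁l : ∀ t, 0 < t → n / (1 + t) ≤ J₁ t) (hJ₁u : ∀ t, 0 < t → J₁ t ≤ n / t)
    (hJ₂u : ∀ t, 0 < t → J₂ t ≤ n / t)
    (hE₁u : ∀ t, 0 < t → E₁ t ≤ g t) (hE₁l : ∀ t, 0 < t → g t - n / (2 * t) ≤ E₁ t)
    (hE₂l : ∀ t, 0 < t → g t - n / (2 * t) ≤ E₂ t)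
    (hK₁ : ∀ t, 0 < t → 2 * (1 / (1 + t)) * J₁ t - n * (1 / (1 + t)) ^ 2 ≤ K₁ t)
    (hK : ∀ t, 0 < t → θ * (K₁ t - J₁ t / (1 + t)) ≤ K₁ t - K₂ t) {t : ℝ} (ht : 0 < t) :
    θ / 2 * (g t - E₁ t) ≤ E₂ t - E₁ t := by
  have hid : ∀ t : ℝ, HasDerivAt (fun t : ℝ => 1 + t) 1 t := fun t => (hasDerivAt_id t).const_add 1
  have hI1 : ∀ t, 0 < t → (1 + t) * J₁ t - n ≤ n / t := fun t ht => by
    have h1 := mul_le_mul_of_nonneg_left (hJ₁u t ht) (by linarith : (0 : ℝ) ≤ 1 + t)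
    have e : (1 + t) * (n / t) = n / t + n := by field_simp
    linarith
  have hI0 : ∀ t, 0 < t → 0 ≤ (1 + t) * J₁ t - n := fun t ht => by
    have h1 := mul_le_mul_of_nonneg_left (hJ₁l t ht) (by linarith : (0 : ℝ) ≤ 1 + t)
    rw [mul_div_cancel₀ _ (by linarith : (1 : ℝ) + t ≠ 0)] at h1
    linarith
  have hhalf : ∀ t : ℝ, 0 < t → n / (2 * t) = 1 / 2 * (n / t) := fun t ht => by field_simp
  -- The entropy term is chosen so that J₁ - J₂ cancels in the derivative, which becomes -(1+t)(K₁ -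
  -- K₂) + θ((1+t)K₁ - J₁).
  have hA : ∀ t, 0 < t → 0 ≤ (1 + t) * (J₁ t - J₂ t) + 2 * (E₂ t - E₁ t) -
      θ * ((1 + t) * J₁ t - n) := fun t ht => by
    refine nonneg_of_deriv_nonpos (C := n + n + θ * n) (fun t ht => ((((hid t).mul
      ((hJ₁ t ht).sub (hJ₂ t ht))).add (((hE₂ t ht).sub (hE₁ t ht)).const_mul 2)).sub
      ((((hid t).mul (hJ₁ t ht)).sub_const n).const_mul θ))) (fun t ht => ?_) (fun t ht => ?_) ht
    · have ht1 : 0 < 1 + t := by linarith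
      have h1 := mul_le_mul_of_nonneg_left (hK t ht) ht1.le
      have e : (1 + t) * (θ * (K₁ t - J₁ t / (1 + t))) = θ * ((1 + t) * K₁ t - J₁ t) := by
        field_simp
      simp only [Pi.sub_apply]
      linarith
    · have h1 := mul_le_mul_of_nonneg_left (hJ₂u t ht) (by linarith : (0 : ℝ) ≤ 1 + t)
      have e1 : (1 + t) * (n / t) = n / t + n := by field_simp
      have h2 := hI0 t ht
      have h3 := mul_le_mul_of_nonneg_left (hI1 t ht) hθ
      have h4 := hE₂l t ht
      have h5 := hE₁u t ht
      rw [hhalf t ht] at h4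
      have e2 : (n + n + θ * n) / t = n / t + n / t + θ * (n / t) := by ring
      rw [e2]
      simp only [Pi.sub_apply, Pi.add_apply, Pi.mul_apply]
      linarith
  -- A logarithmic Sobolev type bound: the excess of Fisher information, rescaled by 1+t, dominates
  -- twice the entropy deficit from the Gaussian.
  have hB : ∀ t, 0 < t → 0 ≤ ((1 + t) * J₁ t - n) - 2 * (g t - E₁ t) := fun t ht => by
    refine nonneg_of_deriv_nonpos (C := n) (fun t ht => ((((hid t).mul (hJ₁ t ht)).sub_const
      n).sub (((hg t ht).sub (hE₁ t ht)).const_mul 2))) (fun t ht => ?_) (fun t ht => ?_) ht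
    · have ht1 : 0 < 1 + t := by linarith
      have h1 := mul_le_mul_of_nonneg_left (hK₁ t ht) ht1.le
      have e : (1 + t) * (2 * (1 / (1 + t)) * J₁ t - n * (1 / (1 + t)) ^ 2) =
          2 * J₁ t - n / (1 + t) := by field_simp
      have e2 : 2 * (n / (2 * (1 + t))) = n / (1 + t) := by field_simp
      linarith
    · have h2 := hI0 t ht
      have h4 := hE₁l t ht
      rw [hhalf t ht] at h4
      simp only [Pi.sub_apply, Pi.mul_apply]
      linarith
  -- Dividing by 1+t makes the derivative's numerator equal to minus half the quantity of `hA` minus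
  -- θ/4 times that of `hB`.
  have hC : 0 ≤ (E₂ t - E₁ t - θ / 2 * (g t - E₁ t)) / (1 + t) := by
    refine nonneg_of_deriv_nonpos (C := n / 2 + θ * n / 4) (fun t ht =>
      ((((hE₂ t ht).sub (hE₁ t ht)).sub (((hg t ht).sub (hE₁ t ht)).const_mul (θ / 2))).div
        (hid t) (by linarith : (1 : ℝ) + t ≠ 0))) (fun t ht => ?_) (fun t ht => ?_) ht
    · refine div_nonpos_of_nonpos_of_nonneg ?_ (sq_nonneg _)
      have ht1 : 0 < 1 + t := by linarith
      have h1 := hA t ht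
      have h2 := mul_nonneg hθ (hB t ht)
      have e2 : n / (2 * (1 + t)) * (1 + t) = n / 2 := by field_simp
      simp only [Pi.sub_apply]
      have e3 : (1 / 2 * J₂ t - 1 / 2 * J₁ t - θ / 2 * (n / (2 * (1 + t)) - 1 / 2 * J₁ t)) *
          (1 + t) = (1 / 2 * J₂ t - 1 / 2 * J₁ t + θ / 4 * J₁ t) * (1 + t) -
            θ / 2 * (n / (2 * (1 + t)) * (1 + t)) := by ring
      rw [e3, e2]
      linarith
    · have ht1 : 0 < 1 + t := by linarith
      have h4 := hE₂l t ht
      have h5 := hE₁u t ht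
      have h6 := hE₁l t ht
      rw [hhalf t ht] at h4 h6
      have h7 : 0 ≤ n / t := by positivity
      have h8 := mul_le_mul_of_nonneg_left h6 hθ
      have e : (n / 2 + θ * n / 4) / t = 1 / 2 * (n / t) + θ / 4 * (n / t) := by ring
      have h9 : 0 ≤ 1 / 2 * (n / t) + θ / 4 * (n / t) := by positivity
      simp only [Pi.sub_apply, Pi.div_apply]
      rw [le_div_iff₀ ht1, e]
      nlinarith [mul_nonneg h9 ht.le]
  have ht1 : 0 < 1 + t := by linarith
  have := mul_nonneg hC ht1.le
  rw [div_mul_cancel₀ _ ht1.ne'] at this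
  linarith

variable {P : Measure (EuclideanSpace ℝ (Fin d))} [IsProbabilityMeasure P] {t : ℝ}

/-- From log((1+t)/t) ≤ 1/t. It gives the decay rate d/(2t) with which every isotropic flow
approaches Gaussian entropy. -/
lemma gaussEntropy_sub_le (d : ℕ) (ht : 0 < t) :
    gaussEntropy d (1 + t) - d / (2 * t) ≤ gaussEntropy d t := by
  have h := log_le_sub_one_of_pos (div_pos (by linarith : (0 : ℝ) < 1 + t) ht)
  have e : log (2 * π * (1 + t)) = log (2 * π * t) + log ((1 + t) / t) := by
    rw [← log_mul (by positivity) (by positivity)]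
    congr 1; field_simp
  have h2 : (1 + t) / t - 1 = 1 / t := by field_simp; ring
  rw [h2] at h
  have h3 := mul_le_mul_of_nonneg_left h (by positivity : (0 : ℝ) ≤ d / 2)
  have e3 : (d : ℝ) / (2 * t) = d / 2 * (1 / t) := by field_simp
  rw [gaussEntropy, gaussEntropy, e, e3]
  linarith

lemma hasDerivAt_gaussEntropy (d : ℕ) (ht : 0 < t) :
    HasDerivAt (fun t => gaussEntropy d (1 + t)) (d / (2 * (1 + t))) t := by
  have h1 : HasDerivAt (fun t : ℝ => 2 * π * (1 + t)) (2 * π) t := by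
    simpa using ((hasDerivAt_id t).const_add 1).const_mul (2 * π)
  have h2 := ((h1.log (by positivity)).const_mul ((d : ℝ) / 2)).const_add ((d : ℝ) / 2)
  refine h2.congr_deriv ?_
  field_simp

/-- The entropy jump along the heat flow. -/
theorem flowEntropy_selfConv_sub_ge {c : ℝ} (h : SatisfiesLipPoincare P c) (hc : 0 < c)
    (hP : IsIsotropicMeasure P) (hP' : IsIsotropicMeasure (selfConv P))
    (hlc : ∀ t, 0 < t → MidLogConcave (heatFlow P t)) (ht : 0 < t) :
    c / (4 * (1 + c)) * (gaussEntropy d (1 + t) - flowEntropy P t) ≤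
      flowEntropy (selfConv P) t - flowEntropy P t := by
  have hJ : ∀ (Q : Measure 𝔼) [IsProbabilityMeasure Q] (t : ℝ), 0 < t →
      HasDerivAt (fun t => ∑ i, fisher Q t i i) (-∑ i, ∑ j, hessSq Q t i j) t := by
    intro Q _ t ht
    rw [← Finset.sum_neg_distrib]
    exact HasDerivAt.fun_sum fun i _ => hasDerivAt_fisher ht i
  have hJu : ∀ (Q : Measure 𝔼) [IsProbabilityMeasure Q] (t : ℝ), 0 < t →
      ∑ i, fisher Q t i i ≤ d / t := by
    intro Q _ t ht
    refine (Finset.sum_le_sum fun i _ => fisher_le ht i).trans_eq ?_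
    simp [div_eq_mul_inv]
  have hEl : ∀ (Q : Measure 𝔼) [IsProbabilityMeasure Q], IsIsotropicMeasure Q → ∀ t, 0 < t →
      gaussEntropy d (1 + t) - d / (2 * t) ≤ flowEntropy Q t := fun Q _ hQ t ht =>
    (gaussEntropy_sub_le d ht).trans (gaussEntropy_le_flowEntropy hQ.integrable_sq ht)
  have key := entropy_jump_of_dissipation (n := d) (θ := c / (2 * (1 + c))) d.cast_nonneg
    (by positivity) (hJ P) (hJ (selfConv P)) (fun t ht => hasDerivAt_flowEntropy hP.integrable_sq ht)
    (fun t ht => hasDerivAt_flowEntropy hP'.integrable_sq ht)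
    (fun t ht => hasDerivAt_gaussEntropy d ht) (fun t ht => ?_) (hJu P) (hJu (selfConv P))
    (fun t ht => flowEntropy_le_gaussEntropy hP ht) (hEl P hP) (hEl _ hP')
    (fun t ht => sum_hessSq_ge ht _) (fun t ht => ?_) ht
  · have e : c / (4 * (1 + c)) = c / (2 * (1 + c)) / 2 := by field_simp; norm_num
    rw [e]
    exact key
  · refine le_trans (le_of_eq ?_) (Finset.sum_le_sum fun i _ => fisher_ge hP ht i)
    simp [div_eq_mul_inv]
  · have h1 := sum_fisher_sq_le h hc hP ht (hlc t ht)
    have h2 := sum_hessSq_selfConv_le ht (hlc t ht)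
    have hc1 : 0 < 1 + c := by linarith
    have ht1 : 0 < 1 + t := by linarith
    generalize ∑ i, ∑ j, hessSq P t i j = K at *
    generalize ∑ i, ∑ j, fisher P t i j ^ 2 = F at *
    generalize ∑ i, fisher P t i i = J at *
    -- Solving for the squared Fisher matrix and inserting it into K₂ ≤ (K + F)/2 gives θ =
    -- c/(2(1+c)).
    have h3 : F ≤ (K + c * (J / (1 + t))) / (1 + c) := by
      rw [le_div_iff₀ hc1]
      have : c / (1 + t) * J = c * (J / (1 + t)) := by ring
      linarith
    have e : c / (2 * (1 + c)) * (K - J / (1 + t)) =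
        K - 1 / 2 * (K + (K + c * (J / (1 + t))) / (1 + c)) := by
      field_simp
      ring
    rw [e]
    linarith

end DifferentialInequality
end EntropyJump

/-! ### A regular version of a log-concave density -/

namespace EntropyJump

section LogConcaveDensity

open Real InnerProductSpace Filter Topology

variable {d : ℕ}

local notation "𝔼" => EuclideanSpace ℝ (Fin d)

lemma midLogConcave_heatKernel {t : ℝ} (ht : 0 < t) : MidLogConcave (heatKernel (d := d) t) := by
  intro x y
  simp only [heatKernel]
  rw [← exp_add, ← exp_nat_mul]
  refine exp_le_exp.2 ?_
  have h1 := parallelogram_law_with_norm ℝ x y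
  have h2 : ‖(2⁻¹ : ℝ) • (x + y)‖ ^ 2 = ‖x + y‖ ^ 2 / 4 := by
    rw [norm_smul, mul_pow]; norm_num; ring
  rw [h2]
  have h3 : 0 ≤ ‖x - y‖ * ‖x - y‖ / (4 * t) := by positivity
  have h4 : ‖x - y‖ * ‖x - y‖ / (4 * t) = ‖x‖ ^ 2 / (2 * t) + ‖y‖ ^ 2 / (2 * t) -
      ‖x + y‖ ^ 2 / (4 * t) := by
    field_simp
    linarith
  push_cast
  have h5 : 2 * (-(‖x + y‖ ^ 2 / 4) / (2 * t) - d / 2 * log (2 * π * t)) =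
      -(‖x + y‖ ^ 2 / (4 * t)) - d * log (2 * π * t) := by field_simp
  rw [h5, neg_div, neg_div]
  linarith

/-- The restriction of `f` to the interior of its support. -/
noncomputable def interiorPart (f : 𝔼 → ℝ) : 𝔼 → ℝ := (interior {x | 0 < f x}).indicator f

section

variable {f : EuclideanSpace ℝ (Fin d) → ℝ}

lemma pos_of_mem_interior_support {x : 𝔼} (hx : x ∈ interior {x | 0 < f x}) : 0 < f x :=
  (interior_subset hx : x ∈ {x | 0 < f x})

lemma interiorPart_nonneg (hf : IsLogConcave f) (x : 𝔼) : 0 ≤ interiorPart f x :=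
  Set.indicator_nonneg (fun x _ => hf.1 x) x

/-- The two functions differ only on the frontier of the convex set {f > 0}, which is Lebesgue null.
Passing to the interior removes arbitrary boundary values of f and gives measurability and almost
everywhere continuity. -/
lemma interiorPart_ae_eq (hf : IsLogConcave f) : interiorPart f =ᵐ[volume] f := by
  have h := hf.2.1.addHaar_frontier (volume : Measure 𝔼)
  rw [Filter.EventuallyEq, ae_iff]
  refine measure_mono_null (fun x hx => ?_) h
  have h1 : x ∉ interior {x | 0 < f x} := fun h1 => hx (Set.indicator_of_mem h1 f)
  have h2 : 0 < f x := (hf.1 x).lt_of_ne fun h2 => hx (by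
    rw [interiorPart, Set.indicator_of_notMem h1, ← h2])
  exact ⟨subset_closure h2, h1⟩

lemma continuousOn_interior_support (hf : IsLogConcave f) :
    ContinuousOn f (interior {x | 0 < f x}) := by
  have h := (hf.2.continuousOn_interior).neg.rexp
  refine h.congr fun x hx => ?_
  have := pos_of_mem_interior_support hx
  simp [exp_log this]

lemma measurable_interiorPart (hf : IsLogConcave f) : Measurable (interiorPart f) := by
  classical
  have h := (continuousOn_interior_support hf).measurable_piecewise
    (continuousOn_const (c := (0 : ℝ))) isOpen_interior.measurableSet
  have e : interiorPart f = (interior {x | 0 < f x}).piecewise f fun _ => 0 :=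
    Set.piecewise_eq_indicator.symm
  rwa [e]

lemma continuousAt_interiorPart (hf : IsLogConcave f) {x : 𝔼}
    (hx : x ∉ frontier (interior {x | 0 < f x})) : ContinuousAt (interiorPart f) x := by
  by_cases h : x ∈ interior {x | 0 < f x}
  · have hn := isOpen_interior.mem_nhds h
    refine ((continuousOn_interior_support hf).continuousAt hn).congr ?_
    filter_upwards [hn] with y hy
    exact (Set.indicator_of_mem hy f).symm
  · have h1 : x ∉ closure (interior {x | 0 < f x}) := fun h1 =>
      hx ⟨h1, by rwa [isOpen_interior.interior_eq]⟩
    have hn := isClosed_closure.isOpen_compl.mem_nhds h1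
    refine (continuousAt_const (y := (0 : ℝ))).congr ?_
    filter_upwards [hn] with y hy
    exact (Set.indicator_of_notMem (fun h2 => hy (subset_closure h2)) f).symm

lemma ae_continuousAt_interiorPart (hf : IsLogConcave f) :
    ∀ᵐ x, ContinuousAt (interiorPart f) x := by
  have h := hf.2.1.interior.addHaar_frontier (volume : Measure 𝔼)
  filter_upwards [compl_mem_ae_iff.2 h] with x hx
  exact continuousAt_interiorPart hf hx

lemma midLogConcave_interiorPart (hf : IsLogConcave f) : MidLogConcave (interiorPart f) := by
  intro x y
  by_cases hx : x ∈ interior {x | 0 < f x}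
  · by_cases hy : y ∈ interior {x | 0 < f x}
    · have hm : (2⁻¹ : ℝ) • (x + y) ∈ interior {x | 0 < f x} := by
        rw [smul_add]
        exact hf.2.1.interior hx hy (by norm_num) (by norm_num) (by norm_num)
      have hc := hf.2.2 (interior_subset hx) (interior_subset hy)
        (by norm_num : (0 : ℝ) ≤ 2⁻¹) (by norm_num : (0 : ℝ) ≤ 2⁻¹) (by norm_num)
      rw [← smul_add] at hc
      have px := pos_of_mem_interior_support hx
      have py := pos_of_mem_interior_support hy
      have pm := pos_of_mem_interior_support hm
      rw [interiorPart, Set.indicator_of_mem hx, Set.indicator_of_mem hy,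
        Set.indicator_of_mem hm, ← log_le_log_iff (by positivity) (by positivity),
        log_mul px.ne' py.ne', log_pow]
      simp only [smul_eq_mul] at hc
      push_cast
      linarith
    · rw [interiorPart, Set.indicator_of_notMem hy, mul_zero]; positivity
  · rw [interiorPart, Set.indicator_of_notMem hx, zero_mul]; positivity

end

/-- A log-concave probability density with a point of positivity and continuity is bounded. -/
lemma MidLogConcave.bounded {q : 𝔼 → ℝ} (hq : MidLogConcave q) (hq0 : ∀ x, 0 ≤ q x)
    (hi : Integrable q) (h1 : ∫ x, q x = 1) {x₀ : 𝔼} (hx₀ : 0 < q x₀)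
    (hc : ContinuousAt q x₀) : ∃ M, ∀ x, q x ≤ M := by
  obtain ⟨r, hr, hball⟩ := Metric.eventually_nhds_iff_ball.1
    (hc.eventually (lt_mem_nhds (half_lt_self hx₀)))
  set a := q x₀ / 2 with ha
  have ha0 : 0 < a := half_pos hx₀
  set v := (volume : Measure 𝔼).real (Metric.ball (0 : 𝔼) (r / 2)) with hv
  have hv0 : 0 < v := ENNReal.toReal_pos (Metric.measure_ball_pos volume _ (half_pos hr)).ne'
    measure_ball_lt_top.ne
  refine ⟨1 / (a * v ^ 2), fun x => ?_⟩
  set c := (2⁻¹ : ℝ) • (x + x₀) with hcd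
  -- Reflect x through z: for z near the midpoint of x and x₀ the reflected point is within r of x₀,
  -- where q > a. Log-concavity then bounds q z below, so a large q x would put mass more than 1 on
  -- the ball.
  have hlow : ∀ z ∈ Metric.ball c (r / 2), √(a * q x) ≤ q z := fun z hz => by
    have hy : (2 : ℝ) • z - x ∈ Metric.ball x₀ r := by
      rw [mem_ball_iff_norm] at hz ⊢
      have e : (2 : ℝ) • z - x - x₀ = (2 : ℝ) • (z - c) := by rw [hcd]; module
      rw [e, norm_smul, Real.norm_two]
      linarith
    have h2 := hq x ((2 : ℝ) • z - x)
    have e : (2⁻¹ : ℝ) • (x + ((2 : ℝ) • z - x)) = z := by module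
    rw [e] at h2
    rw [sqrt_le_left (hq0 z)]
    have h3 := mul_le_mul_of_nonneg_left (hball _ hy).le (hq0 x)
    linarith
  have hvc : (volume : Measure 𝔼).real (Metric.ball c (r / 2)) = v := by
    rw [hv, measureReal_def, measureReal_def, Measure.addHaar_ball_center]
  have h2 : √(a * q x) * v ≤ 1 := by
    rw [← h1, ← hvc]
    calc √(a * q x) * (volume : Measure 𝔼).real (Metric.ball c (r / 2))
        = ∫ z in Metric.ball c (r / 2), √(a * q x) := by
          rw [setIntegral_const, smul_eq_mul, mul_comm]
      _ ≤ ∫ z in Metric.ball c (r / 2), q z :=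
          setIntegral_mono_on (integrableOn_const measure_ball_lt_top.ne) hi.integrableOn
            measurableSet_ball hlow
      _ ≤ ∫ z, q z := setIntegral_le_integral hi (Eventually.of_forall hq0)
  have h3 : (√(a * q x) * v) ^ 2 ≤ 1 := pow_le_one₀ (by positivity) h2
  rw [mul_pow, sq_sqrt (mul_nonneg ha0.le (hq0 x))] at h3
  rw [le_div_iff₀ (by positivity)]
  linarith

/-- A log-concave density has a bounded version. -/
lemma IsLogConcave.isBoundedDensity {f : 𝔼 → ℝ} (hf : IsLogConcave f) {P : Measure 𝔼}
    [IsProbabilityMeasure P] (hP : P = volume.withDensity fun x => ENNReal.ofReal (f x)) :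
    IsBoundedDensity P (interiorPart f) := by
  have hae := interiorPart_ae_eq hf
  have hPq : P = volume.withDensity fun x => ENNReal.ofReal (interiorPart f x) := by
    rw [hP]
    refine withDensity_congr_ae ?_
    filter_upwards [hae] with x hx
    rw [hx]
  have hm := measurable_interiorPart hf
  have h0 := interiorPart_nonneg hf
  have hi : Integrable (interiorPart f) := by
    have := (integrable_withDensity_ofReal_iff hm.aemeasurable h0 (g := fun _ => (1 : ℝ))).1
      (by rw [← hPq]; exact integrable_const _)
    simpa using this
  have h1 : ∫ x, interiorPart f x = 1 := by
    have := integral_withDensity_ofReal hm.aemeasurable h0 (fun _ => (1 : ℝ))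
    rw [← hPq] at this
    simpa using this.symm
  obtain ⟨x₀, hx₀⟩ : ∃ x₀, 0 < interiorPart f x₀ := by
    by_contra! h
    have : ∀ x, interiorPart f x = 0 := fun x => le_antisymm (h x) (h0 x)
    simp [this] at h1
  have hx₀' : x₀ ∈ interior {x | 0 < f x} := by
    by_contra h
    rw [interiorPart, Set.indicator_of_notMem h] at hx₀
    exact hx₀.false
  have hc := continuousAt_interiorPart hf fun h =>
    h.2 (by rwa [isOpen_interior.interior_eq])
  exact ⟨hm, h0, (midLogConcave_interiorPart hf).bounded h0 hi h1 hx₀ hc, hPq⟩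

/-- The heat flow preserves log-concavity. -/
lemma MidLogConcave.heatFlow {P : Measure 𝔼} [IsProbabilityMeasure P] {q : 𝔼 → ℝ}
    (hq : MidLogConcave q) (h : IsBoundedDensity P q) {t : ℝ} (ht : 0 < t) :
    MidLogConcave (heatFlow P t) := by
  obtain ⟨M, hM⟩ := h.bounded
  have h1 := hq.conv (midLogConcave_heatKernel ht) h.measurable (continuous_heatKernel t).measurable
    h.nonneg (fun x => (heatKernel_pos t x).le) fun x => by
      refine (integrable_heatKernel ht).bdd_mul (c := M) ?_ (Eventually.of_forall fun y => ?_)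
      · exact (h.measurable.comp (by fun_prop)).aestronglyMeasurable
      · rw [norm_of_nonneg (h.nonneg _)]; exact hM _
  rwa [← funext h.heatFlow_eq] at h1

end LogConcaveDensity
end EntropyJump

/-! ### Passage from random vectors to measures and densities -/

namespace EntropyJump

section RandomVectors

open Real InnerProductSpace Filter Topology

variable {d : ℕ}

local notation "𝔼" => EuclideanSpace ℝ (Fin d)

section Density

variable {P : Measure (EuclideanSpace ℝ (Fin d))} [IsProbabilityMeasure P]
  {q : EuclideanSpace ℝ (Fin d) → ℝ}

lemma IsBoundedDensity.integrable_mul_comp_sub (h : IsBoundedDensity P q) (z : 𝔼) :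
    Integrable fun y => q (z - y) * q y := by
  obtain ⟨M, hM⟩ := h.bounded
  refine h.integrable.bdd_mul (c := M) ?_ (Eventually.of_forall fun y => ?_)
  · exact (h.measurable.comp (by fun_prop)).aestronglyMeasurable
  · rw [norm_of_nonneg (h.nonneg _)]; exact hM _

/-- Almost everywhere continuity of q suffices: for fixed z, the map y ↦ z - y pulls the exceptional
null set back to a null set. Thus the self-convolution has a continuous density even when q jumps at
the boundary of its support. -/
lemma IsBoundedDensity.continuous_funConv (h : IsBoundedDensity P q)
    (hq : ∀ᵐ x, ContinuousAt q x) : Continuous (funConv q q) := by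
  obtain ⟨M, hM⟩ := h.bounded
  refine continuous_iff_continuousAt.2 fun z => ?_
  refine continuousAt_of_dominated (bound := fun y => M * q y)
    (Eventually.of_forall fun z => (h.integrable_mul_comp_sub z).aestronglyMeasurable)
    (Eventually.of_forall fun z => Eventually.of_forall fun y => ?_) (h.integrable.const_mul M) ?_
  · rw [norm_of_nonneg (mul_nonneg (h.nonneg _) (h.nonneg _))]
    exact mul_le_mul_of_nonneg_right (hM _) (h.nonneg _)
  · have := (Measure.measurePreserving_sub_left (volume : Measure 𝔼) z).quasiMeasurePreserving.ae hq
    filter_upwards [this] with y hy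
    have h1 : ContinuousAt (fun z : 𝔼 => q (z - y)) z :=
      ContinuousAt.comp (f := fun z : 𝔼 => z - y) hy (by fun_prop)
    exact h1.mul continuousAt_const

/-- The density of the self-convolution. -/
lemma IsBoundedDensity.selfConv (h : IsBoundedDensity P q) (hq : ∀ᵐ x, ContinuousAt q x) :
    IsBoundedDensity (selfConv P) (fun w => √2 ^ d * funConv q q (√2 • w)) := by
  obtain ⟨M, hM⟩ := h.bounded
  have hcont := h.continuous_funConv hq
  have hc : Continuous fun w : 𝔼 => √2 ^ d * funConv q q (√2 • w) := by fun_prop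
  have h0 : ∀ w : 𝔼, 0 ≤ √2 ^ d * funConv q q (√2 • w) := fun w =>
    mul_nonneg (by positivity) (integral_nonneg fun y => mul_nonneg (h.nonneg _) (h.nonneg _))
  have hconv : ∀ z, funConv q q z = measConv P q z := fun z => by
    rw [measConv, h.integral_eq, funConv]
    simp only [mul_comm]
  refine ⟨hc.measurable, h0, ⟨√2 ^ d * M, fun w => ?_⟩, ?_⟩
  · refine mul_le_mul_of_nonneg_left ?_ (by positivity)
    rw [hconv]
    exact (le_abs_self _).trans (abs_measConv_le_of_abs_le (fun z => by
      rw [abs_of_nonneg (h.nonneg z)]; exact hM z) _)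
  have hint : Integrable fun w : 𝔼 => √2 ^ d * funConv q q (√2 • w) := by
    rw [funext hconv]
    exact ((integrable_measConv h.integrable).comp_smul (by positivity)).const_mul _
  have : IsFiniteMeasure (volume.withDensity fun w : 𝔼 =>
      ENNReal.ofReal (√2 ^ d * funConv q q (√2 • w))) := isFiniteMeasure_withDensity_ofReal hint.2
  -- The two finite measures are compared on bounded continuous functions, where Fubini and the
  -- dilation formula identify the integrals.
  refine ext_of_forall_integral_eq_of_IsFiniteMeasure fun φ => ?_
  have hφc : Continuous fun z : 𝔼 => φ ((√2)⁻¹ • z) := φ.continuous.comp (by fun_prop)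
  have hφp : Continuous fun p : 𝔼 × 𝔼 => φ ((√2)⁻¹ • (p.1 + p.2)) :=
    φ.continuous.comp (by fun_prop)
  have i1 : Integrable (fun p : 𝔼 × 𝔼 => φ ((√2)⁻¹ • (p.1 + p.2)) * q p.2) (P.prod volume) :=
    (h.integrable.comp_snd P).bdd_mul (c := ‖φ‖) hφp.aestronglyMeasurable
      (Eventually.of_forall fun p => φ.norm_coe_le_norm _)
  have i2 : Integrable (fun p : 𝔼 × 𝔼 => φ ((√2)⁻¹ • (p.1 + p.2))) (P.prod P) :=
    (integrable_const ‖φ‖).mono' hφp.aestronglyMeasurable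
      (Eventually.of_forall fun p => φ.norm_coe_le_norm _)
  have e1 : ∫ w, φ w ∂EntropyJump.selfConv P =
      ∫ y, (∫ z, φ ((√2)⁻¹ • (y + z)) * q z) ∂P := by
    rw [EntropyJump.selfConv, integral_map measurable_selfConv.aemeasurable
      φ.continuous.aestronglyMeasurable, integral_prod _ i2]
    refine integral_congr_ae (Eventually.of_forall fun y => ?_)
    simp only
    rw [h.integral_eq]
    simp only [mul_comm]
  rw [e1, integral_withDensity_ofReal hc.aemeasurable h0,
    ← integral_mul_measConv (φ := fun z => φ ((√2)⁻¹ • z)) i1]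
  have e2 : ∀ w : 𝔼, (√2 ^ d * funConv q q (√2 • w)) • φ w =
      √2 ^ d * (φ ((√2)⁻¹ • (√2 • w)) * measConv P q (√2 • w)) := fun w => by
    rw [smul_smul, inv_mul_cancel₀ (by positivity), one_smul, hconv, smul_eq_mul]
    ring
  simp_rw [e2]
  rw [integral_const_mul, Measure.integral_comp_smul volume
    (fun z => φ ((√2)⁻¹ • z) * measConv P q z), finrank_euclideanSpace, Fintype.card_fin,
    abs_of_pos (by positivity), smul_eq_mul, mul_inv_cancel_left₀ (by positivity)]

lemma IsIsotropicMeasure.selfConv (hP : IsIsotropicMeasure P) :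
    IsIsotropicMeasure (selfConv P) := by
  have ha := measurable_selfConv (d := d).aemeasurable (μ := P.prod P)
  have h2 : (√2)⁻¹ * (√2)⁻¹ = (2⁻¹ : ℝ) := by
    rw [← mul_inv, mul_self_sqrt zero_le_two]
  have i1 := fun i => integrable_coord hP.integrable_sq i
  have i2 := fun i j => integrable_coord_mul_coord hP.integrable_sq i j
  refine ⟨?_, fun i => ?_, fun i j => ?_⟩
  · rw [EntropyJump.selfConv, integrable_map_measure (by fun_prop) ha]
    refine ((hP.integrable_sq.comp_fst P).add (hP.integrable_sq.comp_snd P)).mono'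
      (by fun_prop) (Eventually.of_forall fun p => ?_)
    have h3 := norm_sq_add_le p.1 p.2
    have h4 : ‖(√2)⁻¹ • (p.1 + p.2)‖ ^ 2 = 2⁻¹ * ‖p.1 + p.2‖ ^ 2 := by
      rw [norm_smul, mul_pow, sq ‖(√2)⁻¹‖, norm_of_nonneg (by positivity), h2]
    simp only [Function.comp_apply, Pi.add_apply]
    rw [norm_of_nonneg (sq_nonneg _), h4]
    linarith
  · rw [EntropyJump.selfConv, integral_map ha (by fun_prop)]
    simp only [PiLp.smul_apply, PiLp.add_apply, smul_eq_mul]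
    rw [integral_const_mul, integral_add ((i1 i).comp_fst P) ((i1 i).comp_snd P),
      integral_fun_fst (fun x : 𝔼 => x i), integral_fun_snd (fun x : 𝔼 => x i), hP.mean]
    simp
  · rw [EntropyJump.selfConv, integral_map ha (by fun_prop)]
    have e : ∀ p : 𝔼 × 𝔼, ((√2)⁻¹ • (p.1 + p.2)) i * ((√2)⁻¹ • (p.1 + p.2)) j =
        2⁻¹ * (p.1 i * p.1 j + (p.1 i * p.2 j + (p.1 j * p.2 i + p.2 i * p.2 j))) := fun p => by
      simp only [PiLp.smul_apply, PiLp.add_apply, smul_eq_mul]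
      rw [← h2]; ring
    simp_rw [e]
    rw [integral_const_mul, integral_add_four ((i2 i j).comp_fst P) ((i1 i).mul_prod (i1 j))
      ((i1 j).mul_prod (i1 i)) ((i2 i j).comp_snd P), integral_fun_fst (fun x : 𝔼 => x i * x j),
      integral_fun_snd (fun x : 𝔼 => x i * x j), integral_prod_mul (fun x : 𝔼 => x i) fun x : 𝔼 => x j,
      integral_prod_mul (fun x : 𝔼 => x j) fun x : 𝔼 => x i]
    simp only [hP.cov, hP.mean, probReal_univ, one_smul]
    split_ifs <;> norm_num

end Density

section Entropy

variable {Ω : Type*} [MeasurableSpace Ω] {μ : Measure Ω} {Z : Ω → EuclideanSpace ℝ (Fin d)}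
  {P : Measure (EuclideanSpace ℝ (Fin d))} {q : EuclideanSpace ℝ (Fin d) → ℝ}

lemma IsBoundedDensity.pdf_ae_eq (h : IsBoundedDensity P q) (hZP : μ.map Z = P) :
    (fun x => (pdf Z μ volume x).toReal * log (pdf Z μ volume x).toReal) =ᵐ[volume]
      fun x => q x * log (q x) := by
  have h1 : pdf Z μ volume =ᵐ[volume] fun x => ENNReal.ofReal (q x) := by
    rw [pdf_def, hZP, h.eq]
    exact Measure.rnDeriv_withDensity _ h.measurable.ennreal_ofReal
  filter_upwards [h1] with x hx
  rw [hx, ENNReal.toReal_ofReal (h.nonneg x)]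

lemma IsBoundedDensity.entropy_eq (h : IsBoundedDensity P q) (hZP : μ.map Z = P) :
    entropy Z μ = -∫ x, q x * log (q x) := by
  rw [entropy, integral_congr_ae (h.pdf_ae_eq hZP)]

lemma IsBoundedDensity.hasFiniteEntropy [IsProbabilityMeasure P] (h : IsBoundedDensity P q)
    (hZ : AEMeasurable Z μ) (hZP : μ.map Z = P) (hP : Integrable (fun x : 𝔼 => ‖x‖ ^ 2) P) :
    HasFiniteEntropy Z μ := by
  refine ⟨?_, (h.integrable_mul_log hP).congr (h.pdf_ae_eq hZP).symm⟩
  rw [hasPDF_iff_of_aemeasurable hZ, hZP]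
  refine ⟨inferInstance, ?_⟩
  rw [h.eq]
  exact withDensity_absolutelyContinuous _ _

lemma IsIsotropic.isIsotropicMeasure [IsProbabilityMeasure μ] (hZ : IsIsotropic Z μ) (ha : AEMeasurable Z μ)
    (hZP : μ.map Z = P) : IsIsotropicMeasure P := by
  subst hZP
  refine ⟨?_, fun i => ?_, fun i j => ?_⟩
  · rw [integrable_map_measure (by fun_prop) ha]
    exact hZ.memLp_two.integrable_norm_pow two_ne_zero
  · rw [integral_map ha (by fun_prop)]
    have h := (EuclideanSpace.proj (𝕜 := ℝ) i : 𝔼 →L[ℝ] ℝ).integral_comp_comm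
      (hZ.memLp_two.integrable (by norm_num))
    rw [hZ.mean_eq_zero, map_zero] at h
    exact h
  · rw [integral_map ha (by fun_prop)]
    exact hZ.covariance_eq_one i j

end Entropy

end RandomVectors
end EntropyJump

/-! ### The entropy jump: letting t tend to zero -/

theorem theorem1p1 {d : ℕ} {Ω Ω' : Type*} [MeasurableSpace Ω] [MeasurableSpace Ω']
    (μ : Measure Ω) [IsProbabilityMeasure μ] (ν : Measure Ω')
    (X Y : Ω → EuclideanSpace ℝ (Fin d)) (G : Ω' → EuclideanSpace ℝ (Fin d))
    (f : EuclideanSpace ℝ (Fin d) → ℝ) (c : ℝ)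
    (hXf : EntropyJump.HasDensity X μ f)
    (hf : EntropyJump.IsLogConcave f)
    (hX : EntropyJump.IsIsotropic X μ)
    (hc : 0 < c) (hfc : EntropyJump.SatisfiesPoincare f c)
    (hXY : IndepFun X Y μ) (hY : IdentDistrib Y X μ μ)
    (hG : HasLaw G (stdGaussian (EuclideanSpace ℝ (Fin d))) ν) :
    EntropyJump.HasFiniteEntropy X μ ∧
    EntropyJump.HasFiniteEntropy (fun ω => (√2 : ℝ)⁻¹ • (X ω + Y ω)) μ ∧
    EntropyJump.HasFiniteEntropy G ν ∧
    EntropyJump.entropy (fun ω => (√2 : ℝ)⁻¹ • (X ω + Y ω)) μ - EntropyJump.entropy X μ ≥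
      c / (4 * (1 + c)) * (EntropyJump.entropy G ν - EntropyJump.entropy X μ) := by
  have hPprob : IsProbabilityMeasure (μ.map X) :=
    Measure.isProbabilityMeasure_map hXf.aemeasurable
  have hP := hX.isIsotropicMeasure hXf.aemeasurable rfl
  have hdens := hf.isBoundedDensity hXf.map_eq
  have hdens' := hdens.selfConv (EntropyJump.ae_continuousAt_interiorPart hf)
  have hcont : Continuous fun w : EuclideanSpace ℝ (Fin d) => √2 ^ d *
      EntropyJump.funConv (EntropyJump.interiorPart f) (EntropyJump.interiorPart f) (√2 • w) := by
    have := hdens.continuous_funConv (EntropyJump.ae_continuousAt_interiorPart hf)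
    fun_prop
  have hP' := hP.selfConv
  have hpair : AEMeasurable (fun ω => (X ω, Y ω)) μ :=
    hXf.aemeasurable.prodMk hY.aemeasurable_fst
  have hZ : AEMeasurable (fun ω => (√2 : ℝ)⁻¹ • (X ω + Y ω)) μ :=
    EntropyJump.measurable_selfConv.comp_aemeasurable hpair
  have hZmap : μ.map (fun ω => (√2 : ℝ)⁻¹ • (X ω + Y ω)) = EntropyJump.selfConv (μ.map X) := by
    have h1 := (indepFun_iff_map_prod_eq_prod_map_map hXf.aemeasurable hY.aemeasurable_fst).1 hXY
    rw [hY.map_eq] at h1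
    rw [EntropyJump.selfConv, ← h1, AEMeasurable.map_map_of_aemeasurable
      EntropyJump.measurable_selfConv.aemeasurable hpair]
    rfl
  have hgauss := EntropyJump.integral_heatKernel_mul_log (d := d) one_pos
  have hGdens := EntropyJump.isBoundedDensity_stdGaussian (d := d)
  have hGsq : Integrable (fun x : EuclideanSpace ℝ (Fin d) => ‖x‖ ^ 2)
      (stdGaussian (EuclideanSpace ℝ (Fin d))) :=
    (EntropyJump.integrable_stdGaussian_iff _).2
      (EntropyJump.integrable_norm_sq_mul_heatKernel one_pos)
  refine ⟨hdens.hasFiniteEntropy hXf.aemeasurable rfl hP.integrable_sq,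
    hdens'.hasFiniteEntropy hZ hZmap hP'.integrable_sq,
    hGdens.hasFiniteEntropy hG.aemeasurable hG.map_eq hGsq, ?_⟩
  rw [hdens.entropy_eq rfl, hdens'.entropy_eq hZmap, hGdens.entropy_eq hG.map_eq, hgauss.2, neg_neg]
  have hlip := hfc.lipPoincare hXf.aemeasurable_density hf.1 hXf.map_eq hP.integrable_sq
  have hlc := fun t (ht : 0 < t) =>
    (EntropyJump.midLogConcave_interiorPart hf).heatFlow hdens ht
  set κ := c / (4 * (1 + c)) with hκ
  have hκ0 : 0 ≤ κ := by positivity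
  -- This keeps the weight 1 - κ of Ent X nonnegative, so E₁(t) may be replaced by its lower bound
  -- Ent X.
  have hκ1 : κ ≤ 1 := by
    rw [hκ, div_le_one (by positivity)]
    linarith
  -- The inequality at time t reads E₂ ≥ (1 - κ) E₁ + κ g. Both terms on the right are at least
  -- their values at time zero, so this R is a lower bound of E₂ uniform in t. Convergence of E₁ as
  -- t → 0 is never needed.
  have key := hdens'.le_of_forall_le_flowEntropy hcont hP'
    (R := (1 - κ) * (-∫ x, EntropyJump.interiorPart f x * Real.log (EntropyJump.interiorPart f x)) +
      κ * EntropyJump.gaussEntropy d 1) fun t ht => by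
    have h1 := EntropyJump.flowEntropy_selfConv_sub_ge hlip hc hP hP' hlc ht
    have h2 := mul_le_mul_of_nonneg_left (hdens.le_flowEntropy hP.integrable_sq ht)
      (sub_nonneg.2 hκ1)
    have h3 := mul_le_mul_of_nonneg_left (EntropyJump.gaussEntropy_mono d one_pos
      (by linarith : (1 : ℝ) ≤ 1 + t)) hκ0
    linarith
  rw [ge_iff_le]
  linarith
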